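/- **The calculus.** There are two fragments. *Pure propositions* are $P ::= \top \mid 1 \mid P\multimap P \mid P \,\&\, P \mid P\otimes P$, and *mixed propositions* are $A ::= 0 \mid 1 \mid A\multimap A \mid A\oplus A\mid A\otimes A \mid \mathcal B(P)$ with $P$ pure. Scalars $\alpha$ are complex numbers in the pure fragment and nonnegative reals in the mixed one. *Terms* (up to $\alpha$-equivalence) of both fragments are $x,\ M+N,\ \alpha\cdot M,\ *,\ \delta_1(M,N),\ \lambda x.M,\ M\,N,\ M\otimes N,\ \delta_\otimes(M,xy.N)$; pure terms are also $\langle\rangle,\ \langle m,n\rangle,\ \delta^1_\&(m,x.n),\ \delta^2_\&(m,x.n)$, and mixed terms are also $\delta_0(m),\ \mathrm{inl}(m),\ \mathrm{inr}(m),\ \delta_\oplus(m,x.n,y.o),\ \mathcal B(m)$ with $m$ pure, $\tau(m)$. Judgements $\Gamma\vdash M:S$ are derived by the natural deduction rules of intuitionistic multiplicative additive linear logic with exchange: axiom $x:S\vdash x:S$; $\Gamma\vdash\langle\rangle:\top$ for all $\Gamma$; from $\Gamma\vdash m:0$ infer $\Gamma,\Delta\vdash\delta_0(m):A$; the usual introduction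 and elimination rules of $1,\multimap,\otimes$ (both fragments), $\&$ (pure), $\oplus$ (mixed), where $\delta_1,\delta_\otimes,\delta^i_\&,\delta_\oplus$ and application divide the context between the eliminated term and the other premises, and $\langle m,n\rangle$ and the two branches of $\delta_\oplus$ share it; and the rules: from $\Gamma\vdash M:S$ and $\Gamma\vdash N:S$ infer $\Gamma\vdash M+N:S$ and $\Gamma\vdash\alpha\cdot M:S$; from $\vdash m:P$ (closed, pure) infer $\vdash\mathcal B(m):\mathcal B(P)$; from $\Gamma\vdash m:\mathcal B(P\multimap Q)$ and $\Delta\vdash n:\mathcal B(P)$ infer $\Gamma,\Delta\vdash m\,n:\mathcal B(Q)$; from $\Gamma\vdash m:\mathcal B(P)\otimes\mathcal B(Q)$ infer $\Gamma\vdash\tau(m):\mathcal B(P\otimes Q)$. **Values.** Base values $v_b$, non-combination values $v_n$ and values $v$ are given, in the pure fragment, by $v_b ::= *\mid x\mid v_n\otimes v_n$ and $v_n ::= \langle\rangle\mid\lambda x.m\mid\langle v,v\rangle\mid v_b$; in the mixed fragment, by $v_b ::= *\mid x\mid\mathrm{inl}(v_n)\mid\mathrm{inr}(v_n)\mid v_n\otimes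 v_n\mid\mathcal B(v)$ (with $v$ a pure value) and $v_n::=\lambda x.m\mid v_b$; and in both by $v::=v_n\mid\sum_i\alpha_i\cdot v_{b,i}+\sum_j v_{b,j}\mid\sum_i 0\cdot v_{b,i}$ with $\alpha_i\ne0,1$ and pairwise distinct base values in each sum. Values of either fragment are written $V,W$. All sums below are nonempty. **Reduction.** The relation $\leftrightarrows$, between terms of the same judgement, is the congruence generated by $1\cdot M\leftrightarrows M$; commutativity and associativity of $+$; $\alpha\cdot M+\beta\cdot M\leftrightarrows(\alpha+\beta)\cdot M$; $\alpha\cdot(\beta\cdot M)\leftrightarrows\alpha\beta\cdot M$; $\alpha\cdot(M_1+M_2)\leftrightarrows\alpha\cdot M_1+\alpha\cdot M_2$; $M+0\cdot N\leftrightarrows M$ if $M$ is not of the form $0\cdot M'$; and bilinearity of $\otimes$. *Algebraic forms* are the linear combinations $\sum_i\alpha_i\cdot\mathfrak b_i$ of pairwise distinct base forms whose coefficients are all nonzero or all zero (a coefficient $1$ may be omitted), where a *base form* is a term not of the form $M+N$ or $\alpha\cdot M$ whose immediate subterms are base forms if it is $M\otimes N$, and algebraic forms otherwise. The relation $\to$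 is generated by the rules $\delta_1(\alpha\cdot *,M)\to\alpha\cdot M$; $(\lambda x.M)V\to(V/x)M$; $\delta^i_\&(\langle v_1,v_2\rangle,x.t)\to(v_i/x)t$; $\delta_\oplus(\mathrm{inl}(v),x.m,y.n)\to(v/x)m$; $\delta_\oplus(\mathrm{inr}(v),x.m,y.n)\to(v/y)n$; $\delta_\otimes(V_n\otimes W_n,xy.M)\to(V_n/x,W_n/y)M$; $a\cdot\langle\rangle\to\langle\rangle$; $\sum_i\alpha_i\cdot\lambda x.M_i\to\lambda x.\sum_i\alpha_i\cdot M_i$; $\sum_i a_i\cdot\langle v_i,w_i\rangle\to\langle\sum_i a_i\cdot v_i,\sum_i a_i\cdot w_i\rangle$; $F(\sum_i\alpha_i\cdot V_{b,i})\to\sum_i\alpha_i\cdot F(V_{b,i})$ for $F=\delta_\oplus(-,x.o,y.s),\ \delta_\otimes(-,xy.M),\ \mathrm{inl},\ \mathrm{inr},\ \tau$; $\tau(\mathcal B(v)\otimes\mathcal B(w))\to\mathcal B(v\otimes w)$; $\mathcal B(a\cdot v_b)\to|a|^2\cdot\mathcal B(v_b)$ if $a\neq1$; $(\sum_i p_i\cdot\mathcal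 B(v_i))(\sum_j q_j\cdot\mathcal B(w_j))\to\sum_{i,j}p_iq_j\cdot\mathcal B(v_i\,w_j)$ (the summands on the left of each rule being pairwise distinct), closed under the evaluation contexts $K::=[.]\mid K+M\mid\alpha\cdot K\mid\delta_0(K)\mid\delta_1(K,M)\mid K\,M\mid V\,K\mid\langle K,m\rangle\mid\langle v,K\rangle\mid\delta^i_\&(K,x.m)\mid\mathrm{inl}(K)\mid\mathrm{inr}(K)\mid\delta_\oplus(K,x.m,y.n)\mid K\otimes M\mid V\otimes K\mid\delta_\otimes(K,xy.M)\mid\mathcal B(K)\mid\tau(K)$. Finally $M\hookrightarrow N$ holds if (i) $M\to N$; or (ii) $M\leftrightarrows N$ and $N$ is a value; or (iii) $M$ has no $\to$-reduct and there is an algebraic form $\mathfrak a$ with $M\leftrightarrows\mathfrak a\to N$. Let $\hookrightarrow^*$ be its reflexive transitive closure. **Denotations.** Pure propositions denote finite-dimensional Hilbert spaces and mixed ones finite-dimensional C*-algebras: $[\![\top]\!]=0$, $[\![0]\!]=0$, $[\![1]\!]=\mathbb C$, $[\![S\multimap T]\!]=[\![S]\!]^*\otimes[\![T]\!]$, $[\![S\otimes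 T]\!]=[\![S]\!]\otimes[\![T]\!]$, $[\![P\,\&\,Q]\!]=[\![P]\!]\oplus[\![Q]\!]$, $[\![A\oplus B]\!]=[\![A]\!]\oplus[\![B]\!]$, and $[\![\mathcal B(P)]\!]$ is the algebra of operators on $[\![P]\!]$. A context denotes the tensor product of its propositions. A derivation of $\Gamma\vdash M:T$ denotes a linear map $[\![\Gamma]\!]\to[\![T]\!]$ (completely positive in the mixed fragment), given by the standard interpretation of linear logic in these compact closed categories with biproducts; $+$ and $\alpha\cdot$ denote the pointwise sum and scalar multiple, $\langle\rangle$ and $\delta_0(m)$ denote zero maps, $\mathcal B(m)$ denotes $\mathcal B([\![m]\!])$, where $\mathcal B(f)=f(\cdot)f^\dagger$, the application $m\,n$ at $\mathcal B(P\multimap Q)$ denotes $\mathcal B(\mathrm{eval})\circ\tau\circ([\![m]\!]\otimes[\![n]\!])$, and $\tau(m)$ denotes $\tau\circ[\![m]\!]$, with $\tau:\mathcal B(H)\otimes\mathcal B(K)\cong\mathcal B(H\otimes K)$ the canonical isomorphism. **Contextual equivalence.** Elimination contexts are the terms $E::=[.]\mid\delta_0(E)\mid\delta_1(E,M)\mid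 E\,M\mid\delta^1_\&(E,x.m)\mid\delta^2_\&(E,x.m)\mid\delta_\oplus(E,x.m,y.n)\mid\delta_\otimes(E,xy.M)$ whose only free variable is the hole $[.]$. Closed terms $M,N$ of the same proposition $T$ are contextually equivalent, $M\sim N$, if for every elimination context $[.]:T\vdash E:T'$ with $T'$ equal to $1$ (pure or mixed, in the fragment of $T$) or to $\mathcal B(1)$, there is a value $V$ such that $E[M]\hookrightarrow^*V$ and $E[N]\hookrightarrow^*V$. **Theorem (Adequacy).** If $\vdash M:T$ and $\vdash N:T$ (in either fragment) have equal denotations, $[\![\vdash M:T]\!]=[\![\vdash N:T]\!]$, then $M\sim N$. -/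

import Mathlib

open scoped NNReal BigOperators

namespace BImall

/-! ## Propositions and terms

The two fragments of the calculus (pure and mixed) share most of their constructors, so that
propositions and terms are families indexed by the fragment. -/

/-- The two fragments. -/
inductive Frag : Type
  | pure
  | mixed

/-- Scalars: complex numbers in the pure fragment, nonnegative reals in the mixed one. -/
def Scal : Frag → Type
  | .pure => ℂ
  | .mixed => ℝ≥0

noncomputable instance instCommSemiringScal : (f : Frag) → CommSemiring (Scal f)
  | .pure => inferInstanceAs (CommSemiring ℂ)
  | .mixed => inferInstanceAs (CommSemiring ℝ≥0)

/-- A scalar of either fragment, as a complex number. -/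
noncomputable def Scal.toComplex : {f : Frag} → Scal f → ℂ
  | .pure => fun a => (show ℂ from a)
  | .mixed => fun p => (((show ℝ≥0 from p) : ℝ) : ℂ)

/-- The mixed scalar `|a|²` of a pure scalar `a`. -/
noncomputable def Scal.normSq (a : Scal .pure) : Scal .mixed :=
  (show ℝ≥0 from ‖Scal.toComplex a‖₊ ^ 2)

/-- Propositions: `⊤, 1, P ⊸ Q, P & Q, P ⊗ Q` (pure) and
`0, 1, A ⊸ B, A ⊕ B, A ⊗ B, 𝓑(P)` (mixed). -/
inductive Prp : Frag → Type
  | top : Prp .pure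
  | zero : Prp .mixed
  | one {f : Frag} : Prp f
  | lolli {f : Frag} (S T : Prp f) : Prp f
  | tensor {f : Frag} (S T : Prp f) : Prp f
  | amp (P Q : Prp .pure) : Prp .pure
  | plus (A B : Prp .mixed) : Prp .mixed
  | B (P : Prp .pure) : Prp .mixed

/-- Proof terms modulo `α`-equivalence, with de Bruijn indices.  `lam`, the branches of
`elimWith₁`, `elimWith₂`, `elimPlus` bind one variable (index `0`); the branch of `elimTens`, that
is `δ⊗(m, x y. n)`, binds two variables (`y` has index `0` and `x` has index `1`).
The variables of the pure term `m` inside the mixed term `B m` are pure variables, and are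
unrelated to the mixed variables around it. -/
inductive Tm : Frag → Type
  | var {f : Frag} (i : ℕ) : Tm f
  | add {f : Frag} (M N : Tm f) : Tm f
  | smul {f : Frag} (a : Scal f) (M : Tm f) : Tm f
  | star {f : Frag} : Tm f
  | elimOne {f : Frag} (M N : Tm f) : Tm f
  | lam {f : Frag} (M : Tm f) : Tm f
  | app {f : Frag} (M N : Tm f) : Tm f
  | tens {f : Frag} (M N : Tm f) : Tm f
  | elimTens {f : Frag} (M N : Tm f) : Tm f
  | topI : Tm .pure
  | pair (m n : Tm .pure) : Tm .pure
  | elimWith₁ (m n : Tm .pure) : Tm .pure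
  | elimWith₂ (m n : Tm .pure) : Tm .pure
  | elimZero (m : Tm .mixed) : Tm .mixed
  | inl (m : Tm .mixed) : Tm .mixed
  | inr (m : Tm .mixed) : Tm .mixed
  | elimPlus (m n o : Tm .mixed) : Tm .mixed
  | B (m : Tm .pure) : Tm .mixed
  | tau (m : Tm .mixed) : Tm .mixed

/-- The action of a renaming under one binder. -/
def liftRen (r : ℕ → ℕ) : ℕ → ℕ
  | 0 => 0
  | n + 1 => r n + 1

/-- Renaming of variables. -/
def Tm.rename : {f : Frag} → (ℕ → ℕ) → Tm f → Tm f
  | _, r, .var i => .var (r i)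
  | _, r, .add M N => .add (M.rename r) (N.rename r)
  | _, r, .smul a M => .smul a (M.rename r)
  | _, _, .star => .star
  | _, r, .elimOne M N => .elimOne (M.rename r) (N.rename r)
  | _, r, .lam M => .lam (M.rename (liftRen r))
  | _, r, .app M N => .app (M.rename r) (N.rename r)
  | _, r, .tens M N => .tens (M.rename r) (N.rename r)
  | _, r, .elimTens M N => .elimTens (M.rename r) (N.rename (liftRen (liftRen r)))
  | _, _, .topI => .topI
  | _, r, .pair m n => .pair (m.rename r) (n.rename r)
  | _, r, .elimWith₁ m n => .elimWith₁ (m.rename r) (n.rename (liftRen r))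
  | _, r, .elimWith₂ m n => .elimWith₂ (m.rename r) (n.rename (liftRen r))
  | _, r, .elimZero m => .elimZero (m.rename r)
  | _, r, .inl m => .inl (m.rename r)
  | _, r, .inr m => .inr (m.rename r)
  | _, r, .elimPlus m n o =>
      .elimPlus (m.rename r) (n.rename (liftRen r)) (o.rename (liftRen r))
  | _, _, .B m => .B m
  | _, r, .tau m => .tau (m.rename r)

/-- The action of a substitution under one binder. -/
def liftSub {f : Frag} (s : ℕ → Tm f) : ℕ → Tm f
  | 0 => .var 0
  | n + 1 => (s n).rename Nat.succ

/-- Simultaneous capture-avoiding substitution. -/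
def Tm.subst : {f : Frag} → (ℕ → Tm f) → Tm f → Tm f
  | _, s, .var i => s i
  | _, s, .add M N => .add (M.subst s) (N.subst s)
  | _, s, .smul a M => .smul a (M.subst s)
  | _, _, .star => .star
  | _, s, .elimOne M N => .elimOne (M.subst s) (N.subst s)
  | _, s, .lam M => .lam (M.subst (liftSub s))
  | _, s, .app M N => .app (M.subst s) (N.subst s)
  | _, s, .tens M N => .tens (M.subst s) (N.subst s)
  | _, s, .elimTens M N => .elimTens (M.subst s) (N.subst (liftSub (liftSub s)))
  | _, _, .topI => .topI
  | _, s, .pair m n => .pair (m.subst s) (n.subst s)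
  | _, s, .elimWith₁ m n => .elimWith₁ (m.subst s) (n.subst (liftSub s))
  | _, s, .elimWith₂ m n => .elimWith₂ (m.subst s) (n.subst (liftSub s))
  | _, s, .elimZero m => .elimZero (m.subst s)
  | _, s, .inl m => .inl (m.subst s)
  | _, s, .inr m => .inr (m.subst s)
  | _, s, .elimPlus m n o =>
      .elimPlus (m.subst s) (n.subst (liftSub s)) (o.subst (liftSub s))
  | _, _, .B m => .B m
  | _, s, .tau m => .tau (m.subst s)

/-- `(V/x)M`, where `x` is the variable with index `0` in `M`. -/
def Tm.inst {f : Frag} (V M : Tm f) : Tm f :=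
  M.subst (fun
    | 0 => V
    | n + 1 => .var n)

/-- `(V/x, W/y)M`, where `x`, `y` have indices `1`, `0` in `M`. -/
def Tm.inst₂ {f : Frag} (V W M : Tm f) : Tm f :=
  M.subst (fun
    | 0 => W
    | 1 => V
    | n + 2 => .var n)

/-! ## Derivations

A context lists the declarations of the variables with indices `0, 1, 2, …`; an entry `none`
stands for a variable that is not declared (it belongs to the other part of a context that was
divided between two premises).  The context `Γ, Δ` of a rule with two premises is divided in an
arbitrary way between them, so that the exchange rule is built in. -/

/-- Contexts. -/
abbrev Ctx (f : Frag) : Type := List (Option (Prp f))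

/-- `Empty Γ`: the context `Γ` declares no variable. -/
def Ctx.Empty {f : Frag} (Γ : Ctx f) : Prop := ∀ o ∈ Γ, o = none

/-- `Only Γ i S`: the only declaration in `Γ` is that of the variable `i`, with proposition `S`. -/
inductive Only : {f : Frag} → Ctx f → ℕ → Prp f → Type
  | here {f : Frag} {Γ : Ctx f} {S : Prp f} (h : Γ.Empty) : Only (some S :: Γ) 0 S
  | there {f : Frag} {Γ : Ctx f} {i : ℕ} {S : Prp f} (h : Only Γ i S) :
      Only (none :: Γ) (i + 1) S

/-- `Split Γ Γ₁ Γ₂`: each declaration of `Γ` goes to exactly one of `Γ₁` and `Γ₂`. -/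
inductive Split : {f : Frag} → Ctx f → Ctx f → Ctx f → Type
  | nil {f : Frag} : Split ([] : Ctx f) [] []
  | none {f : Frag} {Γ Γ₁ Γ₂ : Ctx f} (h : Split Γ Γ₁ Γ₂) :
      Split (Option.none :: Γ) (Option.none :: Γ₁) (Option.none :: Γ₂)
  | left {f : Frag} {Γ Γ₁ Γ₂ : Ctx f} (S : Prp f) (h : Split Γ Γ₁ Γ₂) :
      Split (some S :: Γ) (some S :: Γ₁) (Option.none :: Γ₂)
  | right {f : Frag} {Γ Γ₁ Γ₂ : Ctx f} (S : Prp f) (h : Split Γ Γ₁ Γ₂) :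
      Split (some S :: Γ) (Option.none :: Γ₁) (some S :: Γ₂)

/-- Derivations of the judgement `Γ ⊢ M : T`. -/
inductive Der : {f : Frag} → Ctx f → Tm f → Prp f → Type
  | ax {f : Frag} {Γ : Ctx f} {i : ℕ} {S : Prp f} (h : Only Γ i S) : Der Γ (.var i) S
  | sum {f : Frag} {Γ : Ctx f} {M N : Tm f} {S : Prp f} (d : Der Γ M S) (e : Der Γ N S) :
      Der Γ (.add M N) S
  | prod {f : Frag} {Γ : Ctx f} {M : Tm f} {S : Prp f} (a : Scal f) (d : Der Γ M S) :
      Der Γ (.smul a M) S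
  | topI (Γ : Ctx .pure) : Der Γ .topI .top
  | zeroE {Γ Γ₁ Γ₂ : Ctx .mixed} {m : Tm .mixed} (A : Prp .mixed) (h : Split Γ Γ₁ Γ₂)
      (d : Der Γ₁ m .zero) : Der Γ (.elimZero m) A
  | oneI {f : Frag} {Γ : Ctx f} (h : Γ.Empty) : Der Γ .star .one
  | oneE {f : Frag} {Γ Γ₁ Γ₂ : Ctx f} {M N : Tm f} {S : Prp f} (h : Split Γ Γ₁ Γ₂)
      (d : Der Γ₁ M .one) (e : Der Γ₂ N S) : Der Γ (.elimOne M N) S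
  | lolliI {f : Frag} {Γ : Ctx f} {M : Tm f} {S T : Prp f} (d : Der (some S :: Γ) M T) :
      Der Γ (.lam M) (.lolli S T)
  | lolliE {f : Frag} {Γ Γ₁ Γ₂ : Ctx f} {M N : Tm f} {S T : Prp f} (h : Split Γ Γ₁ Γ₂)
      (d : Der Γ₁ M (.lolli S T)) (e : Der Γ₂ N S) : Der Γ (.app M N) T
  | ampI {Γ : Ctx .pure} {m n : Tm .pure} {P Q : Prp .pure} (d : Der Γ m P) (e : Der Γ n Q) :
      Der Γ (.pair m n) (.amp P Q)
  | ampE₁ {Γ Γ₁ Γ₂ : Ctx .pure} {m n : Tm .pure} {P Q R : Prp .pure} (h : Split Γ Γ₁ Γ₂)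
      (d : Der Γ₁ m (.amp P Q)) (e : Der (some P :: Γ₂) n R) : Der Γ (.elimWith₁ m n) R
  | ampE₂ {Γ Γ₁ Γ₂ : Ctx .pure} {m n : Tm .pure} {P Q R : Prp .pure} (h : Split Γ Γ₁ Γ₂)
      (d : Der Γ₁ m (.amp P Q)) (e : Der (some Q :: Γ₂) n R) : Der Γ (.elimWith₂ m n) R
  | plusI₁ {Γ : Ctx .mixed} {m : Tm .mixed} {A : Prp .mixed} (C : Prp .mixed) (d : Der Γ m A) :
      Der Γ (.inl m) (.plus A C)
  | plusI₂ {Γ : Ctx .mixed} {n : Tm .mixed} {C : Prp .mixed} (A : Prp .mixed) (d : Der Γ n C) :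
      Der Γ (.inr n) (.plus A C)
  | plusE {Γ Γ₁ Γ₂ : Ctx .mixed} {m n o : Tm .mixed} {A C D : Prp .mixed} (h : Split Γ Γ₁ Γ₂)
      (d : Der Γ₁ m (.plus A C)) (e₁ : Der (some A :: Γ₂) n D) (e₂ : Der (some C :: Γ₂) o D) :
      Der Γ (.elimPlus m n o) D
  | tensI {f : Frag} {Γ Γ₁ Γ₂ : Ctx f} {M N : Tm f} {S T : Prp f} (h : Split Γ Γ₁ Γ₂)
      (d : Der Γ₁ M S) (e : Der Γ₂ N T) : Der Γ (.tens M N) (.tensor S T)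
  | tensE {f : Frag} {Γ Γ₁ Γ₂ : Ctx f} {M N : Tm f} {S₁ S₂ T : Prp f} (h : Split Γ Γ₁ Γ₂)
      (d : Der Γ₁ M (.tensor S₁ S₂)) (e : Der (some S₂ :: some S₁ :: Γ₂) N T) :
      Der Γ (.elimTens M N) T
  | BI {Γ : Ctx .mixed} {m : Tm .pure} {P : Prp .pure} (h : Γ.Empty) (d : Der [] m P) :
      Der Γ (.B m) (.B P)
  | BlolliE {Γ Γ₁ Γ₂ : Ctx .mixed} {m n : Tm .mixed} {P Q : Prp .pure} (h : Split Γ Γ₁ Γ₂)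
      (d : Der Γ₁ m (.B (.lolli P Q))) (e : Der Γ₂ n (.B P)) : Der Γ (.app m n) (.B Q)
  | Btens {Γ : Ctx .mixed} {m : Tm .mixed} {P Q : Prp .pure}
      (d : Der Γ m (.tensor (.B P) (.B Q))) : Der Γ (.tau m) (.B (.tensor P Q))

/-- The judgement `Γ ⊢ M : T` is derivable. -/
def Derivable {f : Frag} (Γ : Ctx f) (M : Tm f) (T : Prp f) : Prop := Nonempty (Der Γ M T)

/-! ## Values, algebraic forms, and reduction -/

/-- `IsSum [M₁, …, Mₙ] S`: the list is nonempty and `S` is the sum `M₁ + ⋯ + Mₙ`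
(bracketed to the left). -/
def IsSum {f : Frag} : List (Tm f) → Tm f → Prop
  | [], _ => False
  | M :: l, S => S = l.foldl Tm.add M

/-- The three syntactic classes of values: `v_b` (base), `v_n` (values that are not linear
combinations) and `v` (all values). -/
inductive VSort : Type
  | base
  | noncomb
  | full

/-- The grammar of values. -/
inductive Val : VSort → {f : Frag} → Tm f → Prop
  | star {f : Frag} : Val .base (Tm.star : Tm f)
  | var {f : Frag} (i : ℕ) : Val .base (Tm.var i : Tm f)
  | tens {f : Frag} {V W : Tm f} (h : Val .noncomb V) (k : Val .noncomb W) :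
      Val .base (.tens V W)
  | inl {v : Tm .mixed} (h : Val .noncomb v) : Val .base (.inl v)
  | inr {v : Tm .mixed} (h : Val .noncomb v) : Val .base (.inr v)
  | B {v : Tm .pure} (h : Val .full v) : Val .base (.B v)
  | topI : Val .noncomb Tm.topI
  | lam {f : Frag} (M : Tm f) : Val .noncomb (.lam M)
  | pair {v w : Tm .pure} (h : Val .full v) (k : Val .full w) : Val .noncomb (.pair v w)
  | ofBase {f : Frag} {V : Tm f} (h : Val .base V) : Val .noncomb V
  | ofNoncomb {f : Frag} {V : Tm f} (h : Val .noncomb V) : Val .full V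
  /-- `∑ᵢ aᵢ • v_bᵢ + ∑ⱼ v_bⱼ` with `aᵢ ≠ 0, 1` and pairwise distinct base values. -/
  | comb {f : Frag} (l : List (Scal f × Tm f)) (r : List (Tm f)) {V : Tm f}
      (ha : ∀ x ∈ l, x.1 ≠ 0 ∧ x.1 ≠ 1) (hl : ∀ x ∈ l, Val .base x.2)
      (hr : ∀ v ∈ r, Val .base v) (hd : (l.map Prod.snd ++ r).Nodup)
      (hV : IsSum (l.map (fun x => Tm.smul x.1 x.2) ++ r) V) : Val .full V
  /-- `∑ᵢ 0 • v_bᵢ` with pairwise distinct base values. -/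
  | zeros {f : Frag} (l : List (Tm f)) {V : Tm f} (hl : ∀ v ∈ l, Val .base v) (hd : l.Nodup)
      (hV : IsSum (l.map (Tm.smul 0)) V) : Val .full V

/-- The two syntactic classes of the grammar of algebraic forms: `𝔟` (base forms) and
`𝔞` (algebraic forms). -/
inductive FSort : Type
  | base
  | alg

/-- The grammar of base forms and algebraic forms.  An algebraic form is a linear combination
`∑ᵢ αᵢ • 𝔟ᵢ` of pairwise distinct base forms whose coefficients are all nonzero or all zero; a
summand with coefficient `1` is written either `1 • 𝔟` or `𝔟`. -/
inductive AForm : FSort → {f : Frag} → Tm f → Prop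
  | var {f : Frag} (i : ℕ) : AForm .base (Tm.var i : Tm f)
  | star {f : Frag} : AForm .base (Tm.star : Tm f)
  | elimOne {f : Frag} {M N : Tm f} (h : AForm .alg M) (k : AForm .alg N) :
      AForm .base (.elimOne M N)
  | lam {f : Frag} {M : Tm f} (h : AForm .alg M) : AForm .base (.lam M)
  | app {f : Frag} {M N : Tm f} (h : AForm .alg M) (k : AForm .alg N) : AForm .base (.app M N)
  | tens {f : Frag} {M N : Tm f} (h : AForm .base M) (k : AForm .base N) :
      AForm .base (.tens M N)
  | elimTens {f : Frag} {M N : Tm f} (h : AForm .alg M) (k : AForm .alg N) :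
      AForm .base (.elimTens M N)
  | topI : AForm .base Tm.topI
  | pair {m n : Tm .pure} (h : AForm .alg m) (k : AForm .alg n) : AForm .base (.pair m n)
  | elimWith₁ {m n : Tm .pure} (h : AForm .alg m) (k : AForm .alg n) :
      AForm .base (.elimWith₁ m n)
  | elimWith₂ {m n : Tm .pure} (h : AForm .alg m) (k : AForm .alg n) :
      AForm .base (.elimWith₂ m n)
  | elimZero {m : Tm .mixed} (h : AForm .alg m) : AForm .base (.elimZero m)
  | inl {m : Tm .mixed} (h : AForm .alg m) : AForm .base (.inl m)
  | inr {m : Tm .mixed} (h : AForm .alg m) : AForm .base (.inr m)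
  | elimPlus {m n o : Tm .mixed} (h : AForm .alg m) (k : AForm .alg n) (j : AForm .alg o) :
      AForm .base (.elimPlus m n o)
  | B {m : Tm .pure} (h : AForm .alg m) : AForm .base (.B m)
  | tau {m : Tm .mixed} (h : AForm .alg m) : AForm .base (.tau m)
  | comb {f : Frag} (l : List (Scal f × Tm f)) (ts : List (Tm f)) {M : Tm f}
      (ha : (∀ x ∈ l, x.1 ≠ 0) ∨ (∀ x ∈ l, x.1 = 0)) (hl : ∀ x ∈ l, AForm .base x.2)
      (hd : (l.map Prod.snd).Nodup)
      (ht : List.Forall₂ (fun x t => t = Tm.smul x.1 x.2 ∨ (x.1 = 1 ∧ t = x.2)) l ts)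
      (hM : IsSum ts M) : AForm .alg M

/-- One step of the algebraic equivalence, at any place in a term. -/
inductive AlgStep : {f : Frag} → Tm f → Tm f → Prop
  | one_smul {f : Frag} (M : Tm f) : AlgStep (.smul 1 M) M
  | add_comm {f : Frag} (M₁ M₂ : Tm f) : AlgStep (.add M₁ M₂) (.add M₂ M₁)
  | add_assoc {f : Frag} (M₁ M₂ M₃ : Tm f) :
      AlgStep (.add M₁ (.add M₂ M₃)) (.add (.add M₁ M₂) M₃)
  | add_smul {f : Frag} (a b : Scal f) (M : Tm f) :
      AlgStep (.add (.smul a M) (.smul b M)) (.smul (a + b) M)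
  | smul_smul {f : Frag} (a b : Scal f) (M : Tm f) :
      AlgStep (.smul a (.smul b M)) (.smul (a * b) M)
  | smul_add {f : Frag} (a : Scal f) (M₁ M₂ : Tm f) :
      AlgStep (.smul a (.add M₁ M₂)) (.add (.smul a M₁) (.smul a M₂))
  | add_zero {f : Frag} (M N : Tm f) (h : ∀ M' : Tm f, M ≠ .smul 0 M') :
      AlgStep (.add M (.smul 0 N)) M
  | tens_smul {f : Frag} (a : Scal f) (M₁ M₂ : Tm f) :
      AlgStep (.tens M₁ (.smul a M₂)) (.smul a (.tens M₁ M₂))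
  | smul_tens {f : Frag} (a : Scal f) (M₁ M₂ : Tm f) :
      AlgStep (.tens (.smul a M₁) M₂) (.smul a (.tens M₁ M₂))
  | add_tens {f : Frag} (M₁ M₂ N : Tm f) :
      AlgStep (.tens (.add M₁ M₂) N) (.add (.tens M₁ N) (.tens M₂ N))
  | tens_add {f : Frag} (M N₁ N₂ : Tm f) :
      AlgStep (.tens M (.add N₁ N₂)) (.add (.tens M N₁) (.tens M N₂))
  | addL {f : Frag} {M M' : Tm f} (N : Tm f) (h : AlgStep M M') :
      AlgStep (.add M N) (.add M' N)
  | addR {f : Frag} (M : Tm f) {N N' : Tm f} (h : AlgStep N N') :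
      AlgStep (.add M N) (.add M N')
  | smul {f : Frag} (a : Scal f) {M M' : Tm f} (h : AlgStep M M') :
      AlgStep (.smul a M) (.smul a M')
  | elimOneL {f : Frag} {M M' : Tm f} (N : Tm f) (h : AlgStep M M') :
      AlgStep (.elimOne M N) (.elimOne M' N)
  | elimOneR {f : Frag} (M : Tm f) {N N' : Tm f} (h : AlgStep N N') :
      AlgStep (.elimOne M N) (.elimOne M N')
  | lam {f : Frag} {M M' : Tm f} (h : AlgStep M M') : AlgStep (.lam M) (.lam M')
  | appL {f : Frag} {M M' : Tm f} (N : Tm f) (h : AlgStep M M') :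
      AlgStep (.app M N) (.app M' N)
  | appR {f : Frag} (M : Tm f) {N N' : Tm f} (h : AlgStep N N') :
      AlgStep (.app M N) (.app M N')
  | tensL {f : Frag} {M M' : Tm f} (N : Tm f) (h : AlgStep M M') :
      AlgStep (.tens M N) (.tens M' N)
  | tensR {f : Frag} (M : Tm f) {N N' : Tm f} (h : AlgStep N N') :
      AlgStep (.tens M N) (.tens M N')
  | elimTensL {f : Frag} {M M' : Tm f} (N : Tm f) (h : AlgStep M M') :
      AlgStep (.elimTens M N) (.elimTens M' N)
  | elimTensR {f : Frag} (M : Tm f) {N N' : Tm f} (h : AlgStep N N') :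
      AlgStep (.elimTens M N) (.elimTens M N')
  | pairL {m m' : Tm .pure} (n : Tm .pure) (h : AlgStep m m') :
      AlgStep (.pair m n) (.pair m' n)
  | pairR (m : Tm .pure) {n n' : Tm .pure} (h : AlgStep n n') :
      AlgStep (.pair m n) (.pair m n')
  | elimWith₁L {m m' : Tm .pure} (n : Tm .pure) (h : AlgStep m m') :
      AlgStep (.elimWith₁ m n) (.elimWith₁ m' n)
  | elimWith₁R (m : Tm .pure) {n n' : Tm .pure} (h : AlgStep n n') :
      AlgStep (.elimWith₁ m n) (.elimWith₁ m n')
  | elimWith₂L {m m' : Tm .pure} (n : Tm .pure) (h : AlgStep m m') :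
      AlgStep (.elimWith₂ m n) (.elimWith₂ m' n)
  | elimWith₂R (m : Tm .pure) {n n' : Tm .pure} (h : AlgStep n n') :
      AlgStep (.elimWith₂ m n) (.elimWith₂ m n')
  | elimZero {m m' : Tm .mixed} (h : AlgStep m m') : AlgStep (.elimZero m) (.elimZero m')
  | inl {m m' : Tm .mixed} (h : AlgStep m m') : AlgStep (.inl m) (.inl m')
  | inr {m m' : Tm .mixed} (h : AlgStep m m') : AlgStep (.inr m) (.inr m')
  | elimPlus₁ {m m' : Tm .mixed} (n o : Tm .mixed) (h : AlgStep m m') :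
      AlgStep (.elimPlus m n o) (.elimPlus m' n o)
  | elimPlus₂ (m : Tm .mixed) {n n' : Tm .mixed} (o : Tm .mixed) (h : AlgStep n n') :
      AlgStep (.elimPlus m n o) (.elimPlus m n' o)
  | elimPlus₃ (m n : Tm .mixed) {o o' : Tm .mixed} (h : AlgStep o o') :
      AlgStep (.elimPlus m n o) (.elimPlus m n o')
  | B {m m' : Tm .pure} (h : AlgStep m m') : AlgStep (.B m) (.B m')
  | tau {m m' : Tm .mixed} (h : AlgStep m m') : AlgStep (.tau m) (.tau m')

/-- The algebraic equivalence `M ⇆ N` between proof terms of the judgement `Γ ⊢ _ : T`: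
the reflexive, symmetric and transitive closure of the algebraic steps between such terms. -/
def AlgEq {f : Frag} (Γ : Ctx f) (T : Prp f) : Tm f → Tm f → Prop :=
  Relation.EqvGen (fun M N => AlgStep M N ∧ Derivable Γ M T ∧ Derivable Γ N T)

/-- Cut reduction `M → N`. -/
inductive Red : {f : Frag} → Tm f → Tm f → Prop
  -- cut elimination
  | one {f : Frag} (a : Scal f) (M : Tm f) : Red (.elimOne (.smul a .star) M) (.smul a M)
  | beta {f : Frag} (M : Tm f) {V : Tm f} (hV : Val .full V) :
      Red (.app (.lam M) V) (Tm.inst V M)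
  | with₁ {v w : Tm .pure} (t : Tm .pure) (hv : Val .full v) (hw : Val .full w) :
      Red (.elimWith₁ (.pair v w) t) (Tm.inst v t)
  | with₂ {v w : Tm .pure} (t : Tm .pure) (hv : Val .full v) (hw : Val .full w) :
      Red (.elimWith₂ (.pair v w) t) (Tm.inst w t)
  | plusL {v : Tm .mixed} (m n : Tm .mixed) (hv : Val .full v) :
      Red (.elimPlus (.inl v) m n) (Tm.inst v m)
  | plusR {v : Tm .mixed} (m n : Tm .mixed) (hv : Val .full v) :
      Red (.elimPlus (.inr v) m n) (Tm.inst v n)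
  | tensor {f : Frag} {V W : Tm f} (M : Tm f) (hV : Val .noncomb V) (hW : Val .noncomb W) :
      Red (.elimTens (.tens V W) M) (Tm.inst₂ V W M)
  -- commutation with sums and scalar products
  | commTop (a : Scal .pure) : Red (.smul a .topI) .topI
  | commLam {f : Frag} (l : List (Scal f × Tm f)) {S R : Tm f} (hd : (l.map Prod.snd).Nodup)
      (hS : IsSum (l.map (fun x => Tm.smul x.1 (.lam x.2))) S)
      (hR : IsSum (l.map (fun x => Tm.smul x.1 x.2)) R) : Red S (.lam R)
  | commPair (l : List (Scal .pure × Tm .pure × Tm .pure)) {S R₁ R₂ : Tm .pure}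
      (hv : ∀ x ∈ l, Val .full x.2.1 ∧ Val .full x.2.2) (hd : (l.map Prod.snd).Nodup)
      (hS : IsSum (l.map (fun x => Tm.smul x.1 (.pair x.2.1 x.2.2))) S)
      (hR₁ : IsSum (l.map (fun x => Tm.smul x.1 x.2.1)) R₁)
      (hR₂ : IsSum (l.map (fun x => Tm.smul x.1 x.2.2)) R₂) : Red S (.pair R₁ R₂)
  | commPlus (l : List (Scal .mixed × Tm .mixed)) (o s : Tm .mixed) {S R : Tm .mixed}
      (hv : ∀ x ∈ l, Val .base x.2) (hd : (l.map Prod.snd).Nodup)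
      (hS : IsSum (l.map (fun x => Tm.smul x.1 x.2)) S)
      (hR : IsSum (l.map (fun x => Tm.smul x.1 (.elimPlus x.2 o s))) R) :
      Red (.elimPlus S o s) R
  | commTens {f : Frag} (l : List (Scal f × Tm f)) (M : Tm f) {S R : Tm f}
      (hv : ∀ x ∈ l, Val .base x.2) (hd : (l.map Prod.snd).Nodup)
      (hS : IsSum (l.map (fun x => Tm.smul x.1 x.2)) S)
      (hR : IsSum (l.map (fun x => Tm.smul x.1 (.elimTens x.2 M))) R) :
      Red (.elimTens S M) R
  | commInl (l : List (Scal .mixed × Tm .mixed)) {S R : Tm .mixed}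
      (hv : ∀ x ∈ l, Val .base x.2) (hd : (l.map Prod.snd).Nodup)
      (hS : IsSum (l.map (fun x => Tm.smul x.1 x.2)) S)
      (hR : IsSum (l.map (fun x => Tm.smul x.1 (.inl x.2))) R) : Red (.inl S) R
  | commInr (l : List (Scal .mixed × Tm .mixed)) {S R : Tm .mixed}
      (hv : ∀ x ∈ l, Val .base x.2) (hd : (l.map Prod.snd).Nodup)
      (hS : IsSum (l.map (fun x => Tm.smul x.1 x.2)) S)
      (hR : IsSum (l.map (fun x => Tm.smul x.1 (.inr x.2))) R) : Red (.inr S) R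
  -- the modality
  | cast {v w : Tm .pure} (hv : Val .full v) (hw : Val .full w) :
      Red (.tau (.tens (.B v) (.B w))) (.B (.tens v w))
  | commTau (l : List (Scal .mixed × Tm .mixed)) {S R : Tm .mixed}
      (hv : ∀ x ∈ l, Val .base x.2) (hd : (l.map Prod.snd).Nodup)
      (hS : IsSum (l.map (fun x => Tm.smul x.1 x.2)) S)
      (hR : IsSum (l.map (fun x => Tm.smul x.1 (.tau x.2))) R) : Red (.tau S) R
  | commB (a : Scal .pure) {v : Tm .pure} (ha : a ≠ 1) (hv : Val .base v) :
      Red (.B (.smul a v)) (.smul a.normSq (.B v))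
  | commBapp (l k : List (Scal .mixed × Tm .pure)) {S S' R : Tm .mixed}
      (hl : ∀ x ∈ l, Val .full x.2) (hk : ∀ y ∈ k, Val .full y.2)
      (hdl : (l.map Prod.snd).Nodup) (hdk : (k.map Prod.snd).Nodup)
      (hS : IsSum (l.map (fun x => Tm.smul x.1 (.B x.2))) S)
      (hS' : IsSum (k.map (fun y => Tm.smul y.1 (.B y.2))) S')
      (hR : IsSum (l.flatMap (fun x => k.map (fun y =>
        Tm.smul (x.1 * y.1) (.B (.app x.2 y.2))))) R) : Red (.app S S') R
  -- evaluation contexts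
  | addL {f : Frag} {M M' : Tm f} (N : Tm f) (h : Red M M') : Red (.add M N) (.add M' N)
  | smul {f : Frag} (a : Scal f) {M M' : Tm f} (h : Red M M') : Red (.smul a M) (.smul a M')
  | elimZero {m m' : Tm .mixed} (h : Red m m') : Red (.elimZero m) (.elimZero m')
  | elimOneL {f : Frag} {M M' : Tm f} (N : Tm f) (h : Red M M') :
      Red (.elimOne M N) (.elimOne M' N)
  | appL {f : Frag} {M M' : Tm f} (N : Tm f) (h : Red M M') : Red (.app M N) (.app M' N)
  | appR {f : Frag} {V N N' : Tm f} (hV : Val .full V) (h : Red N N') :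
      Red (.app V N) (.app V N')
  | pairL {m m' : Tm .pure} (n : Tm .pure) (h : Red m m') : Red (.pair m n) (.pair m' n)
  | pairR {v n n' : Tm .pure} (hv : Val .full v) (h : Red n n') : Red (.pair v n) (.pair v n')
  | elimWith₁ {m m' : Tm .pure} (n : Tm .pure) (h : Red m m') :
      Red (.elimWith₁ m n) (.elimWith₁ m' n)
  | elimWith₂ {m m' : Tm .pure} (n : Tm .pure) (h : Red m m') :
      Red (.elimWith₂ m n) (.elimWith₂ m' n)
  | inl {m m' : Tm .mixed} (h : Red m m') : Red (.inl m) (.inl m')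
  | inr {m m' : Tm .mixed} (h : Red m m') : Red (.inr m) (.inr m')
  | elimPlus {m m' : Tm .mixed} (n o : Tm .mixed) (h : Red m m') :
      Red (.elimPlus m n o) (.elimPlus m' n o)
  | tensL {f : Frag} {M M' : Tm f} (N : Tm f) (h : Red M M') : Red (.tens M N) (.tens M' N)
  | tensR {f : Frag} {V N N' : Tm f} (hV : Val .full V) (h : Red N N') :
      Red (.tens V N) (.tens V N')
  | elimTens {f : Frag} {M M' : Tm f} (N : Tm f) (h : Red M M') :
      Red (.elimTens M N) (.elimTens M' N)
  | B {m m' : Tm .pure} (h : Red m m') : Red (.B m) (.B m')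
  | tau {m m' : Tm .mixed} (h : Red m m') : Red (.tau m) (.tau m')

/-- The composite reduction `M ↪ N` of proof terms of the judgement `Γ ⊢ _ : T`. -/
inductive Hook {f : Frag} (Γ : Ctx f) (T : Prp f) : Tm f → Tm f → Prop
  | red {M N : Tm f} (h : Red M N) : Hook Γ T M N
  | val {M V : Tm f} (h : AlgEq Γ T M V) (hV : Val .full V) : Hook Γ T M V
  | alg {M A N : Tm f} (hM : ¬ ∃ M', Red M M') (h : AlgEq Γ T M A) (hA : AForm .alg A)
      (hN : Red A N) : Hook Γ T M N

/-- `↪*`, the reflexive and transitive closure of `↪`. -/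
def HookStar {f : Frag} (Γ : Ctx f) (T : Prp f) : Tm f → Tm f → Prop :=
  Relation.ReflTransGen (Hook Γ T)

/-! ## Denotational semantics

A pure proposition `P` denotes the Hilbert space with orthonormal basis `Basis P`; a mixed
proposition `A` denotes the finite-dimensional C*-algebra (a direct sum of full matrix algebras)
whose matrix units are indexed by `Basis A`.  So `⊗` and `⊸` (that is `[X, Y] = X* ⊗ Y`, in the
basis given by the dual basis of `X` and the basis of `Y`) give products of bases, `⊕` and `&`
give disjoint unions, and `𝓑(P)`, the algebra of operators on the Hilbert space of `P`, has as
basis the matrix units `|i⟩⟨j|` with `i, j` in `Basis P`.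

A morphism of Hilbert spaces is a linear map, and a morphism of C*-algebras is a linear map that is
completely positive, so that two morphisms of either category are equal exactly if they are equal
as linear maps.  A linear map `X → Y` is represented by its matrix, with rows indexed by the basis
of `Y` and columns indexed by the basis of `X`. -/

/-- The basis of the denotation of a proposition. -/
def Basis : {f : Frag} → Prp f → Type
  | _, .top => Empty
  | _, .zero => Empty
  | _, .one => Unit
  | _, .lolli S T => Basis S × Basis T
  | _, .tensor S T => Basis S × Basis T
  | _, .amp P Q => Basis P ⊕ Basis Q
  | _, .plus A C => Basis A ⊕ Basis C
  | _, .B P => Basis P × Basis P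

instance instFintypeBasis : {f : Frag} → (T : Prp f) → Fintype (Basis T)
  | _, .top => inferInstanceAs (Fintype Empty)
  | _, .zero => inferInstanceAs (Fintype Empty)
  | _, .one => inferInstanceAs (Fintype Unit)
  | _, .lolli S T =>
      letI := instFintypeBasis S; letI := instFintypeBasis T
      inferInstanceAs (Fintype (Basis S × Basis T))
  | _, .tensor S T =>
      letI := instFintypeBasis S; letI := instFintypeBasis T
      inferInstanceAs (Fintype (Basis S × Basis T))
  | _, .amp P Q =>
      letI := instFintypeBasis P; letI := instFintypeBasis Q
      inferInstanceAs (Fintype (Basis P ⊕ Basis Q))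
  | _, .plus A C =>
      letI := instFintypeBasis A; letI := instFintypeBasis C
      inferInstanceAs (Fintype (Basis A ⊕ Basis C))
  | _, .B P =>
      letI := instFintypeBasis P
      inferInstanceAs (Fintype (Basis P × Basis P))

instance instDecidableEqBasis : {f : Frag} → (T : Prp f) → DecidableEq (Basis T)
  | _, .top => inferInstanceAs (DecidableEq Empty)
  | _, .zero => inferInstanceAs (DecidableEq Empty)
  | _, .one => inferInstanceAs (DecidableEq Unit)
  | _, .lolli S T =>
      letI := instDecidableEqBasis S; letI := instDecidableEqBasis T
      inferInstanceAs (DecidableEq (Basis S × Basis T))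
  | _, .tensor S T =>
      letI := instDecidableEqBasis S; letI := instDecidableEqBasis T
      inferInstanceAs (DecidableEq (Basis S × Basis T))
  | _, .amp P Q =>
      letI := instDecidableEqBasis P; letI := instDecidableEqBasis Q
      inferInstanceAs (DecidableEq (Basis P ⊕ Basis Q))
  | _, .plus A C =>
      letI := instDecidableEqBasis A; letI := instDecidableEqBasis C
      inferInstanceAs (DecidableEq (Basis A ⊕ Basis C))
  | _, .B P =>
      letI := instDecidableEqBasis P
      inferInstanceAs (DecidableEq (Basis P × Basis P))

/-- The basis of the denotation of a context, that is of the tensor product of the denotations of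
its declarations. -/
def CtxBasis {f : Frag} : Ctx f → Type
  | [] => Unit
  | none :: Γ => CtxBasis Γ
  | some S :: Γ => Basis S × CtxBasis Γ

/-- The isomorphism `⟦x : S⟧ ≅ ⟦S⟧`, on bases. -/
def Only.get : {f : Frag} → {Γ : Ctx f} → {i : ℕ} → {S : Prp f} → Only Γ i S →
    CtxBasis Γ → Basis S
  | _, _, _, _, .here _, γ => γ.1
  | _, _, _, _, .there h, γ => h.get γ

/-- The isomorphism `⟦Γ⟧ ≅ ⟦Γ₁⟧ ⊗ ⟦Γ₂⟧`, on bases: first component. -/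
def Split.fst : {f : Frag} → {Γ Γ₁ Γ₂ : Ctx f} → Split Γ Γ₁ Γ₂ → CtxBasis Γ → CtxBasis Γ₁
  | _, _, _, _, .nil, _ => ()
  | _, _, _, _, .none h, γ => h.fst γ
  | _, _, _, _, .left _ h, γ => (γ.1, h.fst γ.2)
  | _, _, _, _, .right _ h, γ => h.fst γ.2

/-- The isomorphism `⟦Γ⟧ ≅ ⟦Γ₁⟧ ⊗ ⟦Γ₂⟧`, on bases: second component. -/
def Split.snd : {f : Frag} → {Γ Γ₁ Γ₂ : Ctx f} → Split Γ Γ₁ Γ₂ → CtxBasis Γ → CtxBasis Γ₂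
  | _, _, _, _, .nil, _ => ()
  | _, _, _, _, .none h, γ => h.snd γ
  | _, _, _, _, .left _ h, γ => h.snd γ.2
  | _, _, _, _, .right _ h, γ => (γ.1, h.snd γ.2)

/-- The functor `𝓑` on a linear map `F` of Hilbert spaces: the matrix, with respect to matrix
units, of the completely positive map `ρ ↦ F ρ F†`. -/
def Bmap {X Y : Type} (F : Matrix Y X ℂ) : Matrix (Y × Y) (X × X) ℂ :=
  .of fun k i => F k.1 i.1 * star (F k.2 i.2)

/-- The evaluation map `[X, Y] ⊗ X → Y`. -/
def evalMap (X Y : Type) [DecidableEq X] [DecidableEq Y] : Matrix Y ((X × Y) × X) ℂ :=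
  .of fun y z => if z.1.1 = z.2 ∧ z.1.2 = y then 1 else 0

/-- The denotation `⟦Γ ⊢ M : T⟧ : ⟦Γ⟧ → ⟦T⟧` of a derivation, as a matrix. -/
noncomputable def den : {f : Frag} → {Γ : Ctx f} → {M : Tm f} → {T : Prp f} → Der Γ M T →
    Matrix (Basis T) (CtxBasis Γ) ℂ
  -- the identity
  | _, _, _, _, .ax h => .of fun t γ => if t = h.get γ then 1 else 0
  | _, _, _, _, .sum d e => .of fun t γ => den d t γ + den e t γ
  | _, _, _, _, .prod a d => .of fun t γ => a.toComplex * den d t γ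
  -- the zero map
  | _, _, _, _, .topI _ => .of fun _ _ => 0
  | _, _, _, _, .zeroE _ _ _ => .of fun _ _ => 0
  -- the identity of `ℂ`
  | _, _, _, _, .oneI _ => .of fun _ _ => 1
  -- `λ ∘ (⟦M⟧ ⊗ ⟦N⟧)`
  | _, _, _, _, .oneE h d e => .of fun t γ => den d () (h.fst γ) * den e t (h.snd γ)
  -- currying
  | _, _, _, _, .lolliI d => .of fun t γ => den d t.2 (t.1, γ)
  -- `eval ∘ (⟦M⟧ ⊗ ⟦N⟧)`
  | _, _, _, _, .lolliE (S := S) (T := T) h d e => .of fun t γ =>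
      ∑ x : Basis S × Basis T, ∑ s : Basis S,
        evalMap (Basis S) (Basis T) t (x, s) * (den d x (h.fst γ) * den e s (h.snd γ))
  -- `⟨⟦m⟧, ⟦n⟧⟩`
  | _, _, _, _, .ampI (P := P) (Q := Q) d e => .of fun (t : Basis P ⊕ Basis Q) γ =>
      match t with
      | .inl t => den d t γ
      | .inr t => den e t γ
  -- `⟦n⟧ ∘ σ ∘ ((πᵢ ∘ ⟦m⟧) ⊗ id)`
  | _, _, _, _, .ampE₁ (P := P) h d e => .of fun t γ =>
      ∑ x : Basis P, den d (Sum.inl x) (h.fst γ) * den e t (x, h.snd γ)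
  | _, _, _, _, .ampE₂ (Q := Q) h d e => .of fun t γ =>
      ∑ x : Basis Q, den d (Sum.inr x) (h.fst γ) * den e t (x, h.snd γ)
  -- `i₁ ∘ ⟦m⟧` and `i₂ ∘ ⟦n⟧`
  | _, _, _, _, .plusI₁ (A := A) C d => .of fun (t : Basis A ⊕ Basis C) γ =>
      match t with
      | .inl t => den d t γ
      | .inr _ => 0
  | _, _, _, _, .plusI₂ (C := C) A d => .of fun (t : Basis A ⊕ Basis C) γ =>
      match t with
      | .inl _ => 0
      | .inr t => den d t γ
  -- `[⟦n⟧, ⟦o⟧] ∘ d ∘ σ ∘ (⟦m⟧ ⊗ id)`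
  | _, _, _, _, .plusE (A := A) (C := C) h d e₁ e₂ => .of fun t γ =>
      (∑ x : Basis A, den d (Sum.inl x) (h.fst γ) * den e₁ t (x, h.snd γ)) +
      (∑ x : Basis C, den d (Sum.inr x) (h.fst γ) * den e₂ t (x, h.snd γ))
  -- `⟦M⟧ ⊗ ⟦N⟧`
  | _, _, _, _, .tensI h d e => .of fun t γ => den d t.1 (h.fst γ) * den e t.2 (h.snd γ)
  -- `⟦N⟧ ∘ (id ⊗ ⟦M⟧)`
  | _, _, _, _, .tensE (S₁ := S₁) (S₂ := S₂) h d e => .of fun t γ =>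
      ∑ x : Basis S₁ × Basis S₂, den d x (h.fst γ) * den e t (x.2, x.1, h.snd γ)
  -- `𝓑(⟦m⟧)`, along `ℂ ≅ 𝓑(ℂ)`
  | _, _, _, _, .BI _ d => .of fun t _ => Bmap (den d) t ((), ())
  -- `𝓑(eval) ∘ τ ∘ (⟦m⟧ ⊗ ⟦n⟧)`, where `τ (|i⟩⟨j| ⊗ |k⟩⟨l|) = |i, k⟩⟨j, l|`
  | _, _, _, _, .BlolliE (P := P) (Q := Q) h d e => .of fun t γ =>
      ∑ x : (Basis P × Basis Q) × (Basis P × Basis Q), ∑ y : Basis P × Basis P,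
        Bmap (evalMap (Basis P) (Basis Q)) t ((x.1, y.1), (x.2, y.2)) *
          (den d x (h.fst γ) * den e y (h.snd γ))
  -- `τ ∘ ⟦m⟧`
  | _, _, _, _, .Btens d => .of fun t γ => den d ((t.1.1, t.2.1), (t.1.2, t.2.2)) γ

/-! ## Contextual equivalence -/

/-- Elimination contexts `E`. -/
inductive ECtx : Frag → Type
  | hole {f : Frag} : ECtx f
  | elimZero (E : ECtx .mixed) : ECtx .mixed
  | elimOne {f : Frag} (E : ECtx f) (M : Tm f) : ECtx f
  | app {f : Frag} (E : ECtx f) (M : Tm f) : ECtx f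
  | elimWith₁ (E : ECtx .pure) (m : Tm .pure) : ECtx .pure
  | elimWith₂ (E : ECtx .pure) (m : Tm .pure) : ECtx .pure
  | elimPlus (E : ECtx .mixed) (m n : Tm .mixed) : ECtx .mixed
  | elimTens {f : Frag} (E : ECtx f) (M : Tm f) : ECtx f

/-- `E[M]`. -/
def ECtx.plug : {f : Frag} → ECtx f → Tm f → Tm f
  | _, .hole, M => M
  | _, .elimZero E, M => .elimZero (E.plug M)
  | _, .elimOne E N, M => .elimOne (E.plug M) N
  | _, .app E N, M => .app (E.plug M) N
  | _, .elimWith₁ E n, M => .elimWith₁ (E.plug M) n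
  | _, .elimWith₂ E n, M => .elimWith₂ (E.plug M) n
  | _, .elimPlus E n o, M => .elimPlus (E.plug M) n o
  | _, .elimTens E N, M => .elimTens (E.plug M) N

/-- `[.] : S ⊢ E : T`: the term `E`, whose only free variable is the hole (which has index `0`),
has proposition `T`.  The hole is the only declared variable, so that the terms in `E` other than
the hole are closed up to the variables that `E` binds in them. -/
def ECtx.Typed {f : Frag} (E : ECtx f) (S T : Prp f) : Prop :=
  Derivable [some S] (E.plug (.var 0)) T

/-- The observable propositions: `1` in both fragments, and `𝓑(1)`. -/
inductive Observable : {f : Frag} → Prp f → Prop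
  | one {f : Frag} : Observable (Prp.one : Prp f)
  | Bone : Observable (Prp.B Prp.one)

/-- Contextual equivalence `M ∼ N` of closed terms of the proposition `S`. -/
def CtxEquiv {f : Frag} (S : Prp f) (M N : Tm f) : Prop :=
  ∀ (E : ECtx f) (T : Prp f), Observable T → E.Typed S T →
    ∃ V : Tm f, Val .full V ∧ HookStar [] T (E.plug M) V ∧ HookStar [] T (E.plug N) V

end BImall

namespace BImall

/-! ## Evaluation of derivations at environments of vectors -/

/-! ### Scalars of both fragments as complex numbers. -/

section Scalars

/-! Every closed term of an observable proposition reduces to a multiple of one base value `u`,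
namely `*` at `1` and `𝓑(*)` at `𝓑(1)`. The denotation of `u` is nonzero, so the scalar can be read
off from the denotation of the term. Denotations are compositional (`Der.exists_plug`), so `E[M]`
and `E[N]` have the same denotation. Reduction preserves it, hence both terms reach the same
multiple of `u`. What has to be proved is soundness (`Red.exists_der`, `AlgEq.sem_eq`) and
normalization (`Der.exists_hookStar`).

Soundness. Denotations are evaluated at pure tensors (`ev`), where each rule becomes a multilinear
formula and substitution becomes composition. A term does not determine its derivation, since the
proposition of a cut is not visible in the term, and the rule `α • M + β • M ⇆ (α + β) • M`
identifies two possibly different derivations of `M`. That they denote the same map (`ev_unique`)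
follows from a logical relation `Rel` between the vectors of two arbitrary propositions: it is
equality when the propositions coincide, and two derivations of one term always give related vectors
(`ev_rel`).

Normalization. Terms are measured lexicographically by `wt`, `cwt 1`, `cwt 2`. The measure `wt` is a
product where a context is divided between two premises and a sum where it is shared, so linearity
bounds the weight after a substitution by the product of the weights (`Der.wt_subst_le`), and cuts
lower `wt`. The steps that keep `wt` do not raise `cwt 1` and lower `cwt 2`. Thus every step `→`
lowers the triple (`Red.dec`).

A term without such a step must be rearranged by `⇆`, which may write a coefficient `1` explicitly;
this leaves `wt` and `cwt 1` unchanged but raises `cwt 2`. So it is shown that every closed term is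
equivalent, with no increase of the first two measures, either to a value or to an algebraic form
with a step that strictly lowers the pair of these two (`Der.exists_linRep`, `LinRep.outcome`). The
rearrangements are computed in the module of terms modulo `⇆`. -/

theorem Scal.toComplex_zero {f : Frag} : (0 : Scal f).toComplex = 0 := by
  cases f
  · rfl
  · show (((0 : ℝ≥0) : ℝ) : ℂ) = 0
    simp

theorem Scal.toComplex_one {f : Frag} : (1 : Scal f).toComplex = 1 := by
  cases f
  · rfl
  · show (((1 : ℝ≥0) : ℝ) : ℂ) = 1
    simp

theorem Scal.toComplex_add {f : Frag} (a b : Scal f) :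
    (a + b).toComplex = a.toComplex + b.toComplex := by
  cases f
  · rfl
  · exact (congrArg _ (NNReal.coe_add a b)).trans (Complex.ofReal_add _ _)

theorem Scal.toComplex_mul {f : Frag} (a b : Scal f) :
    (a * b).toComplex = a.toComplex * b.toComplex := by
  cases f
  · rfl
  · exact (congrArg _ (NNReal.coe_mul a b)).trans (Complex.ofReal_mul _ _)

theorem Scal.toComplex_injective {f : Frag} : Function.Injective (@Scal.toComplex f) := by
  cases f
  · exact fun a b h => h
  · intro a b h
    exact NNReal.coe_injective (Complex.ofReal_injective h)

theorem Scal.toComplex_normSq (a : Scal .pure) :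
    a.normSq.toComplex = a.toComplex * star a.toComplex := by
  show (((‖Scal.toComplex a‖₊ ^ 2 : ℝ≥0) : ℝ) : ℂ) = _
  simp [Complex.mul_conj, Complex.normSq_eq_norm_sq]

end Scalars

/-! ### Pure tensors over a context. -/

instance instFintypeCtxBasis {f : Frag} : (Γ : Ctx f) → Fintype (CtxBasis Γ)
  | [] => inferInstanceAs (Fintype Unit)
  | none :: Γ => instFintypeCtxBasis Γ
  | some S :: Γ =>
      letI := instFintypeCtxBasis Γ
      inferInstanceAs (Fintype (Basis S × CtxBasis Γ))

/-- An environment gives a vector for every declared variable. -/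
def Env {f : Frag} : Ctx f → Type
  | [] => Unit
  | none :: Γ => Env Γ
  | some S :: Γ => (Basis S → ℂ) × Env Γ

def Env.nil {f : Frag} : Env ([] : Ctx f) := ()

def Env.skip {f : Frag} {Γ : Ctx f} (ρ : Env Γ) : Env (none :: Γ) := ρ

def Env.cons {f : Frag} {Γ : Ctx f} {S : Prp f} (x : Basis S → ℂ) (ρ : Env Γ) :
    Env (some S :: Γ) := (x, ρ)

def Env.head {f : Frag} {Γ : Ctx f} {S : Prp f} (ρ : Env (some S :: Γ)) : Basis S → ℂ := ρ.1

def Env.tail {f : Frag} {Γ : Ctx f} {S : Prp f} (ρ : Env (some S :: Γ)) : Env Γ := ρ.2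

def CtxBasis.cons {f : Frag} {Γ : Ctx f} {S : Prp f} (s : Basis S) (γ : CtxBasis Γ) :
    CtxBasis (some S :: Γ) := (s, γ)

/-- The coordinates of the pure tensor given by an environment. -/
def Env.wt {f : Frag} : {Γ : Ctx f} → Env Γ → CtxBasis Γ → ℂ
  | [], _, _ => 1
  | none :: Γ, ρ, γ => Env.wt (Γ := Γ) ρ γ
  | some _ :: _, ρ, γ => ρ.head γ.1 * ρ.tail.wt γ.2

def Only.getE {f : Frag} : {Γ : Ctx f} → {i : ℕ} → {S : Prp f} → Only Γ i S →
    Env Γ → Basis S → ℂ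
  | _, _, _, .here _, ρ => ρ.head
  | _, _, _, .there h, ρ => h.getE ρ

def Split.fstE {f : Frag} : {Γ Γ₁ Γ₂ : Ctx f} → Split Γ Γ₁ Γ₂ → Env Γ → Env Γ₁
  | _, _, _, .nil, _ => Env.nil
  | _, _, _, .none h, ρ => (h.fstE ρ).skip
  | _, _, _, .left _ h, ρ => .cons ρ.head (h.fstE ρ.tail)
  | _, _, _, .right _ h, ρ => (h.fstE ρ.tail).skip

def Split.sndE {f : Frag} : {Γ Γ₁ Γ₂ : Ctx f} → Split Γ Γ₁ Γ₂ → Env Γ → Env Γ₂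
  | _, _, _, .nil, _ => Env.nil
  | _, _, _, .none h, ρ => (h.sndE ρ).skip
  | _, _, _, .left _ h, ρ => (h.sndE ρ.tail).skip
  | _, _, _, .right _ h, ρ => .cons ρ.head (h.sndE ρ.tail)

theorem sum_ctxBasis_nil {f : Frag} (F : CtxBasis ([] : Ctx f) → ℂ) : ∑ γ, F γ = F () :=
  Fintype.sum_unique (ι := Unit) F

theorem sum_ctxBasis_some {f : Frag} (S : Prp f) (Γ : Ctx f) (F : CtxBasis (some S :: Γ) → ℂ) :
    ∑ γ, F γ = ∑ s : Basis S, ∑ γ : CtxBasis Γ, F (.cons s γ) :=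
  Fintype.sum_prod_type (α₁ := Basis S) (α₂ := CtxBasis Γ) F

theorem Env.wt_cons {f : Frag} {S : Prp f} {Γ : Ctx f} (ρ : Env (some S :: Γ)) (s : Basis S)
    (γ : CtxBasis Γ) : ρ.wt (.cons s γ) = ρ.head s * ρ.tail.wt γ := rfl

theorem Env.cons_wt_cons {f : Frag} {S : Prp f} {Γ : Ctx f} (x : Basis S → ℂ) (ρ : Env Γ)
    (s : Basis S) (γ : CtxBasis Γ) :
    (Env.cons x ρ).wt (.cons s γ) = x s * ρ.wt γ := rfl

theorem Ctx.Empty.tail {f : Frag} {o : Option (Prp f)} {Γ : Ctx f} (h : Ctx.Empty (o :: Γ)) :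
    Γ.Empty := fun x hx => h x (List.mem_cons_of_mem _ hx)

theorem Ctx.Empty.head {f : Frag} {o : Option (Prp f)} {Γ : Ctx f} (h : Ctx.Empty (o :: Γ)) :
    o = none := h o List.mem_cons_self

theorem Ctx.empty_nil {f : Frag} : Ctx.Empty ([] : Ctx f) := fun _ h => absurd h List.not_mem_nil

theorem Ctx.Empty.cons {f : Frag} {Γ : Ctx f} (h : Γ.Empty) : Ctx.Empty (none :: Γ) := by
  intro x hx
  rcases List.mem_cons.1 hx with rfl | hx
  · rfl
  · exact h x hx

theorem Ctx.Empty.sum_wt {f : Frag} : {Γ : Ctx f} → (h : Γ.Empty) → (ρ : Env Γ) →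
    ∑ γ, ρ.wt γ = 1
  | [], _, _ => by rw [sum_ctxBasis_nil]; rfl
  | none :: _, h, ρ => h.tail.sum_wt ρ
  | some _ :: _, h, _ => absurd h.head (by simp)

theorem only_get_here {f : Frag} {Γ : Ctx f} {S : Prp f} (hE : Γ.Empty) (s : Basis S)
    (γ : CtxBasis Γ) : (Only.here hE).get (CtxBasis.cons s γ) = s := Only.get.eq_1 ..

theorem Only.sum_wt {f : Frag} {Γ : Ctx f} {i : ℕ} {S : Prp f} (h : Only Γ i S) (ρ : Env Γ)
    (t : Basis S) : ∑ γ, (if t = h.get γ then 1 else 0) * ρ.wt γ = h.getE ρ t := by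
  induction h with
  | here hE =>
    rw [sum_ctxBasis_some, Finset.sum_eq_single t]
    · have : ∀ γ, (if t = (Only.here hE).get (CtxBasis.cons t γ) then 1 else 0) *
          ρ.wt (CtxBasis.cons t γ) = ρ.head t * Env.wt ρ.tail γ := fun γ => by
        rw [only_get_here, if_pos rfl, one_mul, Env.wt_cons]
      simp only [this]
      rw [← Finset.mul_sum, hE.sum_wt]
      exact mul_one _
    · intro b _ hb
      refine Finset.sum_eq_zero fun γ _ => ?_
      rw [only_get_here, if_neg (Ne.symm hb), zero_mul]
    · simp
  | @there Γ i S h ih =>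
    have : ∀ γ : CtxBasis Γ, (Only.there h).get (Γ := none :: Γ) γ = h.get γ :=
      fun γ => Only.get.eq_2 ..
    calc _ = ∑ γ : CtxBasis Γ, (if t = (Only.there h).get (Γ := none :: Γ) γ then 1 else 0) *
          Env.wt (Γ := Γ) ρ γ := rfl
      _ = _ := by simp only [this]; exact ih ρ t

/-- `CtxBasis (none :: Γ)` is `CtxBasis Γ` by definition. These equations name the contexts
explicitly, so that an index can be read at either type. -/
theorem split_fst_none {f : Frag} {Γ Γ₁ Γ₂ : Ctx f} (h : Split Γ Γ₁ Γ₂) (γ : CtxBasis Γ) :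
    Split.fst (Γ := none :: Γ) (Γ₁ := none :: Γ₁) (.none h) γ = h.fst γ := Split.fst.eq_2 ..

theorem split_snd_none {f : Frag} {Γ Γ₁ Γ₂ : Ctx f} (h : Split Γ Γ₁ Γ₂) (γ : CtxBasis Γ) :
    Split.snd (Γ := none :: Γ) (Γ₂ := none :: Γ₂) (.none h) γ = h.snd γ := Split.snd.eq_2 ..

theorem split_fst_left {f : Frag} {Γ Γ₁ Γ₂ : Ctx f} {S : Prp f} (h : Split Γ Γ₁ Γ₂)
    (s : Basis S) (γ : CtxBasis Γ) : (Split.left S h).fst (.cons s γ) = .cons s (h.fst γ) :=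
  Split.fst.eq_3 ..

theorem split_snd_left {f : Frag} {Γ Γ₁ Γ₂ : Ctx f} {S : Prp f} (h : Split Γ Γ₁ Γ₂)
    (s : Basis S) (γ : CtxBasis Γ) :
    Split.snd (Γ₂ := none :: Γ₂) (.left S h) (.cons s γ) = h.snd γ :=
  Split.snd.eq_3 ..

theorem split_fst_right {f : Frag} {Γ Γ₁ Γ₂ : Ctx f} {S : Prp f} (h : Split Γ Γ₁ Γ₂)
    (s : Basis S) (γ : CtxBasis Γ) :
    Split.fst (Γ₁ := none :: Γ₁) (.right S h) (.cons s γ) = h.fst γ :=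
  Split.fst.eq_4 ..

theorem split_snd_right {f : Frag} {Γ Γ₁ Γ₂ : Ctx f} {S : Prp f} (h : Split Γ Γ₁ Γ₂)
    (s : Basis S) (γ : CtxBasis Γ) : (Split.right S h).snd (.cons s γ) = .cons s (h.snd γ) :=
  Split.snd.eq_4 ..

/-- Each declaration goes to exactly one side, so the coordinates of a pure tensor over `Γ` are
products of the coordinates of its two restrictions, and the sum factors. Every rule that divides
its context is evaluated through this identity. -/
theorem Split.sum_mul {f : Frag} {Γ Γ₁ Γ₂ : Ctx f} (h : Split Γ Γ₁ Γ₂) (ρ : Env Γ)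
    (F : CtxBasis Γ₁ → ℂ) (G : CtxBasis Γ₂ → ℂ) :
    ∑ γ, F (h.fst γ) * G (h.snd γ) * ρ.wt γ =
      (∑ γ, F γ * (h.fstE ρ).wt γ) * ∑ γ, G γ * (h.sndE ρ).wt γ := by
  induction h with
  | nil => simp only [sum_ctxBasis_nil, Env.wt, mul_one]; rfl
  | @none Γ Γ₁ Γ₂ h ih =>
    calc _ = ∑ γ : CtxBasis Γ, F (Split.fst (Γ := .none :: Γ) (Γ₁ := .none :: Γ₁) (.none h) γ) *
          G (Split.snd (Γ := .none :: Γ) (Γ₂ := .none :: Γ₂) (.none h) γ) *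
          Env.wt (Γ := Γ) ρ γ := rfl
      _ = _ := by
        simp only [split_fst_none, split_snd_none]
        exact ih ρ F G
  | @left Γ Γ₁ Γ₂ S h ih =>
    have := fun s => ih ρ.tail (fun γ => F (.cons s γ)) G
    rw [sum_ctxBasis_some, sum_ctxBasis_some, Finset.sum_mul]
    refine Finset.sum_congr rfl fun s _ => ?_
    simp only [split_fst_left, Env.wt_cons]
    calc _ = ∑ γ : CtxBasis Γ, ρ.head s * (F (.cons s (h.fst γ)) *
            G (Split.snd (Γ₂ := .none :: Γ₂) (.left S h) (.cons s γ)) * Env.wt ρ.tail γ) :=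
            Finset.sum_congr rfl fun γ _ => mul_left_comm _ (ρ.head s) _
      _ = ρ.head s * ((∑ γ, F (.cons s γ) * (h.fstE ρ.tail).wt γ) *
            ∑ γ, G γ * Env.wt (h.sndE ρ.tail) γ) := by
            simp only [split_snd_left]
            exact (Finset.mul_sum _ _ (ρ.head s)).symm.trans (congrArg (ρ.head s * ·) (this s))
      _ = (∑ γ, ρ.head s * (F (.cons s γ) * (h.fstE ρ.tail).wt γ)) *
            ∑ γ, G γ * Env.wt (h.sndE ρ.tail) γ := by
            rw [← mul_assoc, Finset.mul_sum _ _ (ρ.head s)]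
      _ = _ := congrArg (· * _) (Finset.sum_congr rfl fun γ _ => mul_left_comm (ρ.head s) _ _)
  | @right Γ Γ₁ Γ₂ S h ih =>
    have := fun s => ih ρ.tail F (fun γ => G (.cons s γ))
    rw [sum_ctxBasis_some, sum_ctxBasis_some, Finset.mul_sum]
    refine Finset.sum_congr rfl fun s _ => ?_
    simp only [split_snd_right, Env.wt_cons]
    calc _ = ∑ γ : CtxBasis Γ, ρ.head s *
            (F (Split.fst (Γ₁ := .none :: Γ₁) (.right S h) (.cons s γ)) *
            G (.cons s (h.snd γ)) * Env.wt ρ.tail γ) :=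
            Finset.sum_congr rfl fun γ _ => mul_left_comm _ (ρ.head s) _
      _ = ρ.head s * ((∑ γ, F γ * (h.fstE ρ.tail).wt γ) *
            ∑ γ, G (.cons s γ) * Env.wt (h.sndE ρ.tail) γ) := by
            simp only [split_fst_right]
            exact (Finset.mul_sum _ _ (ρ.head s)).symm.trans (congrArg (ρ.head s * ·) (this s))
      _ = (∑ γ, F γ * Env.wt (h.fstE ρ.tail) γ) *
            ∑ γ, ρ.head s * (G (.cons s γ) * (h.sndE ρ.tail).wt γ) := by
            rw [mul_left_comm, Finset.mul_sum _ _ (ρ.head s)]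
      _ = _ := congrArg (_ * ·) (Finset.sum_congr rfl fun γ _ => mul_left_comm (ρ.head s) _ _)

/-- The value of the linear map denoted by a derivation at a pure tensor. -/
noncomputable def ev {f : Frag} {Γ : Ctx f} {M : Tm f} {T : Prp f} (d : Der Γ M T) (ρ : Env Γ)
    (t : Basis T) : ℂ :=
  ∑ γ, den d t γ * ρ.wt γ

theorem ev_nil {f : Frag} {M : Tm f} {T : Prp f} (d : Der [] M T) (t : Basis T) :
    ev d .nil t = den d t () :=
  (sum_ctxBasis_nil _).trans (mul_one _)

/-- The basis vector with index `s`. -/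
def bvec {f : Frag} {S : Prp f} (s : Basis S) : Basis S → ℂ := fun x => if x = s then 1 else 0

theorem sum_bvec {f : Frag} {S : Prp f} (s : Basis S) (F : Basis S → ℂ) :
    ∑ x, F x * bvec s x = F s := by
  simp [bvec]

theorem ev_cons {f : Frag} {Γ : Ctx f} {M : Tm f} {S T : Prp f} (d : Der (some S :: Γ) M T)
    (x : Basis S → ℂ) (ρ : Env Γ) (t : Basis T) :
    ev d (.cons x ρ) t = ∑ s, x s * ∑ γ, den d t (.cons s γ) * ρ.wt γ := by
  rw [ev, sum_ctxBasis_some]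
  refine Finset.sum_congr rfl fun s _ => ?_
  rw [Finset.mul_sum]
  refine Finset.sum_congr rfl fun γ _ => ?_
  rw [Env.cons_wt_cons, mul_left_comm]

theorem ev_bind {f : Frag} {Γ : Ctx f} {M : Tm f} {S T : Prp f} (d : Der (some S :: Γ) M T)
    (ρ : Env Γ) (s : Basis S) (t : Basis T) :
    ev d (.cons (bvec s) ρ) t = ∑ γ, den d t (.cons s γ) * ρ.wt γ := by
  rw [ev_cons, ← sum_bvec s (fun s => ∑ γ, den d t (.cons s γ) * ρ.wt γ)]
  exact Finset.sum_congr rfl fun _ _ => mul_comm _ _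

/-- Environments are pure tensors, so a denotation is linear in each entry and determined by basis
vectors. The rules that bind variables are reduced to this. -/
theorem ev_linear {f : Frag} {Γ : Ctx f} {M : Tm f} {S T : Prp f} (d : Der (some S :: Γ) M T)
    (x : Basis S → ℂ) (ρ : Env Γ) (t : Basis T) :
    ev d (.cons x ρ) t = ∑ s, x s * ev d (.cons (bvec s) ρ) t := by
  rw [ev_cons]
  exact Finset.sum_congr rfl fun s _ => by rw [ev_bind]

theorem ev_bind₂ {f : Frag} {Γ : Ctx f} {M : Tm f} {S S' T : Prp f}
    (d : Der (some S :: some S' :: Γ) M T)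
    (ρ : Env Γ) (s : Basis S) (s' : Basis S') (t : Basis T) :
    ev d (.cons (bvec s) (.cons (bvec s') ρ)) t =
      ∑ γ, den d t (.cons s (.cons s' γ)) * ρ.wt γ := by
  rw [ev_bind, sum_ctxBasis_some,
    ← sum_bvec s' (fun s' => ∑ γ, den d t (.cons s (.cons s' γ)) * ρ.wt γ)]
  refine Finset.sum_congr rfl fun x _ => ?_
  rw [mul_comm, Finset.mul_sum]
  refine Finset.sum_congr rfl fun γ _ => ?_
  rw [Env.cons_wt_cons, mul_left_comm]

theorem ev_linear₂ {f : Frag} {Γ : Ctx f} {M : Tm f} {S S' T : Prp f}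
    (d : Der (some S :: some S' :: Γ) M T) (x : Basis S → ℂ) (y : Basis S' → ℂ) (ρ : Env Γ)
    (t : Basis T) :
    ev d (.cons x (.cons y ρ)) t =
      ∑ s', ∑ s, y s' * x s * ev d (.cons (bvec s) (.cons (bvec s') ρ)) t := by
  rw [ev_cons, Finset.sum_comm]
  refine Finset.sum_congr rfl fun s _ => ?_
  rw [sum_ctxBasis_some, Finset.mul_sum]
  refine Finset.sum_congr rfl fun s' _ => ?_
  rw [ev_bind₂, Finset.mul_sum, Finset.mul_sum]
  refine Finset.sum_congr rfl fun γ _ => ?_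
  rw [Env.cons_wt_cons]; ring

/-! ### Each rule as a multilinear formula in the environment. -/

section Equations

variable {f : Frag} {Γ Γ₁ Γ₂ : Ctx f}

theorem ev_ax {i : ℕ} {S : Prp f} (h : Only Γ i S) (ρ : Env Γ) :
    ev (.ax h) ρ = h.getE ρ := by
  funext t
  rw [← h.sum_wt ρ t]; rfl

theorem ev_sum {M N : Tm f} {S : Prp f} (d : Der Γ M S) (e : Der Γ N S) (ρ : Env Γ) :
    ev (.sum d e) ρ = ev d ρ + ev e ρ := by
  funext t
  simp [ev, den, add_mul, Finset.sum_add_distrib]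

theorem ev_prod {M : Tm f} {S : Prp f} (a : Scal f) (d : Der Γ M S) (ρ : Env Γ) :
    ev (.prod a d) ρ = a.toComplex • ev d ρ := by
  funext t
  simp [ev, den, mul_assoc, Finset.mul_sum]

theorem ev_zeroE {Γ Γ₁ Γ₂ : Ctx .mixed} {m : Tm .mixed} (A : Prp .mixed) (h : Split Γ Γ₁ Γ₂)
    (d : Der Γ₁ m .zero) (ρ : Env Γ) : ev (.zeroE A h d) ρ = 0 := by
  funext t
  simp [ev, den]

theorem ev_oneI (h : Γ.Empty) (ρ : Env Γ) : ev (.oneI h) ρ = fun _ => 1 := by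
  funext t
  simp [ev, den, h.sum_wt]

theorem ev_oneE {M N : Tm f} {S : Prp f} (h : Split Γ Γ₁ Γ₂) (d : Der Γ₁ M .one)
    (e : Der Γ₂ N S) (ρ : Env Γ) :
    ev (.oneE h d e) ρ = ev d (h.fstE ρ) () • ev e (h.sndE ρ) := by
  funext t
  exact h.sum_mul ρ (fun γ => den d () γ) (fun γ => den e t γ)

theorem ev_lolliI {M : Tm f} {S T : Prp f} (d : Der (some S :: Γ) M T) (ρ : Env Γ) :
    ev (.lolliI d) ρ = fun t => ev d (.cons (bvec t.1) ρ) t.2 := by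
  funext t
  rw [ev_bind]; rfl

theorem ev_lolliE {M N : Tm f} {S T : Prp f} (h : Split Γ Γ₁ Γ₂)
    (d : Der Γ₁ M (.lolli S T)) (e : Der Γ₂ N S) (ρ : Env Γ) :
    ev (.lolliE h d e) ρ =
      fun t => ∑ s : Basis S, ev d (h.fstE ρ) (s, t) * ev e (h.sndE ρ) s := by
  funext t
  have : ∀ γ, den (.lolliE h d e) t γ =
      ∑ s : Basis S, den d (s, t) (h.fst γ) * den e s (h.snd γ) := by
    intro γ
    simp only [den, Matrix.of_apply, evalMap, ite_mul, one_mul, zero_mul]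
    rw [Fintype.sum_prod_type]
    refine Finset.sum_congr rfl fun s _ => ?_
    rw [Finset.sum_eq_single t]
    · simp
    · intro b _ hb; simp [hb]
    · simp
  simp only [ev, this, Finset.sum_mul]
  rw [Finset.sum_comm]
  exact Finset.sum_congr rfl fun s _ => (h.sum_mul ρ (fun γ => den d (s, t) γ) (fun γ => den e s γ)).trans (Finset.sum_mul _ _ _)

theorem ev_ampI {Γ : Ctx .pure} {m n : Tm .pure} {P Q : Prp .pure} (d : Der Γ m P)
    (e : Der Γ n Q) (ρ : Env Γ) :
    ev (.ampI d e) ρ = Sum.elim (ev d ρ) (ev e ρ) := by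
  funext t
  rcases t with t | t <;> rfl

theorem ev_ampE₁ {Γ Γ₁ Γ₂ : Ctx .pure} {m n : Tm .pure} {P Q R : Prp .pure}
    (h : Split Γ Γ₁ Γ₂) (d : Der Γ₁ m (.amp P Q)) (e : Der (some P :: Γ₂) n R) (ρ : Env Γ) :
    ev (.ampE₁ h d e) ρ = ev e (.cons (fun x => ev d (h.fstE ρ) (.inl x)) (h.sndE ρ)) := by
  funext t
  rw [ev_linear]
  simp only [ev_bind]
  simp only [ev, den, Matrix.of_apply, Finset.sum_mul]
  rw [Finset.sum_comm]
  exact Finset.sum_congr rfl fun s _ =>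
    (h.sum_mul ρ (fun γ => den d (.inl s) γ) (fun γ => den e t (.cons s γ))).trans (Finset.sum_mul _ _ _)

theorem ev_ampE₂ {Γ Γ₁ Γ₂ : Ctx .pure} {m n : Tm .pure} {P Q R : Prp .pure}
    (h : Split Γ Γ₁ Γ₂) (d : Der Γ₁ m (.amp P Q)) (e : Der (some Q :: Γ₂) n R) (ρ : Env Γ) :
    ev (.ampE₂ h d e) ρ = ev e (.cons (fun x => ev d (h.fstE ρ) (.inr x)) (h.sndE ρ)) := by
  funext t
  rw [ev_linear]
  simp only [ev_bind]
  simp only [ev, den, Matrix.of_apply, Finset.sum_mul]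
  rw [Finset.sum_comm]
  exact Finset.sum_congr rfl fun s _ =>
    (h.sum_mul ρ (fun γ => den d (.inr s) γ) (fun γ => den e t (.cons s γ))).trans (Finset.sum_mul _ _ _)

theorem ev_plusI₁ {Γ : Ctx .mixed} {m : Tm .mixed} {A : Prp .mixed} (C : Prp .mixed)
    (d : Der Γ m A) (ρ : Env Γ) : ev (.plusI₁ C d) ρ = Sum.elim (ev d ρ) (fun _ => 0) := by
  funext t
  rcases t with t | t
  · rfl
  · exact Finset.sum_eq_zero fun γ _ => zero_mul _

theorem ev_plusI₂ {Γ : Ctx .mixed} {m : Tm .mixed} {C : Prp .mixed} (A : Prp .mixed)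
    (d : Der Γ m C) (ρ : Env Γ) : ev (.plusI₂ A d) ρ = Sum.elim (fun _ => 0) (ev d ρ) := by
  funext t
  rcases t with t | t
  · exact Finset.sum_eq_zero fun γ _ => zero_mul _
  · rfl

theorem ev_plusE {Γ Γ₁ Γ₂ : Ctx .mixed} {m n o : Tm .mixed} {A C D : Prp .mixed}
    (h : Split Γ Γ₁ Γ₂) (d : Der Γ₁ m (.plus A C)) (e₁ : Der (some A :: Γ₂) n D)
    (e₂ : Der (some C :: Γ₂) o D) (ρ : Env Γ) :
    ev (.plusE h d e₁ e₂) ρ = ev e₁ (.cons (fun x => ev d (h.fstE ρ) (.inl x)) (h.sndE ρ)) +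
      ev e₂ (.cons (fun x => ev d (h.fstE ρ) (.inr x)) (h.sndE ρ)) := by
  funext t
  rw [Pi.add_apply, ev_linear, ev_linear e₂]
  simp only [ev_bind]
  simp only [ev, den, Matrix.of_apply, add_mul, Finset.sum_add_distrib, Finset.sum_mul]
  congr 1
  · rw [Finset.sum_comm]
    exact Finset.sum_congr rfl fun s _ =>
      (h.sum_mul ρ (fun γ => den d (.inl s) γ) (fun γ => den e₁ t (.cons s γ))).trans (Finset.sum_mul _ _ _)
  · rw [Finset.sum_comm]
    exact Finset.sum_congr rfl fun s _ =>
      (h.sum_mul ρ (fun γ => den d (.inr s) γ) (fun γ => den e₂ t (.cons s γ))).trans (Finset.sum_mul _ _ _)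

theorem ev_tensI {M N : Tm f} {S T : Prp f} (h : Split Γ Γ₁ Γ₂) (d : Der Γ₁ M S)
    (e : Der Γ₂ N T) (ρ : Env Γ) :
    ev (.tensI h d e) ρ = fun t => ev d (h.fstE ρ) t.1 * ev e (h.sndE ρ) t.2 := by
  funext t
  exact h.sum_mul ρ (fun γ => den d t.1 γ) (fun γ => den e t.2 γ)

theorem ev_tensE {M N : Tm f} {S₁ S₂ T : Prp f} (h : Split Γ Γ₁ Γ₂)
    (d : Der Γ₁ M (.tensor S₁ S₂)) (e : Der (some S₂ :: some S₁ :: Γ₂) N T) (ρ : Env Γ) :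
    ev (.tensE h d e) ρ = fun t => ∑ x₁ : Basis S₁, ∑ x₂ : Basis S₂,
      ev d (h.fstE ρ) (x₁, x₂) * ev e (.cons (bvec x₂) (.cons (bvec x₁) (h.sndE ρ))) t := by
  funext t
  simp only [ev_bind₂]
  simp only [ev, den, Matrix.of_apply, Finset.sum_mul]
  rw [Finset.sum_comm]
  refine (Fintype.sum_prod_type (α₁ := Basis S₁) (α₂ := Basis S₂) _).trans ?_
  exact Finset.sum_congr rfl fun x₁ _ => Finset.sum_congr rfl fun x₂ _ =>
    (h.sum_mul ρ (fun γ => den d (x₁, x₂) γ) (fun γ => den e t (.cons x₂ (.cons x₁ γ)))).trans (Finset.sum_mul _ _ _)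

theorem ev_BI {Γ : Ctx .mixed} {m : Tm .pure} {P : Prp .pure} (h : Γ.Empty) (d : Der [] m P)
    (ρ : Env Γ) : ev (.BI h d) ρ = fun t => ev d .nil t.1 * star (ev d .nil t.2) := by
  funext t
  have : ∀ γ, den (.BI h d) t γ = den d t.1 () * star (den d t.2 ()) := fun γ => rfl
  simp only [ev, this]
  rw [← Finset.mul_sum, h.sum_wt, mul_one]
  exact congrArg₂ (fun a b => a * star b) (ev_nil d t.1).symm (ev_nil d t.2).symm

theorem ev_BlolliE {Γ Γ₁ Γ₂ : Ctx .mixed} {m n : Tm .mixed} {P Q : Prp .pure}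
    (h : Split Γ Γ₁ Γ₂) (d : Der Γ₁ m (.B (.lolli P Q))) (e : Der Γ₂ n (.B P)) (ρ : Env Γ) :
    ev (.BlolliE h d e) ρ = fun t => ∑ p : Basis P, ∑ p' : Basis P,
      ev d (h.fstE ρ) ((p, t.1), (p', t.2)) * ev e (h.sndE ρ) (p, p') := by
  funext t
  have : ∀ γ, den (.BlolliE h d e) t γ = ∑ p : Basis P, ∑ p' : Basis P,
      den d ((p, t.1), (p', t.2)) (h.fst γ) * den e (p, p') (h.snd γ) := by
    intro γ
    -- The entries of `𝓑(eval)` are `0` or `1`, and a nonzero entry forces `y` and the output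
    -- indices; the double sum collapses to the sum over `p` and `p'`.
    have key : ∀ (x : (Basis P × Basis Q) × (Basis P × Basis Q)) (y : Basis P × Basis P),
        Bmap (evalMap (Basis P) (Basis Q)) t ((x.1, y.1), (x.2, y.2)) =
          if (y = (x.1.1, x.2.1) ∧ x.1.2 = t.1 ∧ x.2.2 = t.2) then 1 else 0 := by
      rintro ⟨⟨a, b⟩, c, d⟩ ⟨p, p'⟩
      show (if a = p ∧ b = t.1 then (1 : ℂ) else 0) * star (if c = p' ∧ d = t.2 then (1 : ℂ) else 0) =
        if (p, p') = (a, c) ∧ b = t.1 ∧ d = t.2 then 1 else 0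
      by_cases h1 : a = p <;> by_cases h2 : c = p' <;> by_cases h3 : b = t.1 <;>
        by_cases h4 : d = t.2 <;> simp [h1, h2, h3, h4, eq_comm]
    calc den (.BlolliE h d e) t γ =
        ∑ x : (Basis P × Basis Q) × (Basis P × Basis Q), ∑ y : Basis P × Basis P,
        Bmap (evalMap (Basis P) (Basis Q)) t ((x.1, y.1), (x.2, y.2)) *
          (den d x (h.fst γ) * den e y (h.snd γ)) := rfl
      _ = ∑ x : (Basis P × Basis Q) × (Basis P × Basis Q),
          if x.1.2 = t.1 ∧ x.2.2 = t.2 then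
            den d x (h.fst γ) * den e (x.1.1, x.2.1) (h.snd γ) else 0 := by
          refine Finset.sum_congr rfl fun x _ => ?_
          rw [Finset.sum_eq_single (x.1.1, x.2.1)]
          · rw [key]
            by_cases hx : x.1.2 = t.1 ∧ x.2.2 = t.2 <;> simp [hx]
          · intro y _ hy
            rw [key, if_neg (fun h => hy h.1), zero_mul]
          · simp
      _ = _ := by
          rw [Fintype.sum_prod_type, Fintype.sum_prod_type]
          refine Finset.sum_congr rfl fun p _ => ?_
          rw [Finset.sum_eq_single t.1]
          · rw [Fintype.sum_prod_type]
            refine Finset.sum_congr rfl fun p' _ => ?_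
            rw [Finset.sum_eq_single t.2]
            · exact if_pos ⟨rfl, rfl⟩
            · intro b _ hb; simp [hb]
            · simp
          · intro b _ hb; simp [hb]
          · simp
  simp only [ev, this, Finset.sum_mul]
  rw [Finset.sum_comm]
  refine Finset.sum_congr rfl fun p _ => ?_
  rw [Finset.sum_comm]
  exact Finset.sum_congr rfl fun p' _ =>
    (h.sum_mul ρ (fun γ => den d ((p, t.1), (p', t.2)) γ) (fun γ => den e (p, p') γ)).trans (Finset.sum_mul _ _ _)

theorem ev_Btens {Γ : Ctx .mixed} {m : Tm .mixed} {P Q : Prp .pure}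
    (d : Der Γ m (.tensor (.B P) (.B Q))) (ρ : Env Γ) :
    ev (.Btens d) ρ = fun t => ev d ρ ((t.1.1, t.2.1), (t.1.2, t.2.2)) := rfl

theorem ev_topI (Γ : Ctx .pure) (ρ : Env Γ) : ev (.topI Γ) ρ = 0 := by
  funext t
  exact t.elim

end Equations

/-! ## Coherence: the denotation of a derivation depends only on its conclusion

Two derivations of the same term may cut on different propositions.  They are compared by a binary
logical relation between the denotations of two propositions, which is equality when these
propositions are equal, and relates only the zero vectors when their outermost connectives
differ. -/

/-- The logical relation. -/
def Rel : {f : Frag} → (S S' : Prp f) → (Basis S → ℂ) → (Basis S' → ℂ) → Prop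
  | _, .one, .one, x, y => x () = y ()
  | _, .lolli S T, .lolli S' T', x, y => ∀ a a', Rel S S' a a' →
      Rel T T' (fun t => ∑ s, x (s, t) * a s) (fun t => ∑ s, y (s, t) * a' s)
  -- A tensor need not be pure, and an operator in `𝓑(P)` need not have rank one; in both cases the
  -- relation is the linear span of the pairs of related generators.
  | _, .tensor S T, .tensor S' T', x, y => (x, y) ∈ Submodule.span ℂ
      {p : (Basis S × Basis T → ℂ) × (Basis S' × Basis T' → ℂ) |
        ∃ a a' b b', Rel S S' a a' ∧ Rel T T' b b' ∧
          p = (fun t => a t.1 * b t.2, fun t => a' t.1 * b' t.2)}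
  | _, .amp P Q, .amp P' Q', x, y =>
      Rel P P' (fun t => x (.inl t)) (fun t => y (.inl t)) ∧
      Rel Q Q' (fun t => x (.inr t)) (fun t => y (.inr t))
  | _, .plus P Q, .plus P' Q', x, y =>
      Rel P P' (fun t => x (.inl t)) (fun t => y (.inl t)) ∧
      Rel Q Q' (fun t => x (.inr t)) (fun t => y (.inr t))
  | _, .B P, .B P', x, y => (x, y) ∈ Submodule.span ℂ
      {p : (Basis P × Basis P → ℂ) × (Basis P' × Basis P' → ℂ) |
        ∃ a a', Rel P P' a a' ∧
          p = (fun t => a t.1 * star (a t.2), fun t => a' t.1 * star (a' t.2))}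
  -- This also covers `⊤` with `⊤` and `0` with `0`, whose spaces are zero. For different
  -- connectives it expresses that a term typed in both ways denotes zero.
  | _, _, _, x, y => x = 0 ∧ y = 0

theorem Rel.zero {f : Frag} (S : Prp f) : ∀ S' : Prp f, Rel S S' 0 0 := by
  induction S with
  | tensor S T ihS ihT =>
    intro S'
    cases S' <;> first | exact ⟨rfl, rfl⟩ | exact Submodule.zero_mem _
  | lolli S T ihS ihT =>
    intro S'
    cases S' with
    | lolli S' T' =>
      intro a a' _
      convert ihT T' using 1 <;> (funext t; exact Finset.sum_eq_zero fun s _ => zero_mul _)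
    | _ => exact ⟨rfl, rfl⟩
  | B P ih => intro S'; cases S' <;> first | exact ⟨rfl, rfl⟩ | exact Submodule.zero_mem _
  | amp P Q ihP ihQ => intro S'; cases S' <;> first | exact ⟨rfl, rfl⟩ | exact ⟨ihP _, ihQ _⟩
  | plus P Q ihP ihQ => intro S'; cases S' <;> first | exact ⟨rfl, rfl⟩ | exact ⟨ihP _, ihQ _⟩
  | one => intro S'; cases S' <;> first | exact ⟨rfl, rfl⟩ | rfl
  | top => intro S'; cases S' <;> exact ⟨rfl, rfl⟩
  | zero => intro S'; cases S' <;> exact ⟨rfl, rfl⟩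

theorem Rel.mismatch_add {X Y : Type} {x x₁ : X → ℂ} {y y₁ : Y → ℂ} (h : x = 0 ∧ y = 0)
    (h₁ : x₁ = 0 ∧ y₁ = 0) (a b : ℂ) : a • x + b • x₁ = 0 ∧ a • y + b • y₁ = 0 := by
  rw [h.1, h.2, h₁.1, h₁.2]; simp

/-- `Rel S S'` is a linear subspace of the product of the two spaces: on functions because
application is linear in the function, on tensors and operators because it is a span. The rules for
sums and scalars and the inductions on spans rest on this. -/
theorem Rel.comb {f : Frag} (S : Prp f) : ∀ (S' : Prp f) {x x₁ : Basis S → ℂ}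
    {y y₁ : Basis S' → ℂ} (_ : Rel S S' x y) (_ : Rel S S' x₁ y₁) (a b : ℂ),
    Rel S S' (a • x + b • x₁) (a • y + b • y₁) := by
  induction S with
  | tensor S T ihS ihT =>
    intro S' x x₁ y y₁ h h₁ a b
    cases S' <;> first | exact Rel.mismatch_add h h₁ a b |
      exact Submodule.add_mem _ (Submodule.smul_mem _ a h) (Submodule.smul_mem _ b h₁)
  | lolli S T ihS ihT =>
    intro S' x x₁ y y₁ h h₁ a b
    cases S' with
    | lolli S' T' =>
      intro c c' hc
      convert ihT T' (h c c' hc) (h₁ c c' hc) a b using 1 <;>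
      · funext t
        simp only [Pi.add_apply, Pi.smul_apply, smul_eq_mul, Finset.mul_sum,
          ← Finset.sum_add_distrib]
        refine Finset.sum_congr rfl fun s _ => ?_
        change (a * _ + b * _) * _ = _
        ring
    | _ => exact Rel.mismatch_add h h₁ a b
  | B P ih =>
    intro S' x x₁ y y₁ h h₁ a b
    cases S' <;> first | exact Rel.mismatch_add h h₁ a b |
      exact Submodule.add_mem _ (Submodule.smul_mem _ a h) (Submodule.smul_mem _ b h₁)
  | amp P Q ihP ihQ =>
    intro S' x x₁ y y₁ h h₁ a b
    cases S' <;> first | exact Rel.mismatch_add h h₁ a b |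
      exact ⟨ihP _ h.1 h₁.1 a b, ihQ _ h.2 h₁.2 a b⟩
  | plus P Q ihP ihQ =>
    intro S' x x₁ y y₁ h h₁ a b
    cases S' <;> first | exact Rel.mismatch_add h h₁ a b |
      exact ⟨ihP _ h.1 h₁.1 a b, ihQ _ h.2 h₁.2 a b⟩
  | one =>
    intro S' x x₁ y y₁ h h₁ a b
    cases S' <;> first | exact Rel.mismatch_add h h₁ a b |
      exact congrArg₂ (fun u v => a * u + b * v) h h₁
  | top => intro S' x x₁ y y₁ h h₁ a b; cases S' <;> exact Rel.mismatch_add h h₁ a b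
  | zero => intro S' x x₁ y y₁ h h₁ a b; cases S' <;> exact Rel.mismatch_add h h₁ a b

theorem Rel.add {f : Frag} {S S' : Prp f} {x x₁ : Basis S → ℂ}
    {y y₁ : Basis S' → ℂ} (h : Rel S S' x y) (h₁ : Rel S S' x₁ y₁) :
    Rel S S' (x + x₁) (y + y₁) := by
  have := Rel.comb S S' h h₁ 1 1
  rwa [one_smul, one_smul, one_smul, one_smul] at this

theorem Rel.smul {f : Frag} {S S' : Prp f} {x : Basis S → ℂ}
    {y : Basis S' → ℂ} (h : Rel S S' x y) (a : ℂ) :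
    Rel S S' (a • x) (a • y) := by
  have := Rel.comb S S' h h a 0
  rwa [zero_smul, zero_smul, add_zero, add_zero] at this

/-! ### Generators of tensor products and of operator spaces. -/

theorem mem_span_of_diag {X Z : Type} [Fintype X] (v : Z → X → ℂ)
    (hv : ∀ x : X → ℂ, x ∈ Submodule.span ℂ (Set.range v))
    {s : Set ((X → ℂ) × (X → ℂ))} (hs : ∀ z, (v z, v z) ∈ s) (x : X → ℂ) :
    (x, x) ∈ Submodule.span ℂ s := by
  have h := hv x
  induction h using Submodule.span_induction with
  | mem x hx => obtain ⟨z, rfl⟩ := hx; exact Submodule.subset_span (hs z)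
  | zero => exact Submodule.zero_mem _
  | add x y _ _ hx hy => exact Submodule.add_mem _ hx hy
  | smul a x _ hx => exact Submodule.smul_mem _ a hx

theorem eq_of_mem_span_diag {X : Type} {s : Set ((X → ℂ) × (X → ℂ))} (hs : ∀ p ∈ s, p.1 = p.2)
    {x y : X → ℂ} (h : (x, y) ∈ Submodule.span ℂ s) : x = y :=
  Submodule.span_induction (p := fun p _ => p.1 = p.2) hs rfl
    (fun _ _ _ _ h h' => congrArg₂ (· + ·) h h') (fun a _ _ h => congrArg (a • ·) h) h

theorem span_tensor {X Y : Type} [Fintype X] [Fintype Y] [DecidableEq X] [DecidableEq Y]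
    (x : X × Y → ℂ) : x ∈ Submodule.span ℂ (Set.range
      fun (p : (X → ℂ) × (Y → ℂ)) => fun (t : X × Y) => p.1 t.1 * p.2 t.2) := by
  have : x = ∑ z : X × Y, x z • fun t : X × Y =>
      (Pi.single z.1 1 : X → ℂ) t.1 * (Pi.single z.2 1 : Y → ℂ) t.2 := by
    funext t
    rw [Finset.sum_apply, Finset.sum_eq_single t]
    · simp
    · intro b _ hb
      by_cases h1 : t.1 = b.1
      · have h2 : t.2 ≠ b.2 := fun h2 => hb (Prod.ext h1 h2).symm
        simp [h2]
      · simp [h1]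
    · simp
  rw [this]
  exact Submodule.sum_mem _ fun z _ => Submodule.smul_mem _ _ (Submodule.subset_span ⟨(_, _), rfl⟩)

/-- Polarization: `|p⟩⟨q|` is a combination of the four operators `|v⟩⟨v|` with `v = p ± q` and `v =
p ± i q`, and the matrix units `|i⟩⟨j|` are of the form `|p⟩⟨q|`. -/
theorem span_rank_one {X : Type} [Fintype X] [DecidableEq X]
    (x : X × X → ℂ) : x ∈ Submodule.span ℂ (Set.range
      fun (p : X → ℂ) => fun (t : X × X) => p t.1 * star (p t.2)) := by
  set W := Submodule.span ℂ (Set.range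
      fun (p : X → ℂ) => fun (t : X × X) => p t.1 * star (p t.2))
  have hW : ∀ p : X → ℂ, (fun (t : X × X) => p t.1 * star (p t.2)) ∈ W :=
    fun p => Submodule.subset_span ⟨p, rfl⟩
  have h : ∀ p q : X → ℂ, (fun (t : X × X) => p t.1 * star (q t.2)) ∈ W := by
    intro p q
    have key : (fun (t : X × X) => p t.1 * star (q t.2)) =
        (1 / 4 : ℂ) • (fun (t : X × X) => (p + q) t.1 * star ((p + q) t.2)) +
        (-1 / 4 : ℂ) • (fun (t : X × X) => (p - q) t.1 * star ((p - q) t.2)) +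
        (Complex.I / 4) • (fun (t : X × X) => (p + Complex.I • q) t.1 *
          star ((p + Complex.I • q) t.2)) +
        (-Complex.I / 4) • (fun (t : X × X) => (p - Complex.I • q) t.1 *
          star ((p - Complex.I • q) t.2)) := by
      funext t
      simp only [Pi.add_apply, Pi.sub_apply, Pi.smul_apply, smul_eq_mul, star_add, star_sub,
        star_mul', Complex.star_def, Complex.conj_I]
      ring_nf
      simp only [Complex.I_sq]
      ring
    rw [key]
    exact W.add_mem (W.add_mem (W.add_mem (W.smul_mem _ (hW _)) (W.smul_mem _ (hW _)))
      (W.smul_mem _ (hW _))) (W.smul_mem _ (hW _))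
  have : x = ∑ z : X × X, x z • fun t : X × X =>
      (Pi.single z.1 1 : X → ℂ) t.1 * star ((Pi.single z.2 1 : X → ℂ) t.2) := by
    funext t
    rw [Finset.sum_apply, Finset.sum_eq_single t]
    · simp
    · intro b _ hb
      by_cases h1 : t.1 = b.1
      · have h2 : t.2 ≠ b.2 := fun h2 => hb (Prod.ext h1 h2).symm
        simp [h2]
      · simp [h1]
    · simp
  rw [this]
  exact Submodule.sum_mem _ fun z _ => Submodule.smul_mem _ _ (h _ _)

/-- For tensors and operators the related generators are diagonal by induction, so their span lies
in the diagonal, and it fills the diagonal because the generators span the space. For functions,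
reflexivity at the source allows testing on basis vectors. -/
theorem Rel.iff_eq {f : Frag} (S : Prp f) : ∀ x y : Basis S → ℂ, Rel S S x y ↔ x = y := by
  induction S with
  | one => exact fun x y => ⟨fun h => funext fun _ => h, fun h => congrFun h _⟩
  | top => exact fun x y => ⟨fun h => h.1.trans h.2.symm, fun _ => ⟨funext (·.elim), funext (·.elim)⟩⟩
  | zero =>
    exact fun x y => ⟨fun h => h.1.trans h.2.symm, fun _ => ⟨funext (·.elim), funext (·.elim)⟩⟩
  | amp P Q ihP ihQ =>
    refine fun x y => ⟨fun h => funext fun t => ?_, ?_⟩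
    · rcases t with t | t
      · exact congrFun ((ihP _ _).1 h.1) t
      · exact congrFun ((ihQ _ _).1 h.2) t
    · rintro rfl
      exact ⟨(ihP _ _).2 rfl, (ihQ _ _).2 rfl⟩
  | plus P Q ihP ihQ =>
    refine fun x y => ⟨fun h => funext fun t => ?_, ?_⟩
    · rcases t with t | t
      · exact congrFun ((ihP _ _).1 h.1) t
      · exact congrFun ((ihQ _ _).1 h.2) t
    · rintro rfl
      exact ⟨(ihP _ _).2 rfl, (ihQ _ _).2 rfl⟩
  | lolli S T ihS ihT =>
    refine fun x y => ⟨fun h => funext fun t => ?_, ?_⟩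
    · have := congrFun ((ihT _ _).1 (h (bvec t.1) (bvec t.1) ((ihS _ _).2 rfl))) t.2
      exact (sum_bvec t.1 (fun s => x (s, t.2))).symm.trans
        (this.trans (sum_bvec t.1 (fun s => y (s, t.2))))
    · rintro rfl a a' ha
      rw [(ihS _ _).1 ha]
      exact (ihT _ _).2 rfl
  | tensor S T ihS ihT =>
    refine fun x y => ⟨fun h => ?_, ?_⟩
    · refine eq_of_mem_span_diag (X := Basis S × Basis T) ?_ h
      rintro _ ⟨a, a', b, b', ha, hb, rfl⟩
      rw [(ihS _ _).1 ha, (ihT _ _).1 hb]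
    · rintro rfl
      refine mem_span_of_diag (X := Basis S × Basis T) _ span_tensor ?_ x
      intro z
      exact ⟨z.1, z.1, z.2, z.2, (ihS _ _).2 rfl, (ihT _ _).2 rfl, rfl⟩
  | B P ih =>
    refine fun x y => ⟨fun h => ?_, ?_⟩
    · refine eq_of_mem_span_diag (X := Basis P × Basis P) ?_ h
      rintro _ ⟨a, a', ha, rfl⟩
      rw [(ih _ _).1 ha]
    · rintro rfl
      refine mem_span_of_diag (X := Basis P × Basis P) _ span_rank_one ?_ x
      intro z
      exact ⟨z, z, (ih _ _).2 rfl, rfl⟩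

/-- Environments that give related vectors to the variables declared in both contexts. -/
def CompatE {f : Frag} : (Γ Γ' : Ctx f) → Env Γ → Env Γ' → Prop
  | none :: Γ, none :: Γ', ρ, ρ' => CompatE Γ Γ' ρ ρ'
  -- A variable declared on one side only is unconstrained: two derivations may divide a context
  -- differently, since `topI` and `zeroE` absorb unused declarations. A variable that occurs
  -- through `ax` is declared on both sides.
  | none :: Γ, some _ :: Γ', ρ, ρ' => CompatE Γ Γ' ρ ρ'.tail
  | some _ :: Γ, none :: Γ', ρ, ρ' => CompatE Γ Γ' ρ.tail ρ'
  | some S :: Γ, some S' :: Γ', ρ, ρ' => Rel S S' ρ.head ρ'.head ∧ CompatE Γ Γ' ρ.tail ρ'.tail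
  | _, _, _, _ => True

theorem CompatE.refl {f : Frag} : ∀ (Γ : Ctx f) (ρ : Env Γ), CompatE Γ Γ ρ ρ
  | [], _ => trivial
  | none :: Γ, ρ => CompatE.refl Γ ρ
  | some _ :: Γ, ρ => ⟨(Rel.iff_eq _ _ _).2 rfl, CompatE.refl Γ ρ.tail⟩

theorem CompatE.split {f : Frag} {Γ Γ₁ Γ₂ : Ctx f} (h : Split Γ Γ₁ Γ₂) :
    ∀ {Γ' Γ₁' Γ₂' : Ctx f} (h' : Split Γ' Γ₁' Γ₂') {ρ : Env Γ} {ρ' : Env Γ'},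
      CompatE Γ Γ' ρ ρ' → CompatE Γ₁ Γ₁' (h.fstE ρ) (h'.fstE ρ') ∧
        CompatE Γ₂ Γ₂' (h.sndE ρ) (h'.sndE ρ') := by
  induction h with
  | nil => intro Γ' Γ₁' Γ₂' h' ρ ρ' c; cases h' <;> exact ⟨trivial, trivial⟩
  | none h ih =>
    intro Γ' Γ₁' Γ₂' h' ρ ρ' c
    cases h' with
    | nil => exact ⟨trivial, trivial⟩
    | none h' => exact ih h' c
    | left S h' => exact ih h' (ρ' := ρ'.tail) c
    | right S h' => exact ih h' (ρ' := ρ'.tail) c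
  | left S h ih =>
    intro Γ' Γ₁' Γ₂' h' ρ ρ' c
    cases h' with
    | nil => exact ⟨trivial, trivial⟩
    | none h' => exact ih h' (ρ := ρ.tail) c
    | left S h' => exact ⟨⟨c.1, (ih h' c.2).1⟩, (ih h' c.2).2⟩
    | right S h' => exact ih h' c.2
  | right S h ih =>
    intro Γ' Γ₁' Γ₂' h' ρ ρ' c
    cases h' with
    | nil => exact ⟨trivial, trivial⟩
    | none h' => exact ih h' (ρ := ρ.tail) c
    | left S h' => exact ih h' c.2
    | right S h' => exact ⟨(ih h' c.2).1, ⟨c.1, (ih h' c.2).2⟩⟩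

theorem CompatE.only {f : Frag} {Γ : Ctx f} {i : ℕ} {S : Prp f} (h : Only Γ i S) :
    ∀ {Γ' : Ctx f} {S' : Prp f} (h' : Only Γ' i S') {ρ : Env Γ} {ρ' : Env Γ'},
      CompatE Γ Γ' ρ ρ' → Rel S S' (h.getE ρ) (h'.getE ρ') := by
  induction h with
  | here hE => intro Γ' S' h' ρ ρ' c; cases h' with | here hE' => exact c.1
  | there h ih => intro Γ' S' h' ρ ρ' c; cases h' with | there h' => exact ih h' c

/-- A vector of a tensor product. -/
def tvec {f : Frag} {S T : Prp f} (a : Basis S → ℂ) (b : Basis T → ℂ) :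
    Basis (S.tensor T) → ℂ := fun t => a t.1 * b t.2

/-- The operator `|a⟩⟨a|`. -/
def bproj {P : Prp .pure} (a : Basis P → ℂ) : Basis (Prp.B P) → ℂ :=
  fun t => a t.1 * star (a t.2)

theorem Rel.tvec {f : Frag} {S T S' T' : Prp f} {a : Basis S → ℂ} {a' : Basis S' → ℂ}
    {b : Basis T → ℂ} {b' : Basis T' → ℂ} (ha : Rel S S' a a') (hb : Rel T T' b b') :
    Rel (S.tensor T) (S'.tensor T') (tvec a b) (tvec a' b') :=
  Submodule.subset_span ⟨a, a', b, b', ha, hb, rfl⟩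

theorem Rel.bproj {P P' : Prp .pure} {a : Basis P → ℂ} {a' : Basis P' → ℂ} (ha : Rel P P' a a') :
    Rel (.B P) (.B P') (bproj a) (bproj a') :=
  Submodule.subset_span ⟨a, a', ha, rfl⟩

/-- Linear maps preserve the relation if they preserve it on pure tensors. -/
theorem Rel.tensor_map {f g : Frag} {S T S' T' : Prp f} {U U' : Prp g}
    {x : Basis (S.tensor T) → ℂ} {y : Basis (S'.tensor T') → ℂ}
    (h : Rel (S.tensor T) (S'.tensor T') x y)
    (L : (Basis (S.tensor T) → ℂ) →ₗ[ℂ] (Basis U → ℂ))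
    (L' : (Basis (S'.tensor T') → ℂ) →ₗ[ℂ] (Basis U' → ℂ))
    (hL : ∀ a a' b b', Rel S S' a a' → Rel T T' b b' →
      Rel U U' (L (BImall.tvec a b)) (L' (BImall.tvec a' b'))) :
    Rel U U' (L x) (L' y) := by
  refine Submodule.span_induction (M := (Basis S × Basis T → ℂ) × (Basis S' × Basis T' → ℂ))
    (p := fun p _ => Rel U U' (L p.1) (L' p.2)) ?_ ?_ ?_ ?_ h
  · rintro _ ⟨a, a', b, b', ha, hb, rfl⟩
    exact hL a a' b b' ha hb
  · exact (L.map_zero).symm ▸ (L'.map_zero).symm ▸ Rel.zero U U'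
  · intro p q _ _ hp hq
    exact (L.map_add p.1 q.1).symm ▸ (L'.map_add p.2 q.2).symm ▸ hp.add hq
  · intro a p _ hp
    exact (L.map_smul a p.1).symm ▸ (L'.map_smul a p.2).symm ▸ hp.smul a

theorem Rel.B_map {g : Frag} {P P' : Prp .pure} {U U' : Prp g}
    {x : Basis (Prp.B P) → ℂ} {y : Basis (Prp.B P') → ℂ}
    (h : Rel (.B P) (.B P') x y)
    (L : (Basis (Prp.B P) → ℂ) →ₗ[ℂ] (Basis U → ℂ))
    (L' : (Basis (Prp.B P') → ℂ) →ₗ[ℂ] (Basis U' → ℂ))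
    (hL : ∀ a a', Rel P P' a a' → Rel U U' (L (BImall.bproj a)) (L' (BImall.bproj a'))) :
    Rel U U' (L x) (L' y) := by
  refine Submodule.span_induction (M := (Basis P × Basis P → ℂ) × (Basis P' × Basis P' → ℂ))
    (p := fun p _ => Rel U U' (L p.1) (L' p.2)) ?_ ?_ ?_ ?_ h
  · rintro _ ⟨a, a', ha, rfl⟩
    exact hL a a' ha
  · exact (L.map_zero).symm ▸ (L'.map_zero).symm ▸ Rel.zero U U'
  · intro p q _ _ hp hq
    exact (L.map_add p.1 q.1).symm ▸ (L'.map_add p.2 q.2).symm ▸ hp.add hq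
  · intro a p _ hp
    exact (L.map_smul a p.1).symm ▸ (L'.map_smul a p.2).symm ▸ hp.smul a

/-- The application of an element of `𝓑(P ⊸ Q)` to an element of `𝓑(P)`. -/
noncomputable def bapp {P Q : Prp .pure} : (Basis (Prp.B (P.lolli Q)) → ℂ) →ₗ[ℂ]
    (Basis (Prp.B P) → ℂ) →ₗ[ℂ] (Basis (Prp.B Q) → ℂ) :=
  LinearMap.mk₂ ℂ (fun x y t => ∑ p : Basis P, ∑ p' : Basis P,
      x ((p, t.1), (p', t.2)) * y (p, p'))
    (fun x x' y => by
      funext t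
      simp only [Pi.add_apply, ← Finset.sum_add_distrib]
      exact Finset.sum_congr rfl fun i _ => Finset.sum_congr rfl fun j _ => add_mul _ _ _)
    (fun c x y => by
      funext t
      simp only [Pi.smul_apply, smul_eq_mul, Finset.mul_sum]
      exact Finset.sum_congr rfl fun i _ => Finset.sum_congr rfl fun j _ => mul_assoc _ _ _)
    (fun x y y' => by
      funext t
      simp only [Pi.add_apply, ← Finset.sum_add_distrib]
      exact Finset.sum_congr rfl fun i _ => Finset.sum_congr rfl fun j _ => mul_add _ _ _)
    (fun c x y => by
      funext t
      simp only [Pi.smul_apply, smul_eq_mul, Finset.mul_sum]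
      exact Finset.sum_congr rfl fun i _ => Finset.sum_congr rfl fun j _ => mul_left_comm _ _ _)

/-- Functoriality of `𝓑` on rank-one operators: applying `|a⟩⟨a|` to `|b⟩⟨b|` gives the projector of
the vector obtained by applying `a` to `b`. -/
theorem bapp_bproj {P Q : Prp .pure} (a : Basis (P.lolli Q) → ℂ) (b : Basis P → ℂ) :
    bapp (bproj a) (bproj b) = bproj (fun q => ∑ p, a (p, q) * b p) := by
  funext t
  show ∑ p : Basis P, ∑ p' : Basis P, a (p, t.1) * star (a (p', t.2)) * (b p * star (b p')) =
    (∑ p, a (p, t.1) * b p) * star (∑ p, a (p, t.2) * b p)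
  rw [star_sum, Finset.sum_mul_sum]
  refine Finset.sum_congr rfl fun p _ => Finset.sum_congr rfl fun p' _ => ?_
  rw [star_mul']; ring

theorem Rel.bapp {P Q P' Q' : Prp .pure} {x : Basis (Prp.B (P.lolli Q)) → ℂ}
    {x' : Basis (Prp.B (P'.lolli Q')) → ℂ} {y : Basis (Prp.B P) → ℂ} {y' : Basis (Prp.B P') → ℂ}
    (hx : Rel (.B (P.lolli Q)) (.B (P'.lolli Q')) x x') (hy : Rel (.B P) (.B P') y y') :
    Rel (.B Q) (.B Q') (bapp x y) (bapp x' y') := by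
  refine hx.B_map (BImall.bapp.flip y) (BImall.bapp.flip y') fun a a' ha => ?_
  refine hy.B_map (BImall.bapp (BImall.bproj a)) (BImall.bapp (BImall.bproj a')) fun b b' hb => ?_
  rw [bapp_bproj, bapp_bproj]
  exact Rel.bproj (ha b b' hb)

/-- The isomorphism `𝓑(P) ⊗ 𝓑(Q) ≅ 𝓑(P ⊗ Q)`. -/
def btens {P Q : Prp .pure} : (Basis ((Prp.B P).tensor (.B Q)) → ℂ) →ₗ[ℂ]
    (Basis (Prp.B (P.tensor Q)) → ℂ) where
  toFun x t := x ((t.1.1, t.2.1), (t.1.2, t.2.2))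
  map_add' _ _ := rfl
  map_smul' _ _ := rfl

theorem btens_tvec_bproj {P Q : Prp .pure} (a : Basis P → ℂ) (b : Basis Q → ℂ) :
    btens (tvec (bproj a) (bproj b)) = bproj (tvec a b) := by
  funext t
  show (a t.1.1 * star (a t.2.1)) * (b t.1.2 * star (b t.2.2)) =
    (a t.1.1 * b t.1.2) * star (a t.2.1 * b t.2.2)
  rw [star_mul']; ring

/-- The tensor product of vectors, as a bilinear map. -/
noncomputable def tvecₗ {f : Frag} {S T : Prp f} : (Basis S → ℂ) →ₗ[ℂ] (Basis T → ℂ) →ₗ[ℂ]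
    (Basis (S.tensor T) → ℂ) :=
  LinearMap.mk₂ ℂ (fun x y => tvec x y)
    (fun _ _ _ => funext fun _ => add_mul _ _ _)
    (fun _ _ _ => funext fun _ => mul_assoc _ _ _)
    (fun _ _ _ => funext fun _ => mul_add _ _ _)
    (fun _ _ _ => funext fun _ => mul_left_comm _ _ _)

/-- By linearity it suffices to treat `|u⟩⟨u| ⊗ |v⟩⟨v|`, and the isomorphism sends this to `|u ⊗
v⟩⟨u ⊗ v|`. Since the factors of a generator are themselves only spanned by projectors, the
reduction is made once for each factor. -/
theorem Rel.btens {P Q P' Q' : Prp .pure} {x : Basis ((Prp.B P).tensor (.B Q)) → ℂ}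
    {x' : Basis ((Prp.B P').tensor (.B Q')) → ℂ}
    (hx : Rel ((Prp.B P).tensor (.B Q)) ((Prp.B P').tensor (.B Q')) x x') :
    Rel (.B (P.tensor Q)) (.B (P'.tensor Q')) (btens x) (btens x') := by
  refine hx.tensor_map BImall.btens BImall.btens fun a a' b b' ha hb => ?_
  refine ha.B_map (BImall.btens ∘ₗ tvecₗ.flip b) (BImall.btens ∘ₗ tvecₗ.flip b')
    fun u u' hu => ?_
  refine hb.B_map (BImall.btens ∘ₗ tvecₗ (BImall.bproj u)) (BImall.btens ∘ₗ tvecₗ (BImall.bproj u'))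
    fun v v' hv => ?_
  show Rel _ _ (BImall.btens (BImall.tvec (BImall.bproj u) (BImall.bproj v)))
    (BImall.btens (BImall.tvec (BImall.bproj u') (BImall.bproj v')))
  rw [btens_tvec_bproj, btens_tvec_bproj]
  exact Rel.bproj (hu.tvec hv)

/-- The elimination of a tensor product, as a linear map. -/
noncomputable def elimTensₗ {f : Frag} {Γ : Ctx f} {N : Tm f} {S₁ S₂ T : Prp f}
    (e : Der (some S₂ :: some S₁ :: Γ) N T) (ρ : Env Γ) :
    (Basis (S₁.tensor S₂) → ℂ) →ₗ[ℂ] (Basis T → ℂ) where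
  toFun x t := ∑ x₁ : Basis S₁, ∑ x₂ : Basis S₂,
      x (x₁, x₂) * ev e (.cons (bvec x₂) (.cons (bvec x₁) ρ)) t
  map_add' x y := by
    funext t
    simp only [Pi.add_apply, ← Finset.sum_add_distrib]
    exact Finset.sum_congr rfl fun i _ => Finset.sum_congr rfl fun j _ => add_mul _ _ _
  map_smul' c x := by
    funext t
    simp only [Pi.smul_apply, smul_eq_mul, Finset.mul_sum]
    exact Finset.sum_congr rfl fun i _ => Finset.sum_congr rfl fun j _ => mul_assoc _ _ _

theorem elimTensₗ_tvec {f : Frag} {Γ : Ctx f} {N : Tm f} {S₁ S₂ T : Prp f}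
    (e : Der (some S₂ :: some S₁ :: Γ) N T) (ρ : Env Γ) (a : Basis S₁ → ℂ) (b : Basis S₂ → ℂ) :
    elimTensₗ e ρ (tvec a b) = ev e (.cons b (.cons a ρ)) := by
  funext t
  rw [ev_linear₂]; rfl

theorem ev_tensE' {f : Frag} {Γ Γ₁ Γ₂ : Ctx f} {M N : Tm f} {S₁ S₂ T : Prp f} (h : Split Γ Γ₁ Γ₂)
    (d : Der Γ₁ M (.tensor S₁ S₂)) (e : Der (some S₂ :: some S₁ :: Γ₂) N T) (ρ : Env Γ) :
    ev (.tensE h d e) ρ = elimTensₗ e (h.sndE ρ) (ev d (h.fstE ρ)) := ev_tensE h d e ρ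

theorem ev_BlolliE' {Γ Γ₁ Γ₂ : Ctx .mixed} {m n : Tm .mixed} {P Q : Prp .pure}
    (h : Split Γ Γ₁ Γ₂) (d : Der Γ₁ m (.B (.lolli P Q))) (e : Der Γ₂ n (.B P)) (ρ : Env Γ) :
    ev (.BlolliE h d e) ρ = bapp (ev d (h.fstE ρ)) (ev e (h.sndE ρ)) := ev_BlolliE h d e ρ

theorem ev_Btens' {Γ : Ctx .mixed} {m : Tm .mixed} {P Q : Prp .pure}
    (d : Der Γ m (.tensor (.B P) (.B Q))) (ρ : Env Γ) :
    ev (.Btens d) ρ = btens (ev d ρ) := rfl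

theorem ev_tensI' {f : Frag} {Γ Γ₁ Γ₂ : Ctx f} {M N : Tm f} {S T : Prp f} (h : Split Γ Γ₁ Γ₂)
    (d : Der Γ₁ M S) (e : Der Γ₂ N T) (ρ : Env Γ) :
    ev (.tensI h d e) ρ = tvec (ev d (h.fstE ρ)) (ev e (h.sndE ρ)) := ev_tensI h d e ρ

theorem ev_BI' {Γ : Ctx .mixed} {m : Tm .pure} {P : Prp .pure} (h : Γ.Empty) (d : Der [] m P)
    (ρ : Env Γ) : ev (.BI h d) ρ = bproj (ev d .nil) := ev_BI h d ρ

/-- Two derivations of the same term have related denotations. -/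
theorem ev_rel {f : Frag} {Γ : Ctx f} {M : Tm f} {T : Prp f} (d : Der Γ M T) :
    ∀ {Γ' : Ctx f} {T' : Prp f} (e : Der Γ' M T') {ρ : Env Γ} {ρ' : Env Γ'},
      CompatE Γ Γ' ρ ρ' → Rel T T' (ev d ρ) (ev e ρ') := by
  induction d with
  | ax h =>
    intro Γ' T' e ρ ρ' c
    cases e with | ax h' => rw [ev_ax, ev_ax]; exact c.only h h'
  | sum d₁ d₂ ih₁ ih₂ =>
    intro Γ' T' e ρ ρ' c
    cases e with | sum e₁ e₂ => rw [ev_sum, ev_sum]; exact (ih₁ e₁ c).add (ih₂ e₂ c)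
  | prod a d ih =>
    intro Γ' T' e ρ ρ' c
    cases e with | prod _ e => rw [ev_prod, ev_prod]; exact (ih e c).smul _
  | topI Γ =>
    intro Γ' T' e ρ ρ' c
    cases e with | topI _ => rw [ev_topI, ev_topI]; exact Rel.zero _ _
  | zeroE A h d ih =>
    intro Γ' T' e ρ ρ' c
    cases e with | zeroE _ _ _ => rw [ev_zeroE, ev_zeroE]; exact Rel.zero _ _
  | oneI h =>
    intro Γ' T' e ρ ρ' c
    cases e with | oneI h' => rw [ev_oneI, ev_oneI]; exact rfl
  | oneE h d₁ d₂ ih₁ ih₂ =>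
    intro Γ' T' e ρ ρ' c
    cases e with
    | oneE h' e₁ e₂ =>
      -- At `1` the relation is equality of scalars, so the scalar can be rewritten.
      have h₁ : _ = _ := ih₁ e₁ (c.split h h').1
      rw [ev_oneE, ev_oneE, h₁]
      exact (ih₂ e₂ (c.split h h').2).smul _
  | lolliI d ih =>
    intro Γ' T' e ρ ρ' c
    cases e with
    | lolliI e =>
      intro a a' ha
      convert ih e (ρ := .cons a ρ) (ρ' := .cons a' ρ') ⟨ha, c⟩ using 1
      · funext t
        rw [ev_lolliI, ev_linear]; exact Finset.sum_congr rfl fun s _ => mul_comm _ _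
      · funext t
        rw [ev_lolliI, ev_linear]; exact Finset.sum_congr rfl fun s _ => mul_comm _ _
  | lolliE h d₁ d₂ ih₁ ih₂ =>
    intro Γ' T' e ρ ρ' c
    cases e with
    | lolliE h' e₁ e₂ =>
      rw [ev_lolliE, ev_lolliE]
      exact ih₁ e₁ (c.split h h').1 _ _ (ih₂ e₂ (c.split h h').2)
    | BlolliE h' e₁ e₂ =>
      -- One derivation types the function at `S ⊸ T`, the other at `𝓑(P ⊸ Q)`. These connectives
      -- differ, so both denotations of the function vanish, and with them both applications.
      obtain ⟨h1, h2⟩ := ih₁ e₁ (c.split h h').1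
      rw [ev_lolliE, ev_BlolliE', h1, h2, map_zero, LinearMap.zero_apply]
      convert Rel.zero _ _ using 1
      exact funext fun t => Finset.sum_eq_zero fun s _ => zero_mul _
  | ampI d₁ d₂ ih₁ ih₂ =>
    intro Γ' T' e ρ ρ' c
    cases e with | ampI e₁ e₂ => rw [ev_ampI, ev_ampI]; exact ⟨ih₁ e₁ c, ih₂ e₂ c⟩
  | ampE₁ h d₁ d₂ ih₁ ih₂ =>
    intro Γ' T' e ρ ρ' c
    cases e with
    | ampE₁ h' e₁ e₂ =>
      rw [ev_ampE₁, ev_ampE₁]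
      exact ih₂ e₂ ⟨(ih₁ e₁ (c.split h h').1).1, (c.split h h').2⟩
  | ampE₂ h d₁ d₂ ih₁ ih₂ =>
    intro Γ' T' e ρ ρ' c
    cases e with
    | ampE₂ h' e₁ e₂ =>
      rw [ev_ampE₂, ev_ampE₂]
      exact ih₂ e₂ ⟨(ih₁ e₁ (c.split h h').1).2, (c.split h h').2⟩
  | plusI₁ C d ih =>
    intro Γ' T' e ρ ρ' c
    cases e with
    | plusI₁ C' e => rw [ev_plusI₁, ev_plusI₁]; exact ⟨ih e c, Rel.zero _ _⟩
  | plusI₂ C d ih =>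
    intro Γ' T' e ρ ρ' c
    cases e with
    | plusI₂ C' e => rw [ev_plusI₂, ev_plusI₂]; exact ⟨Rel.zero _ _, ih e c⟩
  | plusE h d d₁ d₂ ih ih₁ ih₂ =>
    intro Γ' T' e ρ ρ' c
    cases e with
    | plusE h' e e₁ e₂ =>
      rw [ev_plusE, ev_plusE]
      have hc := c.split h h'
      have he := ih e hc.1
      exact (ih₁ e₁ (ρ := .cons _ (h.sndE ρ)) (ρ' := .cons _ (h'.sndE ρ')) ⟨he.1, hc.2⟩).add
        (ih₂ e₂ (ρ := .cons _ (h.sndE ρ)) (ρ' := .cons _ (h'.sndE ρ')) ⟨he.2, hc.2⟩)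
  | tensI h d₁ d₂ ih₁ ih₂ =>
    intro Γ' T' e ρ ρ' c
    cases e with
    | tensI h' e₁ e₂ =>
      rw [ev_tensI', ev_tensI']
      exact (ih₁ e₁ (c.split h h').1).tvec (ih₂ e₂ (c.split h h').2)
  | tensE h d₁ d₂ ih₁ ih₂ =>
    intro Γ' T' e ρ ρ' c
    cases e with
    | tensE h' e₁ e₂ =>
      rw [ev_tensE', ev_tensE']
      refine (ih₁ e₁ (c.split h h').1).tensor_map _ _ fun a a' b b' ha hb => ?_
      rw [elimTensₗ_tvec, elimTensₗ_tvec]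
      exact ih₂ e₂ ⟨hb, ha, (c.split h h').2⟩
  | BI h d ih =>
    intro Γ' T' e ρ ρ' c
    cases e with
    | BI h' e => rw [ev_BI', ev_BI']; exact (ih e (CompatE.refl [] _)).bproj
  | BlolliE h d₁ d₂ ih₁ ih₂ =>
    intro Γ' T' e ρ ρ' c
    cases e with
    | BlolliE h' e₁ e₂ =>
      rw [ev_BlolliE', ev_BlolliE']
      exact (ih₁ e₁ (c.split h h').1).bapp (ih₂ e₂ (c.split h h').2)
    | lolliE h' e₁ e₂ =>
      obtain ⟨h1, h2⟩ := ih₁ e₁ (c.split h h').1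
      rw [ev_lolliE, ev_BlolliE', h1, h2, map_zero, LinearMap.zero_apply]
      convert Rel.zero _ _ using 1
      exact funext fun t => Finset.sum_eq_zero fun s _ => zero_mul _
  | Btens d ih =>
    intro Γ' T' e ρ ρ' c
    cases e with
    | Btens e => rw [ev_Btens', ev_Btens']; exact (ih e c).btens

/-- Coherence. -/
theorem ev_unique {f : Frag} {Γ : Ctx f} {M : Tm f} {T : Prp f} (d e : Der Γ M T) : ev d = ev e :=
  funext fun ρ => (Rel.iff_eq _ _ _).1 (ev_rel d e (CompatE.refl Γ ρ))

open Classical in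
/-- The denotation of a judgement. -/
noncomputable def sem {f : Frag} (Γ : Ctx f) (T : Prp f) (M : Tm f) (ρ : Env Γ) : Basis T → ℂ :=
  if h : Derivable Γ M T then ev h.some ρ else 0

/-- Coherence removes the dependence on the chosen derivation, so equations between denotations can
be written without naming derivations. -/
theorem sem_eq {f : Frag} {Γ : Ctx f} {M : Tm f} {T : Prp f} (d : Der Γ M T) :
    sem Γ T M = ev d := by
  funext ρ
  rw [sem, dif_pos ⟨d⟩, ev_unique _ d]

/-! ## Substitution -/

theorem liftSub_var {f : Frag} (r : ℕ → ℕ) :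
    (liftSub fun i => (Tm.var (r i) : Tm f)) = fun i => .var (liftRen r i) := by
  funext i
  cases i <;> rfl

theorem Tm.rename_eq_subst {f : Frag} (M : Tm f) : ∀ r : ℕ → ℕ,
    M.rename r = M.subst fun i => .var (r i) := by
  induction M <;> intro r <;> simp_all only [Tm.rename, Tm.subst, liftSub_var]

/-- A class of typed substitutions, with their denotations, under which derivations are stable. -/
structure SubstClass {f : Frag}
    (P : (Γ : Ctx f) → (ℕ → Tm f) → (Δ : Ctx f) → (Env Δ → Env Γ) → Prop) : Prop where
  lift {Γ Δ : Ctx f} {s : ℕ → Tm f} {F : Env Δ → Env Γ} (S : Prp f) (h : P Γ s Δ F) :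
    P (some S :: Γ) (liftSub s) (some S :: Δ) fun ρ => .cons ρ.head (F ρ.tail)
  empty {Γ Δ : Ctx f} {s : ℕ → Tm f} {F : Env Δ → Env Γ} (h : P Γ s Δ F) (hΓ : Γ.Empty) : Δ.Empty
  split {Γ Γ₁ Γ₂ Δ : Ctx f} {s : ℕ → Tm f} {F : Env Δ → Env Γ} (h : P Γ s Δ F)
    (k : Split Γ Γ₁ Γ₂) : ∃ (Δ₁ Δ₂ : Ctx f) (k' : Split Δ Δ₁ Δ₂) (F₁ : Env Δ₁ → Env Γ₁)
      (F₂ : Env Δ₂ → Env Γ₂), P Γ₁ s Δ₁ F₁ ∧ P Γ₂ s Δ₂ F₂ ∧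
        (∀ ρ, k.fstE (F ρ) = F₁ (k'.fstE ρ)) ∧ ∀ ρ, k.sndE (F ρ) = F₂ (k'.sndE ρ)
  only {Γ Δ : Ctx f} {s : ℕ → Tm f} {F : Env Δ → Env Γ} (h : P Γ s Δ F) {i : ℕ} {S : Prp f}
    (k : Only Γ i S) : ∃ d : Der Δ (s i) S, ∀ ρ, ev d ρ = k.getE (F ρ)

/-- A single induction serves weakening and substitution of closed terms: a `SubstClass` provides
exactly what the rules ask for, namely passing under binders, dividing the target context along a
division of the source, and treating variables. The term `N` is kept apart from `M.subst s` so that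
each rule is applied to the premises first and its subject identified afterwards. -/
theorem Der.exists_subst_aux {f : Frag} {Γ : Ctx f} {M : Tm f} {T : Prp f} (d : Der Γ M T) :
    ∀ {P : (Γ : Ctx f) → (ℕ → Tm f) → (Δ : Ctx f) → (Env Δ → Env Γ) → Prop} (_ : SubstClass P)
      {Δ : Ctx f} {s : ℕ → Tm f} {F : Env Δ → Env Γ} (_ : P Γ s Δ F),
      ∃ (N : Tm f) (_ : N = M.subst s) (e : Der Δ N T), ∀ ρ, ev e ρ = ev d (F ρ) := by
  induction d with
  | ax h =>
    intro P hP Δ s F hF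
    obtain ⟨e, he⟩ := hP.only hF h
    exact ⟨_, by rfl, e, fun ρ => by rw [he, ev_ax]⟩
  | sum d e ihd ihe =>
    intro P hP Δ s F hF
    obtain ⟨_, rfl, d', hd⟩ := ihd hP hF
    obtain ⟨_, rfl, e', he⟩ := ihe hP hF
    exact ⟨_, by rfl, .sum d' e', fun ρ => by rw [ev_sum, ev_sum, hd, he]⟩
  | prod a d ihd =>
    intro P hP Δ s F hF
    obtain ⟨_, rfl, d', hd⟩ := ihd hP hF
    exact ⟨_, by rfl, .prod a d', fun ρ => by rw [ev_prod, ev_prod, hd]⟩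
  | topI Γ =>
    intro P hP Δ s F hF
    exact ⟨_, by rfl, .topI Δ, fun ρ => by rw [ev_topI, ev_topI]⟩
  | zeroE A h d ihd =>
    intro P hP Δ s F hF
    obtain ⟨Δ₁, Δ₂, k, F₁, F₂, h₁, h₂, e₁, e₂⟩ := hP.split hF h
    obtain ⟨_, rfl, d', hd⟩ := ihd hP h₁
    exact ⟨_, by rfl, .zeroE A k d', fun ρ => by rw [ev_zeroE, ev_zeroE]⟩
  | oneI h =>
    intro P hP Δ s F hF
    exact ⟨_, by rfl, .oneI (hP.empty hF h), fun ρ => by rw [ev_oneI, ev_oneI]⟩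
  | oneE h d e ihd ihe =>
    intro P hP Δ s F hF
    obtain ⟨Δ₁, Δ₂, k, F₁, F₂, h₁, h₂, e₁, e₂⟩ := hP.split hF h
    obtain ⟨_, rfl, d', hd⟩ := ihd hP h₁
    obtain ⟨_, rfl, e', he⟩ := ihe hP h₂
    exact ⟨_, by rfl, .oneE k d' e', fun ρ => by rw [ev_oneE, ev_oneE, hd, he, e₁, e₂]⟩
  | lolliI d ihd =>
    intro P hP Δ s F hF
    obtain ⟨_, rfl, d', hd⟩ := ihd hP (hP.lift _ hF)
    exact ⟨_, by rfl, .lolliI d', fun ρ => by rw [ev_lolliI, ev_lolliI]; funext t; rw [hd]; rfl⟩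
  | lolliE h d e ihd ihe =>
    intro P hP Δ s F hF
    obtain ⟨Δ₁, Δ₂, k, F₁, F₂, h₁, h₂, e₁, e₂⟩ := hP.split hF h
    obtain ⟨_, rfl, d', hd⟩ := ihd hP h₁
    obtain ⟨_, rfl, e', he⟩ := ihe hP h₂
    exact ⟨_, by rfl, .lolliE k d' e', fun ρ => by rw [ev_lolliE, ev_lolliE, hd, he, e₁, e₂]⟩
  | ampI d e ihd ihe =>
    intro P hP Δ s F hF
    obtain ⟨_, rfl, d', hd⟩ := ihd hP hF
    obtain ⟨_, rfl, e', he⟩ := ihe hP hF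
    exact ⟨_, by rfl, .ampI d' e', fun ρ => by rw [ev_ampI, ev_ampI, hd, he]⟩
  | ampE₁ h d e ihd ihe =>
    intro P hP Δ s F hF
    obtain ⟨Δ₁, Δ₂, k, F₁, F₂, h₁, h₂, e₁, e₂⟩ := hP.split hF h
    obtain ⟨_, rfl, d', hd⟩ := ihd hP h₁
    obtain ⟨_, rfl, e', he⟩ := ihe hP (hP.lift _ h₂)
    refine ⟨_, by rfl, .ampE₁ k d' e', fun ρ => ?_⟩
    rw [ev_ampE₁, ev_ampE₁, hd, he, e₁, e₂]; rfl
  | ampE₂ h d e ihd ihe =>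
    intro P hP Δ s F hF
    obtain ⟨Δ₁, Δ₂, k, F₁, F₂, h₁, h₂, e₁, e₂⟩ := hP.split hF h
    obtain ⟨_, rfl, d', hd⟩ := ihd hP h₁
    obtain ⟨_, rfl, e', he⟩ := ihe hP (hP.lift _ h₂)
    refine ⟨_, by rfl, .ampE₂ k d' e', fun ρ => ?_⟩
    rw [ev_ampE₂, ev_ampE₂, hd, he, e₁, e₂]; rfl
  | plusI₁ C d ihd =>
    intro P hP Δ s F hF
    obtain ⟨_, rfl, d', hd⟩ := ihd hP hF
    exact ⟨_, by rfl, .plusI₁ C d', fun ρ => by rw [ev_plusI₁, ev_plusI₁, hd]⟩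
  | plusI₂ C d ihd =>
    intro P hP Δ s F hF
    obtain ⟨_, rfl, d', hd⟩ := ihd hP hF
    exact ⟨_, by rfl, .plusI₂ C d', fun ρ => by rw [ev_plusI₂, ev_plusI₂, hd]⟩
  | plusE h d e o ihd ihe iho =>
    intro P hP Δ s F hF
    obtain ⟨Δ₁, Δ₂, k, F₁, F₂, h₁, h₂, e₁, e₂⟩ := hP.split hF h
    obtain ⟨_, rfl, d', hd⟩ := ihd hP h₁
    obtain ⟨_, rfl, e', he⟩ := ihe hP (hP.lift _ h₂)
    obtain ⟨_, rfl, o', ho⟩ := iho hP (hP.lift _ h₂)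
    refine ⟨_, by rfl, .plusE k d' e' o', fun ρ => ?_⟩
    rw [ev_plusE, ev_plusE, hd, he, ho, e₁, e₂]; rfl
  | tensI h d e ihd ihe =>
    intro P hP Δ s F hF
    obtain ⟨Δ₁, Δ₂, k, F₁, F₂, h₁, h₂, e₁, e₂⟩ := hP.split hF h
    obtain ⟨_, rfl, d', hd⟩ := ihd hP h₁
    obtain ⟨_, rfl, e', he⟩ := ihe hP h₂
    exact ⟨_, by rfl, .tensI k d' e', fun ρ => by rw [ev_tensI, ev_tensI, hd, he, e₁, e₂]⟩
  | tensE h d e ihd ihe =>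
    intro P hP Δ s F hF
    obtain ⟨Δ₁, Δ₂, k, F₁, F₂, h₁, h₂, e₁, e₂⟩ := hP.split hF h
    obtain ⟨_, rfl, d', hd⟩ := ihd hP h₁
    obtain ⟨_, rfl, e', he⟩ := ihe hP (hP.lift _ (hP.lift _ h₂))
    refine ⟨_, by rfl, .tensE k d' e', fun ρ => ?_⟩
    rw [ev_tensE, ev_tensE, hd, e₁, e₂]
    funext t
    exact Finset.sum_congr rfl fun _ _ => Finset.sum_congr rfl fun _ _ => by rw [he]; rfl
  | BI h d ihd =>
    intro P hP Δ s F hF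
    exact ⟨_, by rfl, .BI (hP.empty hF h) d, fun ρ => by rw [ev_BI, ev_BI]⟩
  | BlolliE h d e ihd ihe =>
    intro P hP Δ s F hF
    obtain ⟨Δ₁, Δ₂, k, F₁, F₂, h₁, h₂, e₁, e₂⟩ := hP.split hF h
    obtain ⟨_, rfl, d', hd⟩ := ihd hP h₁
    obtain ⟨_, rfl, e', he⟩ := ihe hP h₂
    exact ⟨_, by rfl, .BlolliE k d' e', fun ρ => by rw [ev_BlolliE, ev_BlolliE, hd, he, e₁, e₂]⟩
  | Btens d ihd =>
    intro P hP Δ s F hF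
    obtain ⟨_, rfl, d', hd⟩ := ihd hP hF
    exact ⟨_, by rfl, .Btens d', fun ρ => by rw [ev_Btens, ev_Btens, hd]⟩

theorem Der.exists_subst {f : Frag} {Γ : Ctx f} {M : Tm f} {T : Prp f} (d : Der Γ M T)
    {P : (Γ : Ctx f) → (ℕ → Tm f) → (Δ : Ctx f) → (Env Δ → Env Γ) → Prop} (hP : SubstClass P)
    {Δ : Ctx f} {s : ℕ → Tm f} {F : Env Δ → Env Γ} (h : P Γ s Δ F) :
    ∃ e : Der Δ (M.subst s) T, ∀ ρ, ev e ρ = ev d (F ρ) := by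
  obtain ⟨_, rfl, e, he⟩ := d.exists_subst_aux hP h
  exact ⟨e, he⟩

/-- The substitution `x ↦ x` into a context with one more undeclared variable. -/
inductive Weakening {f : Frag} :
    (Γ : Ctx f) → (ℕ → Tm f) → (Δ : Ctx f) → (Env Δ → Env Γ) → Prop
  | base (Γ : Ctx f) : Weakening Γ (fun i => .var i.succ) (none :: Γ) fun ρ => ρ
  | skip {Γ Δ : Ctx f} {s : ℕ → Tm f} {F : Env Δ → Env Γ} (h : Weakening Γ s Δ F) :
    Weakening (none :: Γ) (liftSub s) (none :: Δ) F
  | lift {Γ Δ : Ctx f} {s : ℕ → Tm f} {F : Env Δ → Env Γ} (S : Prp f) (h : Weakening Γ s Δ F) :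
    Weakening (some S :: Γ) (liftSub s) (some S :: Δ) fun ρ => .cons ρ.head (F ρ.tail)

theorem Weakening.only {f : Frag} {Γ Δ : Ctx f} {s : ℕ → Tm f} {F : Env Δ → Env Γ}
    (h : Weakening Γ s Δ F) : ∀ {i : ℕ} {S : Prp f} (k : Only Γ i S),
      ∃ (j : ℕ) (k' : Only Δ j S), s i = .var j ∧ ∀ ρ, k'.getE ρ = k.getE (F ρ) := by
  have hemp : ∀ {Γ Δ : Ctx f} {s : ℕ → Tm f} {F : Env Δ → Env Γ}, Weakening Γ s Δ F → Γ.Empty →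
      Δ.Empty := by
    intro Γ Δ s F h
    induction h with
    | base Γ => exact fun h => h.cons
    | skip h ih => exact fun k => (ih k.tail).cons
    | lift S h ih => exact fun k => absurd k.head (by simp)
  induction h with
  | base Γ => exact fun {i S} k => ⟨i + 1, .there k, rfl, fun ρ => rfl⟩
  | skip h ih =>
    intro i S k
    cases k with
    | there k =>
      obtain ⟨j, k', hj, hk⟩ := ih k
      exact ⟨j + 1, .there k', by simp [liftSub, hj, Tm.rename], hk⟩
  | lift S h ih =>
    intro i S k
    cases k with
    | here k => exact ⟨0, .here (hemp h k), rfl, fun ρ => rfl⟩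

theorem Weakening.substClass {f : Frag} : SubstClass (@Weakening f) where
  lift S h := h.lift S
  empty h := by
    induction h with
    | base Γ => exact fun h => h.cons
    | skip h ih => exact fun k => (ih k.tail).cons
    | lift S h ih => exact fun k => absurd k.head (by simp)
  split := by
    intro Γ Γ₁ Γ₂ Δ s F h k
    induction h generalizing Γ₁ Γ₂ with
    | base Γ =>
      exact ⟨_, _, .none k, _, _, .base _, .base _, fun ρ => rfl, fun ρ => rfl⟩
    | skip h ih =>
      cases k with
      | none k =>
        obtain ⟨_, _, k', F₁, F₂, h₁, h₂, e₁, e₂⟩ := ih k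
        exact ⟨_, _, .none k', _, _, h₁.skip, h₂.skip, e₁, e₂⟩
    | lift S h ih =>
      cases k with
      | left _ k =>
        obtain ⟨_, _, k', F₁, F₂, h₁, h₂, e₁, e₂⟩ := ih k
        exact ⟨_, _, .left S k', _, _, h₁.lift S, h₂.skip,
          fun ρ => congrArg (Env.cons ρ.head) (e₁ ρ.tail), fun ρ => e₂ ρ.tail⟩
      | right _ k =>
        obtain ⟨_, _, k', F₁, F₂, h₁, h₂, e₁, e₂⟩ := ih k
        exact ⟨_, _, .right S k', _, _, h₁.skip, h₂.lift S,
          fun ρ => e₁ ρ.tail, fun ρ => congrArg (Env.cons ρ.head) (e₂ ρ.tail)⟩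
  only := by
    intro Γ Δ s F h i S k
    obtain ⟨j, k', hj, hk⟩ := Weakening.only h k
    rw [hj]
    exact ⟨.ax k', fun ρ => by rw [ev_ax, hk]⟩

theorem Der.exists_weaken {f : Frag} {Γ : Ctx f} {M : Tm f} {T : Prp f} (d : Der Γ M T) :
    ∃ e : Der (none :: Γ) (M.rename Nat.succ) T, ∀ ρ : Env Γ, ev e ρ.skip = ev d ρ := by
  rw [Tm.rename_eq_subst]
  obtain ⟨e, he⟩ := d.exists_subst Weakening.substClass (.base Γ)
  exact ⟨e, he⟩

/-- Substitution of closed terms for the last variables of a context. -/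
inductive ClosedSubst {f : Frag} :
    (Γ : Ctx f) → (ℕ → Tm f) → (Δ : Ctx f) → (Env Δ → Env Γ) → Prop
  | nil (s : ℕ → Tm f) : ClosedSubst [] s [] fun ρ => ρ
  | none {Γ : Ctx f} {s : ℕ → Tm f} {F : Env [] → Env Γ}
      (h : ClosedSubst Γ (fun i => s (i + 1)) [] F) : ClosedSubst (none :: Γ) s [] F
  | some {Γ : Ctx f} {s : ℕ → Tm f} {F : Env [] → Env Γ} {S : Prp f} (d : Der [] (s 0) S)
      (h : ClosedSubst Γ (fun i => s (i + 1)) [] F) :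
      ClosedSubst (some S :: Γ) s [] fun ρ => .cons (ev d ρ) (F ρ)
  | skip {Γ Δ : Ctx f} {s : ℕ → Tm f} {F : Env Δ → Env Γ} (h : ClosedSubst Γ s Δ F) :
      ClosedSubst (.none :: Γ) (liftSub s) (.none :: Δ) F
  | lift {Γ Δ : Ctx f} {s : ℕ → Tm f} {F : Env Δ → Env Γ} (S : Prp f) (h : ClosedSubst Γ s Δ F) :
      ClosedSubst (.some S :: Γ) (liftSub s) (.some S :: Δ) fun ρ => .cons ρ.head (F ρ.tail)

theorem ClosedSubst.empty {f : Frag} {Γ Δ : Ctx f} {s : ℕ → Tm f} {F : Env Δ → Env Γ}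
    (h : ClosedSubst Γ s Δ F) : Γ.Empty → Δ.Empty := by
  induction h with
  | nil | none | some => exact fun _ => Ctx.empty_nil
  | skip h ih => exact fun k => (ih k.tail).cons
  | lift S h ih => exact fun k => absurd k.head (by simp)

theorem ClosedSubst.substClass {f : Frag} : SubstClass (@ClosedSubst f) where
  lift S h := h.lift S
  empty h := h.empty
  split := by
    intro Γ Γ₁ Γ₂ Δ s F h k
    induction h generalizing Γ₁ Γ₂ with
    | nil s =>
      cases k with
      | nil => exact ⟨_, _, .nil, _, _, .nil s, .nil s, fun ρ => rfl, fun ρ => rfl⟩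
    | none h ih =>
      cases k with
      | none k =>
        obtain ⟨_, _, k', F₁, F₂, h₁, h₂, e₁, e₂⟩ := ih k
        cases k' with
        | nil => exact ⟨_, _, .nil, _, _, h₁.none, h₂.none, e₁, e₂⟩
    | some d h ih =>
      cases k with
      | left _ k =>
        obtain ⟨_, _, k', F₁, F₂, h₁, h₂, e₁, e₂⟩ := ih k
        cases k' with
        | nil =>
          exact ⟨_, _, .nil, _, _, .some d h₁, h₂.none,
            fun ρ => congrArg (Env.cons (ev d ρ)) (e₁ ρ), e₂⟩
      | right _ k =>
        obtain ⟨_, _, k', F₁, F₂, h₁, h₂, e₁, e₂⟩ := ih k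
        cases k' with
        | nil =>
          exact ⟨_, _, .nil, _, _, h₁.none, .some d h₂,
            e₁, fun ρ => congrArg (Env.cons (ev d ρ)) (e₂ ρ)⟩
    | skip h ih =>
      cases k with
      | none k =>
        obtain ⟨_, _, k', F₁, F₂, h₁, h₂, e₁, e₂⟩ := ih k
        exact ⟨_, _, .none k', _, _, h₁.skip, h₂.skip, e₁, e₂⟩
    | lift S h ih =>
      cases k with
      | left _ k =>
        obtain ⟨_, _, k', F₁, F₂, h₁, h₂, e₁, e₂⟩ := ih k
        exact ⟨_, _, .left S k', _, _, h₁.lift S, h₂.skip,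
          fun ρ => congrArg (Env.cons ρ.head) (e₁ ρ.tail), fun ρ => e₂ ρ.tail⟩
      | right _ k =>
        obtain ⟨_, _, k', F₁, F₂, h₁, h₂, e₁, e₂⟩ := ih k
        exact ⟨_, _, .right S k', _, _, h₁.skip, h₂.lift S,
          fun ρ => e₁ ρ.tail, fun ρ => congrArg (Env.cons ρ.head) (e₂ ρ.tail)⟩
  only := by
    intro Γ Δ s F h i S k
    induction h generalizing i with
    | nil s => cases k
    | none h ih =>
      cases k with
      | there k => exact ih k
    | some d h ih =>
      cases k with
      | here k => exact ⟨d, fun ρ => rfl⟩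
    | skip h ih =>
      cases k with
      | there k =>
        obtain ⟨d, hd⟩ := ih k
        -- `liftSub` has shifted the term given to this variable, so its derivation is weakened by
        -- the undeclared slot.
        obtain ⟨e, he⟩ := d.exists_weaken
        exact ⟨e, fun ρ => (he ρ).trans (hd ρ)⟩
    | lift T h ih =>
      cases k with
      | here k => exact ⟨.ax (.here (h.empty k)), fun ρ => ev_ax _ ρ⟩

theorem Der.exists_inst {f : Frag} {V M : Tm f} {S T : Prp f} (d : Der [some S] M T)
    (dV : Der [] V S) :
    ∃ e : Der [] (Tm.inst V M) T, ev e .nil = ev d (.cons (ev dV .nil) .nil) := by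
  obtain ⟨e, he⟩ := d.exists_subst ClosedSubst.substClass
    (s := fun | 0 => V | n + 1 => .var n) (.some dV (.nil _))
  exact ⟨e, he _⟩

theorem Der.exists_inst₂ {f : Frag} {V W M : Tm f} {S₁ S₂ T : Prp f}
    (d : Der [some S₂, some S₁] M T) (dV : Der [] V S₁) (dW : Der [] W S₂) :
    ∃ e : Der [] (Tm.inst₂ V W M) T,
      ev e .nil = ev d (.cons (ev dW .nil) (.cons (ev dV .nil) .nil)) := by
  obtain ⟨e, he⟩ := d.exists_subst ClosedSubst.substClass
    (s := fun | 0 => W | 1 => V | n + 2 => .var n) (.some dW (.some dV (.nil _)))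
  exact ⟨e, he _⟩

theorem liftSub_var_id {f : Frag} : liftSub (Tm.var : ℕ → Tm f) = Tm.var := by
  funext i
  cases i <;> rfl

theorem Tm.subst_var {f : Frag} (M : Tm f) : M.subst Tm.var = M := by
  induction M <;> simp_all only [Tm.subst, liftSub_var_id]

/-- Substituting each variable for itself changes the context but not the term. It removes the slot
`none` that the hole leaves in the contexts of the other premises of an elimination. -/
theorem Der.exists_trim {f : Frag} {Γ Δ : Ctx f} {F : Env Δ → Env Γ} {M : Tm f} {T : Prp f}
    (d : Der Γ M T) (h : ClosedSubst Γ Tm.var Δ F) :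
    ∃ e : Der Δ M T, ∀ ρ, ev e ρ = ev d (F ρ) := by
  have := d.exists_subst ClosedSubst.substClass h
  rwa [Tm.subst_var] at this

theorem ClosedSubst.trim {f : Frag} :
    ClosedSubst [.none] (Tm.var : ℕ → Tm f) [] fun ρ => ρ := .none (.nil _)

theorem ClosedSubst.trim₁ {f : Frag} (S : Prp f) :
    ClosedSubst [.some S, .none] (Tm.var : ℕ → Tm f) [.some S] fun ρ => ρ := by
  have := (ClosedSubst.trim (f := f)).lift S
  rwa [liftSub_var_id] at this

theorem ClosedSubst.trim₂ {f : Frag} (S S' : Prp f) :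
    ClosedSubst [.some S, .some S', .none] (Tm.var : ℕ → Tm f) [.some S, .some S'] fun ρ => ρ := by
  have := (ClosedSubst.trim₁ S').lift S
  rwa [liftSub_var_id] at this

/-- The hole sits in the eliminated term at every level and is never discarded, so its declaration
must go to the eliminated premise. This excludes the other way of dividing the context in
`Der.exists_plug`. -/
theorem not_der_plug {f : Frag} (E : ECtx f) : ∀ T : Prp f, Der [none] (E.plug (.var 0)) T →
    False := by
  induction E with
  | hole =>
    intro T d
    cases d with
    | ax h => cases h
  | elimZero E ih =>
    intro T d
    cases d with
    | zeroE _ h d => cases h with | none h => cases h; exact ih _ d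
  | elimOne E N ih =>
    intro T d
    cases d with
    | oneE h d _ => cases h with | none h => cases h; exact ih _ d
  | app E N ih =>
    intro T d
    cases d with
    | lolliE h d _ => cases h with | none h => cases h; exact ih _ d
    | BlolliE h d _ => cases h with | none h => cases h; exact ih _ d
  | elimWith₁ E N ih =>
    intro T d
    cases d with
    | ampE₁ h d _ => cases h with | none h => cases h; exact ih _ d
  | elimWith₂ E N ih =>
    intro T d
    cases d with
    | ampE₂ h d _ => cases h with | none h => cases h; exact ih _ d
  | elimPlus E N O ih =>
    intro T d
    cases d with
    | plusE h d _ => cases h with | none h => cases h; exact ih _ d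
  | elimTens E N ih =>
    intro T d
    cases d with
    | tensE h d _ => cases h with | none h => cases h; exact ih _ d

theorem Split.cases_one {f : Frag} {S : Prp f} {Γ₁ Γ₂ : Ctx f} (h : Split [some S] Γ₁ Γ₂) :
    (∃ (e₁ : Γ₁ = [some S]) (e₂ : Γ₂ = [.none]), e₁ ▸ e₂ ▸ h = .left S .nil) ∨ Γ₁ = [.none] := by
  cases h with
  | left _ h => cases h; exact .inl ⟨rfl, rfl, rfl⟩
  | right _ h => cases h; exact .inr rfl

/-- Compositionality: the denotation of `E[M]` is that of `E` at the vector denoted by `M`, hence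
depends on `M` only through its denotation. The derivation of `E` is followed down to the axiom for
the hole, where the derivation of `M` is put. -/
theorem Der.exists_plug {f : Frag} (E : ECtx f) : ∀ {S T : Prp f}
    (d : Der [some S] (E.plug (.var 0)) T) {M : Tm f} (dM : Der [] M S),
    ∃ e : Der [] (E.plug M) T, ev e .nil = ev d (.cons (ev dM .nil) .nil) := by
  induction E with
  | hole =>
    intro S T d M dM
    cases d with
    | ax h =>
      cases h with
      | here h => exact ⟨dM, (ev_ax (.here h) (.cons (ev dM .nil) .nil)).symm⟩
  | elimZero E ih =>
    intro S T d M dM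
    cases d with
    | zeroE _ h d =>
      rcases h.cases_one with ⟨rfl, rfl, rfl⟩ | rfl
      · obtain ⟨e, he⟩ := ih d dM
        exact ⟨.zeroE _ .nil e, (ev_zeroE _ .nil e .nil).trans (ev_zeroE _ _ d _).symm⟩
      · exact (not_der_plug _ _ d).elim
  | elimOne E N ih =>
    intro S T d M dM
    cases d with
    | oneE h d k =>
      rcases h.cases_one with ⟨rfl, rfl, rfl⟩ | rfl
      · obtain ⟨e, he⟩ := ih d dM
        obtain ⟨k', hk⟩ := k.exists_trim .trim
        refine ⟨.oneE .nil e k', (ev_oneE .nil e k' .nil).trans ((ev_oneE _ d k _).trans ?_).symm⟩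
        exact congrArg₂ (fun (x : _ → ℂ) y => x () • y) he.symm (hk .nil).symm
      · exact (not_der_plug _ _ d).elim
  | app E N ih =>
    intro S T d M dM
    cases d with
    | lolliE h d k =>
      rcases h.cases_one with ⟨rfl, rfl, rfl⟩ | rfl
      · obtain ⟨e, he⟩ := ih d dM
        obtain ⟨k', hk⟩ := k.exists_trim .trim
        refine ⟨.lolliE .nil e k', ?_⟩
        have hk' : ev k' .nil = ev k (Env.nil).skip := hk .nil
        calc ev (.lolliE .nil e k') .nil
            = fun t => ∑ s, ev e .nil (s, t) * ev k' .nil s := ev_lolliE .nil e k' .nil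
          _ = fun t => ∑ s, ev d (.cons (ev dM .nil) .nil) (s, t) * ev k (Env.nil).skip s := by
            rw [he, hk']
          _ = _ := (ev_lolliE (.left S .nil) d k (.cons (ev dM .nil) .nil)).symm
      · exact (not_der_plug _ _ d).elim
    | BlolliE h d k =>
      rcases h.cases_one with ⟨rfl, rfl, rfl⟩ | rfl
      · obtain ⟨e, he⟩ := ih d dM
        obtain ⟨k', hk⟩ := k.exists_trim .trim
        refine ⟨.BlolliE .nil e k', (ev_BlolliE' .nil e k' .nil).trans
          ((ev_BlolliE' _ d k _).trans ?_).symm⟩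
        exact congrArg₂ (fun x y => bapp x y) he.symm (hk .nil).symm
      · exact (not_der_plug _ _ d).elim
  | elimWith₁ E N ih =>
    intro S T d M dM
    cases d with
    | ampE₁ h d k =>
      rcases h.cases_one with ⟨rfl, rfl, rfl⟩ | rfl
      · obtain ⟨e, he⟩ := ih d dM
        obtain ⟨k', hk⟩ := k.exists_trim (.trim₁ _)
        refine ⟨.ampE₁ .nil e k', ?_⟩
        calc ev (.ampE₁ .nil e k') .nil
            = ev k' (.cons (fun x => ev e .nil (.inl x)) .nil) := ev_ampE₁ .nil e k' .nil
          _ = ev k (.cons (fun x => ev d (.cons (ev dM .nil) .nil) (.inl x)) (Env.nil).skip) := by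
            rw [he]; exact hk _
          _ = _ := (ev_ampE₁ (.left S .nil) d k (.cons (ev dM .nil) .nil)).symm
      · exact (not_der_plug _ _ d).elim
  | elimWith₂ E N ih =>
    intro S T d M dM
    cases d with
    | ampE₂ h d k =>
      rcases h.cases_one with ⟨rfl, rfl, rfl⟩ | rfl
      · obtain ⟨e, he⟩ := ih d dM
        obtain ⟨k', hk⟩ := k.exists_trim (.trim₁ _)
        refine ⟨.ampE₂ .nil e k', ?_⟩
        calc ev (.ampE₂ .nil e k') .nil
            = ev k' (.cons (fun x => ev e .nil (.inr x)) .nil) := ev_ampE₂ .nil e k' .nil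
          _ = ev k (.cons (fun x => ev d (.cons (ev dM .nil) .nil) (.inr x)) (Env.nil).skip) := by
            rw [he]; exact hk _
          _ = _ := (ev_ampE₂ (.left S .nil) d k (.cons (ev dM .nil) .nil)).symm
      · exact (not_der_plug _ _ d).elim
  | elimPlus E N O ih =>
    intro S T d M dM
    cases d with
    | plusE h d k o =>
      rcases h.cases_one with ⟨rfl, rfl, rfl⟩ | rfl
      · obtain ⟨e, he⟩ := ih d dM
        obtain ⟨k', hk⟩ := k.exists_trim (.trim₁ _)
        obtain ⟨o', ho⟩ := o.exists_trim (.trim₁ _)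
        refine ⟨.plusE .nil e k' o', ?_⟩
        calc ev (.plusE .nil e k' o') .nil
            = ev k' (.cons (fun x => ev e .nil (.inl x)) .nil) +
              ev o' (.cons (fun x => ev e .nil (.inr x)) .nil) := ev_plusE .nil e k' o' .nil
          _ = ev k (.cons (fun x => ev d (.cons (ev dM .nil) .nil) (.inl x)) (Env.nil).skip) +
              ev o (.cons (fun x => ev d (.cons (ev dM .nil) .nil) (.inr x)) (Env.nil).skip) := by
            rw [he]; exact congrArg₂ (· + ·) (hk _) (ho _)
          _ = _ := (ev_plusE (.left S .nil) d k o (.cons (ev dM .nil) .nil)).symm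
      · exact (not_der_plug _ _ d).elim
  | elimTens E N ih =>
    intro S T d M dM
    cases d with
    | tensE h d k =>
      rcases h.cases_one with ⟨rfl, rfl, rfl⟩ | rfl
      · obtain ⟨e, he⟩ := ih d dM
        obtain ⟨k', hk⟩ := k.exists_trim (.trim₂ _ _)
        refine ⟨.tensE .nil e k', ?_⟩
        have hL : elimTensₗ k' .nil = elimTensₗ k (Env.nil).skip := by
          ext x t
          exact Finset.sum_congr rfl fun x₁ _ => Finset.sum_congr rfl fun x₂ _ =>
            congrArg (_ * ·) (congrFun (hk _) t)
        calc ev (.tensE .nil e k') .nil = elimTensₗ k' .nil (ev e .nil) := ev_tensE' .nil e k' .nil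
          _ = elimTensₗ k (Env.nil).skip (ev d (.cons (ev dM .nil) .nil)) := by rw [he, hL]
          _ = _ := (ev_tensE' (.left S .nil) d k (.cons (ev dM .nil) .nil)).symm
      · exact (not_der_plug _ _ d).elim

/-! ## Algebraic equivalence preserves typing and denotations -/

theorem tvec_smul_left {f : Frag} {S T : Prp f} (c : ℂ) (a : Basis S → ℂ) (b : Basis T → ℂ) :
    tvec (c • a) b = c • tvec a b := by
  funext t; exact mul_assoc _ _ _

theorem tvec_smul_right {f : Frag} {S T : Prp f} (c : ℂ) (a : Basis S → ℂ) (b : Basis T → ℂ) :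
    tvec a (c • b) = c • tvec a b := by
  funext t; exact mul_left_comm _ _ _

theorem tvec_add_left {f : Frag} {S T : Prp f} (a a' : Basis S → ℂ) (b : Basis T → ℂ) :
    tvec (a + a') b = tvec a b + tvec a' b := by
  funext t; exact add_mul _ _ _

theorem tvec_add_right {f : Frag} {S T : Prp f} (a : Basis S → ℂ) (b b' : Basis T → ℂ) :
    tvec a (b + b') = tvec a b + tvec a b' := by
  funext t; exact mul_add _ _ _

theorem AlgStep.exists_der {f : Frag} {M N : Tm f} (h : AlgStep M N) :
    ∀ {Γ : Ctx f} {T : Prp f} (d : Der Γ M T), ∃ e : Der Γ N T, ev e = ev d := by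
  induction h with
  | one_smul M =>
    intro Γ T d
    cases d with
    | prod _ d => exact ⟨d, funext fun ρ => by rw [ev_prod, Scal.toComplex_one, _root_.one_smul]⟩
  | add_comm M₁ M₂ =>
    intro Γ T d
    cases d with
    | sum d e => exact ⟨.sum e d, funext fun ρ => by rw [ev_sum, ev_sum, _root_.add_comm]⟩
  | add_assoc M₁ M₂ M₃ =>
    intro Γ T d
    cases d with
    | sum d e =>
      cases e with
      | sum e g => exact ⟨.sum (.sum d e) g, funext fun ρ => by simp only [ev_sum, _root_.add_assoc]⟩
  | add_smul a b M =>
    intro Γ T d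
    cases d with
    | sum d e =>
      cases d with
      | prod _ d =>
        cases e with
        | prod _ e =>
          refine ⟨.prod _ d, funext fun ρ => ?_⟩
          -- The two occurrences of `M` may have different derivations; here coherence is
          -- indispensable.
          rw [ev_sum, ev_prod, ev_prod, ev_prod, ev_unique e d, Scal.toComplex_add, _root_.add_smul]
  | smul_smul a b M =>
    intro Γ T d
    cases d with
    | prod _ d =>
      cases d with
      | prod _ d =>
        exact ⟨.prod _ d, funext fun ρ => by
          rw [ev_prod, ev_prod, ev_prod, Scal.toComplex_mul, mul_smul]⟩
  | smul_add a M₁ M₂ =>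
    intro Γ T d
    cases d with
    | prod _ d =>
      cases d with
      | sum d e =>
        exact ⟨.sum (.prod _ d) (.prod _ e), funext fun ρ => by
          rw [ev_sum, ev_prod, ev_prod, ev_prod, ev_sum, _root_.smul_add]⟩
  | add_zero M N h =>
    intro Γ T d
    cases d with
    | sum d e =>
      cases e with
      | prod _ e =>
        exact ⟨d, funext fun ρ => by
          rw [ev_sum, ev_prod, Scal.toComplex_zero, zero_smul, _root_.add_zero]⟩
  | tens_smul a M₁ M₂ =>
    intro Γ T d
    cases d with
    | tensI h d e =>
      cases e with
      | prod _ e =>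
        exact ⟨.prod a (.tensI h d e), funext fun ρ => by
          rw [ev_prod, ev_tensI', ev_tensI', ev_prod, tvec_smul_right]⟩
  | smul_tens a M₁ M₂ =>
    intro Γ T d
    cases d with
    | tensI h d e =>
      cases d with
      | prod _ d =>
        exact ⟨.prod a (.tensI h d e), funext fun ρ => by
          rw [ev_prod, ev_tensI', ev_tensI', ev_prod, tvec_smul_left]⟩
  | add_tens M₁ M₂ N =>
    intro Γ T d
    cases d with
    | tensI h d e =>
      cases d with
      | sum d d' =>
        exact ⟨.sum (.tensI h d e) (.tensI h d' e), funext fun ρ => by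
          rw [ev_sum, ev_tensI', ev_tensI', ev_tensI', ev_sum, tvec_add_left]⟩
  | tens_add M N₁ N₂ =>
    intro Γ T d
    cases d with
    | tensI h d e =>
      cases e with
      | sum e e' =>
        exact ⟨.sum (.tensI h d e) (.tensI h d e'), funext fun ρ => by
          rw [ev_sum, ev_tensI', ev_tensI', ev_tensI', ev_sum, tvec_add_right]⟩
  | addL N h ih =>
    intro Γ T d
    cases d with
    | sum d k =>
      obtain ⟨e, he⟩ := ih d
      exact ⟨.sum e k, funext fun ρ => by rw [ev_sum, ev_sum, he]⟩
  | addR M h ih =>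
    intro Γ T d
    cases d with
    | sum k d =>
      obtain ⟨e, he⟩ := ih d
      exact ⟨.sum k e, funext fun ρ => by rw [ev_sum, ev_sum, he]⟩
  | smul a h ih =>
    intro Γ T d
    cases d with
    | prod a d =>
      obtain ⟨e, he⟩ := ih d
      exact ⟨.prod a e, funext fun ρ => by rw [ev_prod, ev_prod, he]⟩
  | elimOneL N h ih =>
    intro Γ T d
    cases d with
    | oneE s d k =>
      obtain ⟨e, he⟩ := ih d
      exact ⟨.oneE s e k, funext fun ρ => by rw [ev_oneE, ev_oneE, he]⟩
  | elimOneR M h ih =>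
    intro Γ T d
    cases d with
    | oneE s k d =>
      obtain ⟨e, he⟩ := ih d
      exact ⟨.oneE s k e, funext fun ρ => by rw [ev_oneE, ev_oneE, he]⟩
  | lam h ih =>
    intro Γ T d
    cases d with
    | lolliI d =>
      obtain ⟨e, he⟩ := ih d
      exact ⟨.lolliI e, funext fun ρ => by rw [ev_lolliI, ev_lolliI, he]⟩
  | appL N h ih =>
    intro Γ T d
    cases d with
    | lolliE s d k =>
      obtain ⟨e, he⟩ := ih d
      exact ⟨.lolliE s e k, funext fun ρ => by rw [ev_lolliE, ev_lolliE, he]⟩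
    | BlolliE s d k =>
      obtain ⟨e, he⟩ := ih d
      exact ⟨.BlolliE s e k, funext fun ρ => by rw [ev_BlolliE, ev_BlolliE, he]⟩
  | appR N h ih =>
    intro Γ T d
    cases d with
    | lolliE s k d =>
      obtain ⟨e, he⟩ := ih d
      exact ⟨.lolliE s k e, funext fun ρ => by rw [ev_lolliE, ev_lolliE, he]⟩
    | BlolliE s k d =>
      obtain ⟨e, he⟩ := ih d
      exact ⟨.BlolliE s k e, funext fun ρ => by rw [ev_BlolliE, ev_BlolliE, he]⟩
  | tensL N h ih =>
    intro Γ T d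
    cases d with
    | tensI s d k =>
      obtain ⟨e, he⟩ := ih d
      exact ⟨.tensI s e k, funext fun ρ => by rw [ev_tensI, ev_tensI, he]⟩
  | tensR N h ih =>
    intro Γ T d
    cases d with
    | tensI s k d =>
      obtain ⟨e, he⟩ := ih d
      exact ⟨.tensI s k e, funext fun ρ => by rw [ev_tensI, ev_tensI, he]⟩
  | elimTensL N h ih =>
    intro Γ T d
    cases d with
    | tensE s d k =>
      obtain ⟨e, he⟩ := ih d
      exact ⟨.tensE s e k, funext fun ρ => by rw [ev_tensE, ev_tensE, he]⟩
  | elimTensR N h ih =>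
    intro Γ T d
    cases d with
    | tensE s k d =>
      obtain ⟨e, he⟩ := ih d
      exact ⟨.tensE s k e, funext fun ρ => by rw [ev_tensE, ev_tensE, he]⟩
  | pairL N h ih =>
    intro Γ T d
    cases d with
    | ampI d k =>
      obtain ⟨e, he⟩ := ih d
      exact ⟨.ampI e k, funext fun ρ => by rw [ev_ampI, ev_ampI, he]⟩
  | pairR N h ih =>
    intro Γ T d
    cases d with
    | ampI k d =>
      obtain ⟨e, he⟩ := ih d
      exact ⟨.ampI k e, funext fun ρ => by rw [ev_ampI, ev_ampI, he]⟩
  | elimWith₁L N h ih =>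
    intro Γ T d
    cases d with
    | ampE₁ s d k =>
      obtain ⟨e, he⟩ := ih d
      exact ⟨.ampE₁ s e k, funext fun ρ => by rw [ev_ampE₁, ev_ampE₁, he]⟩
  | elimWith₁R N h ih =>
    intro Γ T d
    cases d with
    | ampE₁ s k d =>
      obtain ⟨e, he⟩ := ih d
      exact ⟨.ampE₁ s k e, funext fun ρ => by rw [ev_ampE₁, ev_ampE₁, he]⟩
  | elimWith₂L N h ih =>
    intro Γ T d
    cases d with
    | ampE₂ s d k =>
      obtain ⟨e, he⟩ := ih d
      exact ⟨.ampE₂ s e k, funext fun ρ => by rw [ev_ampE₂, ev_ampE₂, he]⟩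
  | elimWith₂R N h ih =>
    intro Γ T d
    cases d with
    | ampE₂ s k d =>
      obtain ⟨e, he⟩ := ih d
      exact ⟨.ampE₂ s k e, funext fun ρ => by rw [ev_ampE₂, ev_ampE₂, he]⟩
  | elimZero h ih =>
    intro Γ T d
    cases d with
    | zeroE A s d =>
      obtain ⟨e, he⟩ := ih d
      exact ⟨.zeroE _ s e, funext fun ρ => by rw [ev_zeroE, ev_zeroE]⟩
  | inl h ih =>
    intro Γ T d
    cases d with
    | plusI₁ _ d =>
      obtain ⟨e, he⟩ := ih d
      exact ⟨.plusI₁ _ e, funext fun ρ => by rw [ev_plusI₁, ev_plusI₁, he]⟩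
  | inr h ih =>
    intro Γ T d
    cases d with
    | plusI₂ _ d =>
      obtain ⟨e, he⟩ := ih d
      exact ⟨.plusI₂ _ e, funext fun ρ => by rw [ev_plusI₂, ev_plusI₂, he]⟩
  | elimPlus₁ _ _ h ih =>
    intro Γ T d
    cases d with
    | plusE s d k k' =>
      obtain ⟨e, he⟩ := ih d
      exact ⟨.plusE s e k k', funext fun ρ => by rw [ev_plusE, ev_plusE, he]⟩
  | elimPlus₂ _ _ h ih =>
    intro Γ T d
    cases d with
    | plusE s k d k' =>
      obtain ⟨e, he⟩ := ih d
      exact ⟨.plusE s k e k', funext fun ρ => by rw [ev_plusE, ev_plusE, he]⟩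
  | elimPlus₃ _ _ h ih =>
    intro Γ T d
    cases d with
    | plusE s k k' d =>
      obtain ⟨e, he⟩ := ih d
      exact ⟨.plusE s k k' e, funext fun ρ => by rw [ev_plusE, ev_plusE, he]⟩
  | B h ih =>
    intro Γ T d
    cases d with
    | BI s d =>
      obtain ⟨e, he⟩ := ih d
      exact ⟨.BI s e, funext fun ρ => by rw [ev_BI, ev_BI, he]⟩
  | tau h ih =>
    intro Γ T d
    cases d with
    | Btens d =>
      obtain ⟨e, he⟩ := ih d
      exact ⟨.Btens e, funext fun ρ => by rw [ev_Btens, ev_Btens, he]⟩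

/-! ### Algebraic equivalence as a typed congruence. -/

section AlgEq

variable {f : Frag} {Γ : Ctx f} {T : Prp f} {M N L : Tm f}

theorem AlgStep.derivable (h : AlgStep M N) (d : Derivable Γ M T) : Derivable Γ N T :=
  let ⟨d⟩ := d
  let ⟨e, _⟩ := h.exists_der d
  ⟨e⟩

theorem AlgEq.refl (M : Tm f) : AlgEq Γ T M M := Relation.EqvGen.refl M

theorem AlgEq.symm (h : AlgEq Γ T M N) : AlgEq Γ T N M := Relation.EqvGen.symm _ _ h

theorem AlgEq.trans (h : AlgEq Γ T M N) (k : AlgEq Γ T N L) : AlgEq Γ T M L :=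
  Relation.EqvGen.trans _ _ _ h k

theorem AlgStep.algEq (h : AlgStep M N) (d : Derivable Γ M T) : AlgEq Γ T M N :=
  Relation.EqvGen.rel _ _ ⟨h, d, h.derivable d⟩

/-- A step read backwards could introduce an untypable term, as in `M + 0 • N ⇆ M`; this is why
every link of the chain carries the typing of both ends. -/
theorem AlgEq.derivable_iff (h : AlgEq Γ T M N) : Derivable Γ M T ↔ Derivable Γ N T := by
  induction h with
  | rel _ _ h => exact iff_of_true h.2.1 h.2.2
  | refl => rfl
  | symm _ _ _ ih => exact ih.symm
  | trans _ _ _ _ _ ih₁ ih₂ => exact ih₁.trans ih₂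

theorem AlgEq.sem_eq (h : AlgEq Γ T M N) : sem Γ T M = sem Γ T N := by
  induction h with
  | rel _ _ h =>
    obtain ⟨h, ⟨d⟩, -⟩ := h
    obtain ⟨e, he⟩ := h.exists_der d
    rw [BImall.sem_eq d, BImall.sem_eq e, he]
  | refl => rfl
  | symm _ _ _ ih => exact ih.symm
  | trans _ _ _ _ _ ih₁ ih₂ => exact ih₁.trans ih₂

/-- Term constructors preserve algebraic equivalence. -/
theorem AlgEq.map {g : Frag} {Δ : Ctx g} {S : Prp g} (h : AlgEq Γ T M N) (C : Tm f → Tm g)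
    (hs : ∀ {M N : Tm f}, AlgStep M N → AlgStep (C M) (C N))
    (hd : ∀ {M : Tm f}, Der Γ M T → Derivable Δ (C M) S) : AlgEq Δ S (C M) (C N) := by
  induction h with
  | rel _ _ h =>
    obtain ⟨h, ⟨d⟩, -⟩ := h
    exact (hs h).algEq (hd d)
  | refl => exact AlgEq.refl _
  | symm _ _ _ ih => exact ih.symm
  | trans _ _ _ _ _ ih₁ ih₂ => exact ih₁.trans ih₂

end AlgEq

/-! ## Sums of terms -/

section IsSum

variable {f : Frag}

theorem isSum_append_singleton {l : List (Tm f)} (hl : l ≠ []) {N S : Tm f} :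
    IsSum (l ++ [N]) S ↔ ∃ S', IsSum l S' ∧ S = .add S' N := by
  cases l with
  | nil => exact absurd rfl hl
  | cons M l => simp [IsSum]

theorem exists_isSum {l : List (Tm f)} (hl : l ≠ []) : ∃ S, IsSum l S := by
  cases l with
  | nil => exact absurd rfl hl
  | cons M l => exact ⟨_, rfl⟩

/-- Induction on sums. -/
theorem IsSum.rec_add {p : List (Tm f) → Tm f → Prop} (h₁ : ∀ M, p [M] M)
    (h₂ : ∀ (l : List (Tm f)) (S N : Tm f), IsSum l S → p l S → p (l ++ [N]) (.add S N)) :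
    ∀ {l : List (Tm f)} {S : Tm f}, IsSum l S → p l S := by
  intro l
  induction l using List.reverseRecOn with
  | nil => exact fun h => h.elim
  | append_singleton l N ih =>
    intro S h
    by_cases hl : l = []
    · subst hl
      cases h; exact h₁ N
    · obtain ⟨S', h', rfl⟩ := (isSum_append_singleton hl).1 h
      exact h₂ l S' N h' (ih h')

theorem IsSum.derivable_iff {Γ : Ctx f} {T : Prp f} {l : List (Tm f)} {S : Tm f} (h : IsSum l S) :
    Derivable Γ S T ↔ ∀ M ∈ l, Derivable Γ M T := by
  refine IsSum.rec_add (p := fun l S => Derivable Γ S T ↔ ∀ M ∈ l, Derivable Γ M T)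
    (fun M => by simp) (fun l S N _ ih => ?_) h
  have : Derivable Γ (.add S N) T ↔ Derivable Γ S T ∧ Derivable Γ N T := by
    constructor
    · rintro ⟨d⟩
      cases d with
      | sum d e => exact ⟨⟨d⟩, ⟨e⟩⟩
    · rintro ⟨⟨d⟩, ⟨e⟩⟩
      exact ⟨.sum d e⟩
  rw [this, ih]
  simp [or_imp, forall_and]

theorem IsSum.sem_eq {Γ : Ctx f} {T : Prp f} {l : List (Tm f)} {S : Tm f} (h : IsSum l S) :
    Derivable Γ S T → sem Γ T S = (l.map (sem Γ T)).sum := by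
  refine IsSum.rec_add (p := fun l S => Derivable Γ S T → sem Γ T S = (l.map (sem Γ T)).sum)
    (fun M _ => by simp) (fun l S N _ ih hd => ?_) h
  obtain ⟨d⟩ := hd
  cases d with
  | sum d e =>
    have : sem Γ T (.add S N) = sem Γ T S + sem Γ T N := by
      rw [BImall.sem_eq d, BImall.sem_eq e, BImall.sem_eq (.sum d e)]
      exact funext fun ρ => ev_sum d e ρ
    rw [this, ih ⟨d⟩]
    simp

theorem derivable_smul {Γ : Ctx f} {T : Prp f} {a : Scal f} {M : Tm f} :
    Derivable Γ (.smul a M) T ↔ Derivable Γ M T := by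
  constructor
  · rintro ⟨d⟩
    cases d with
    | prod _ d => exact ⟨d⟩
  · rintro ⟨d⟩
    exact ⟨.prod a d⟩

theorem sem_smul {Γ : Ctx f} {T : Prp f} (a : Scal f) {M : Tm f} (h : Derivable Γ M T) :
    sem Γ T (.smul a M) = a.toComplex • sem Γ T M := by
  obtain ⟨d⟩ := h
  rw [sem_eq d, sem_eq (.prod a d)]
  exact funext fun ρ => ev_prod a d ρ

theorem IsSum.derivable_smul {Γ : Ctx f} {T : Prp f} {X : Type} {l : List X} {a : X → Scal f}
    {g : X → Tm f} {S : Tm f} (h : IsSum (l.map fun x => .smul (a x) (g x)) S) :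
    Derivable Γ S T ↔ ∀ x ∈ l, Derivable Γ (g x) T := by
  rw [h.derivable_iff]
  simp [BImall.derivable_smul]

theorem IsSum.sem_smul {Γ : Ctx f} {T : Prp f} {X : Type} {l : List X} {a : X → Scal f}
    {g : X → Tm f} {S : Tm f} (h : IsSum (l.map fun x => .smul (a x) (g x)) S)
    (hd : Derivable Γ S T) :
    sem Γ T S = (l.map fun x => (a x).toComplex • sem Γ T (g x)).sum := by
  rw [h.sem_eq hd, List.map_map]
  congr 1
  exact List.map_congr_left fun x hx => BImall.sem_smul _ (h.derivable_smul.1 hd x hx)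

/-- Linear maps that agree on the summands agree on the sums. -/
theorem IsSum.linear_eq {Γ Δ : Ctx f} {T T' : Prp f} {X E : Type} [AddCommGroup E] [Module ℂ E]
    {l : List X} {a : X → Scal f} {g₁ g₂ : X → Tm f} {S R : Tm f}
    (hS : IsSum (l.map fun x => .smul (a x) (g₁ x)) S)
    (hR : IsSum (l.map fun x => .smul (a x) (g₂ x)) R)
    (dS : Derivable Γ S T) (dR : Derivable Δ R T')
    (L₁ : (Env Γ → Basis T → ℂ) →ₗ[ℂ] E) (L₂ : (Env Δ → Basis T' → ℂ) →ₗ[ℂ] E)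
    (h : ∀ x ∈ l, L₁ (sem Γ T (g₁ x)) = L₂ (sem Δ T' (g₂ x))) :
    L₁ (sem Γ T S) = L₂ (sem Δ T' R) := by
  rw [hS.sem_smul dS, hR.sem_smul dR, map_list_sum, map_list_sum, List.map_map, List.map_map]
  congr 1
  exact List.map_congr_left fun x hx => by simp only [Function.comp_apply, map_smul, h x hx]

/-- A term constructor that denotes a linear map commutes with sums. -/
theorem IsSum.exists_der_map {T T' : Prp f} {X : Type} {l : List X} {a : X → Scal f}
    {g : X → Tm f} {F : Tm f → Tm f} {S R : Tm f}
    (hS : IsSum (l.map fun x => .smul (a x) (g x)) S)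
    (hR : IsSum (l.map fun x => .smul (a x) (F (g x))) R)
    (L : (Basis T → ℂ) →ₗ[ℂ] (Basis T' → ℂ))
    (hF : ∀ {M : Tm f} (d : Der [] M T), ∃ e : Der [] (F M) T', ∀ ρ, ev e ρ = L (ev d ρ))
    (d : Der [] S T) : ∃ e : Der [] R T', ∀ ρ, ev e ρ = L (ev d ρ) := by
  have hg := hS.derivable_smul.1 ⟨d⟩
  have hR' : Derivable [] R T' := hR.derivable_smul.2 fun x hx =>
    let ⟨d⟩ := hg x hx
    let ⟨e, _⟩ := hF d
    ⟨e⟩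
  have := hS.linear_eq hR ⟨d⟩ hR' (L.compLeft (Env [])) .id fun x hx => by
    obtain ⟨d⟩ := hg x hx
    obtain ⟨e, he⟩ := hF d
    rw [BImall.sem_eq d, BImall.sem_eq e]
    exact funext fun ρ => (he ρ).symm
  obtain ⟨e⟩ := hR'
  rw [BImall.sem_eq d, BImall.sem_eq e] at this
  exact ⟨e, fun ρ => (congrFun this ρ).symm⟩

end IsSum

/-! ## Cut reduction preserves typing and denotations -/

def fstₗ {P Q : Prp .pure} : (Basis (P.amp Q) → ℂ) →ₗ[ℂ] (Basis P → ℂ) where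
  toFun x t := x (.inl t)
  map_add' _ _ := rfl
  map_smul' _ _ := rfl

def sndₗ {P Q : Prp .pure} : (Basis (P.amp Q) → ℂ) →ₗ[ℂ] (Basis Q → ℂ) where
  toFun x t := x (.inr t)
  map_add' _ _ := rfl
  map_smul' _ _ := rfl

def inlₗ {A C : Prp .mixed} : (Basis A → ℂ) →ₗ[ℂ] (Basis (A.plus C) → ℂ) where
  toFun x := Sum.elim x fun _ => 0
  map_add' _ _ := by
    funext t
    cases t
    · rfl
    · exact (add_zero (0 : ℂ)).symm
  map_smul' c _ := by
    funext t
    cases t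
    · rfl
    · exact (mul_zero c).symm

def inrₗ {A C : Prp .mixed} : (Basis C → ℂ) →ₗ[ℂ] (Basis (A.plus C) → ℂ) where
  toFun x := Sum.elim (fun _ => 0) x
  map_add' _ _ := by
    funext t
    cases t
    · exact (add_zero (0 : ℂ)).symm
    · rfl
  map_smul' c _ := by
    funext t
    cases t
    · exact (mul_zero c).symm
    · rfl

theorem ev_cons_add {f : Frag} {Γ : Ctx f} {M : Tm f} {S T : Prp f} (d : Der (some S :: Γ) M T)
    (x y : Basis S → ℂ) (ρ : Env Γ) :
    ev d (.cons (x + y) ρ) = ev d (.cons x ρ) + ev d (.cons y ρ) := by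
  funext t
  rw [Pi.add_apply, ev_linear, ev_linear d x, ev_linear d y, ← Finset.sum_add_distrib]
  exact Finset.sum_congr rfl fun s _ => add_mul _ _ _

theorem ev_cons_smul {f : Frag} {Γ : Ctx f} {M : Tm f} {S T : Prp f} (d : Der (some S :: Γ) M T)
    (c : ℂ) (x : Basis S → ℂ) (ρ : Env Γ) :
    ev d (.cons (c • x) ρ) = c • ev d (.cons x ρ) := by
  funext t
  rw [Pi.smul_apply, ev_linear, ev_linear d x, smul_eq_mul, Finset.mul_sum]
  exact Finset.sum_congr rfl fun s _ => mul_assoc _ _ _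

/-- The linear map denoted by a derivation with one variable. -/
noncomputable def evₗ {f : Frag} {Γ : Ctx f} {M : Tm f} {S T : Prp f}
    (d : Der (some S :: Γ) M T) (ρ : Env Γ) : (Basis S → ℂ) →ₗ[ℂ] (Basis T → ℂ) where
  toFun x := ev d (.cons x ρ)
  map_add' x y := ev_cons_add d x y ρ
  map_smul' c x := ev_cons_smul d c x ρ

def plusInlₗ {A C : Prp .mixed} : (Basis (A.plus C) → ℂ) →ₗ[ℂ] (Basis A → ℂ) where
  toFun x t := x (.inl t)
  map_add' _ _ := rfl
  map_smul' _ _ := rfl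

def plusInrₗ {A C : Prp .mixed} : (Basis (A.plus C) → ℂ) →ₗ[ℂ] (Basis C → ℂ) where
  toFun x t := x (.inr t)
  map_add' _ _ := rfl
  map_smul' _ _ := rfl

noncomputable def plusElimₗ {Γ : Ctx .mixed} {M N : Tm .mixed} {A C D : Prp .mixed}
    (d : Der (some A :: Γ) M D) (e : Der (some C :: Γ) N D) (ρ : Env Γ) :
    (Basis (A.plus C) → ℂ) →ₗ[ℂ] (Basis D → ℂ) :=
  (evₗ d ρ).comp plusInlₗ + (evₗ e ρ).comp plusInrₗ

theorem ev_plusI₁' {Γ : Ctx .mixed} {m : Tm .mixed} {A : Prp .mixed} (C : Prp .mixed)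
    (d : Der Γ m A) (ρ : Env Γ) : ev (.plusI₁ C d) ρ = inlₗ (ev d ρ) := ev_plusI₁ C d ρ

theorem ev_plusI₂' {Γ : Ctx .mixed} {m : Tm .mixed} {C : Prp .mixed} (A : Prp .mixed)
    (d : Der Γ m C) (ρ : Env Γ) : ev (.plusI₂ A d) ρ = inrₗ (ev d ρ) := ev_plusI₂ A d ρ

theorem map₂_list_sum {E F G : Type} [AddCommGroup E] [AddCommGroup F] [AddCommGroup G]
    [Module ℂ E] [Module ℂ F] [Module ℂ G] (B : E →ₗ[ℂ] F →ₗ[ℂ] G) (l : List E) (k : List F) :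
    B l.sum k.sum = (l.flatMap fun x => k.map fun y => B x y).sum := by
  induction l with
  | nil => simp
  | cons x l ih =>
    rw [List.sum_cons, map_add, LinearMap.add_apply, ih, List.flatMap_cons, List.sum_append,
      map_list_sum]

theorem bproj_smul {P : Prp .pure} (a : Scal .pure) (x : Basis P → ℂ) :
    bproj (a.toComplex • x) = a.normSq.toComplex • bproj x := by
  funext t
  show (a.toComplex * x t.1) * star (a.toComplex * x t.2) = _ * (x t.1 * star (x t.2))
  rw [Scal.toComplex_normSq, star_mul']; ring

/-- `λ`-abstraction, on denotations. -/
def curryₗ {f : Frag} {S T : Prp f} :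
    (Env [some S] → Basis T → ℂ) →ₗ[ℂ] (Env ([] : Ctx f) → Basis (S.lolli T) → ℂ) where
  toFun x ρ t := x (.cons (bvec t.1) ρ) t.2
  map_add' _ _ := rfl
  map_smul' _ _ := rfl

/-- Closed terms suffice: evaluation contexts never go under a binder, so only the empty context is
divided and only closed values are substituted. Cuts follow from the substitution lemma, and
commutations from the linearity of the constructor concerned. -/
theorem Red.exists_der {f : Frag} {M N : Tm f} (h : Red M N) :
    ∀ {T : Prp f} (d : Der [] M T), ∃ e : Der [] N T, ∀ ρ, ev e ρ = ev d ρ := by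
  induction h with
  | one a M =>
    intro T d
    cases d with
    | oneE h d e =>
      cases h
      cases d with
      | prod _ d =>
        cases d with
        | oneI h =>
          refine ⟨.prod a e, fun ρ => ?_⟩
          rw [ev_prod, ev_oneE, ev_prod, ev_oneI]
          exact congrArg (· • ev e ρ) (mul_one a.toComplex).symm
  | beta M hV =>
    intro T d
    cases d with
    | lolliE h d k =>
      cases h
      cases d with
      | lolliI d =>
        obtain ⟨e, he⟩ := d.exists_inst k
        refine ⟨e, fun ρ => he.trans ?_⟩
        rw [ev_lolliE, ev_lolliI]
        funext t
        rw [ev_linear]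
        exact Finset.sum_congr rfl fun s _ => mul_comm _ _
    | BlolliE h d k => cases h; cases d
  | with₁ t hv hw =>
    intro T d
    cases d with
    | ampE₁ h d k =>
      cases h
      cases d with
      | ampI d d' =>
        obtain ⟨e, he⟩ := k.exists_inst d
        exact ⟨e, fun ρ => he.trans (by rw [ev_ampE₁, ev_ampI]; rfl)⟩
  | with₂ t hv hw =>
    intro T d
    cases d with
    | ampE₂ h d k =>
      cases h
      cases d with
      | ampI d d' =>
        obtain ⟨e, he⟩ := k.exists_inst d'
        exact ⟨e, fun ρ => he.trans (by rw [ev_ampE₂, ev_ampI]; rfl)⟩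
  | plusL m n hv =>
    intro T d
    cases d with
    | plusE h d k o =>
      cases h
      cases d with
      | plusI₁ _ d =>
        obtain ⟨e, he⟩ := k.exists_inst d
        refine ⟨e, fun ρ => he.trans ?_⟩
        rw [ev_plusE, ev_plusI₁]
        exact ((congrArg _ (map_zero (evₗ o _))).trans (add_zero _)).symm
  | plusR m n hv =>
    intro T d
    cases d with
    | plusE h d k o =>
      cases h
      cases d with
      | plusI₂ _ d =>
        obtain ⟨e, he⟩ := o.exists_inst d
        refine ⟨e, fun ρ => he.trans ?_⟩
        rw [ev_plusE, ev_plusI₂]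
        exact ((congrArg (· + _) (map_zero (evₗ k _))).trans (zero_add _)).symm
  | tensor M hV hW =>
    intro T d
    cases d with
    | tensE h d k =>
      cases h
      cases d with
      | tensI h d d' =>
        cases h
        obtain ⟨e, he⟩ := k.exists_inst₂ d d'
        exact ⟨e, fun ρ => he.trans (by rw [ev_tensE', ev_tensI', elimTensₗ_tvec]; rfl)⟩
  | commTop a =>
    intro T d
    cases d with
    | prod _ d =>
      cases d with
      | topI => exact ⟨.topI _, fun ρ => by rw [ev_prod, ev_topI, smul_zero]⟩
  | @commLam f l S R hd hS hR =>
    intro T d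
    -- Sums are nonempty, since `IsSum []` is false; one summand is enough to see that `T` has the
    -- form `A ⊸ C`.
    obtain ⟨x, hx⟩ := List.exists_mem_of_ne_nil l (by rintro rfl; exact hS)
    have hg := hS.derivable_smul.1 ⟨d⟩
    obtain ⟨dx⟩ := hg x hx
    cases dx with
    | @lolliI _ _ _ A C dx =>
      have hR' : Derivable [some A] R C := hR.derivable_smul.2 fun y hy => by
        obtain ⟨dy⟩ := hg y hy
        cases dy with
        | lolliI dy => exact ⟨dy⟩
      have := hS.linear_eq hR ⟨d⟩ hR' .id curryₗ fun y hy => by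
        obtain ⟨dy⟩ := hg y hy
        cases dy with
        | lolliI dy =>
          rw [sem_eq dy, sem_eq (.lolliI dy)]
          exact funext fun ρ => ev_lolliI dy ρ
      obtain ⟨e⟩ := hR'
      rw [sem_eq d, sem_eq e] at this
      exact ⟨.lolliI e, fun ρ => (ev_lolliI e ρ).trans (congrFun this ρ).symm⟩
  | @commPair l S R₁ R₂ hv hd hS hR₁ hR₂ =>
    intro T d
    obtain ⟨x, hx⟩ := List.exists_mem_of_ne_nil l (by rintro rfl; exact hS)
    have hg := hS.derivable_smul.1 ⟨d⟩
    obtain ⟨dx⟩ := hg x hx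
    cases dx with
    | @ampI _ _ _ P Q dx dx' =>
      have hR₁' : Derivable [] R₁ P := hR₁.derivable_smul.2 fun y hy => by
        obtain ⟨dy⟩ := hg y hy
        cases dy with
        | ampI dy _ => exact ⟨dy⟩
      have hR₂' : Derivable [] R₂ Q := hR₂.derivable_smul.2 fun y hy => by
        obtain ⟨dy⟩ := hg y hy
        cases dy with
        | ampI _ dy => exact ⟨dy⟩
      have h₁ := hS.linear_eq hR₁ ⟨d⟩ hR₁' (fstₗ.compLeft (Env [])) .id fun y hy => by
        obtain ⟨dy⟩ := hg y hy
        cases dy with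
        | ampI dy dy' =>
          rw [sem_eq dy, sem_eq (.ampI dy dy')]
          exact funext fun ρ => congrArg fstₗ (ev_ampI dy dy' ρ)
      have h₂ := hS.linear_eq hR₂ ⟨d⟩ hR₂' (sndₗ.compLeft (Env [])) .id fun y hy => by
        obtain ⟨dy⟩ := hg y hy
        cases dy with
        | ampI dy dy' =>
          rw [sem_eq dy', sem_eq (.ampI dy dy')]
          exact funext fun ρ => congrArg sndₗ (ev_ampI dy dy' ρ)
      obtain ⟨e₁⟩ := hR₁'
      obtain ⟨e₂⟩ := hR₂'
      rw [sem_eq d, sem_eq e₁] at h₁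
      rw [sem_eq d, sem_eq e₂] at h₂
      refine ⟨.ampI e₁ e₂, fun ρ => (ev_ampI e₁ e₂ ρ).trans ?_⟩
      funext t
      cases t with
      | inl t => exact (congrFun (congrFun h₁ ρ) t).symm
      | inr t => exact (congrFun (congrFun h₂ ρ) t).symm
  | commPlus l o s hv hd hS hR =>
    intro T d
    cases d with
    | plusE h d k k' =>
      cases h
      have key : ∀ {M} (d : Der [] M _) ρ, ev (.plusE .nil d k k') ρ =
          plusElimₗ k k' .nil (ev d ρ) := fun d ρ => ev_plusE .nil d k k' ρ
      obtain ⟨e, he⟩ := hS.exists_der_map (F := fun M => .elimPlus M o s) hR _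
        (fun d => ⟨.plusE .nil d k k', key d⟩) d
      exact ⟨e, fun ρ => (he ρ).trans (key d ρ).symm⟩
  | commTens l M hv hd hS hR =>
    intro T d
    cases d with
    | tensE h d k =>
      cases h
      have key : ∀ {M} (d : Der [] M _) ρ, ev (.tensE .nil d k) ρ =
          elimTensₗ k .nil (ev d ρ) := fun d ρ => ev_tensE' .nil d k ρ
      obtain ⟨e, he⟩ := hS.exists_der_map (F := fun S => .elimTens S M) hR _
        (fun d => ⟨.tensE .nil d k, key d⟩) d
      exact ⟨e, fun ρ => (he ρ).trans (key d ρ).symm⟩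
  | commInl l hv hd hS hR =>
    intro T d
    cases d with
    | plusI₁ C d =>
      obtain ⟨e, he⟩ := hS.exists_der_map (F := .inl) hR inlₗ
        (fun d => ⟨.plusI₁ C d, ev_plusI₁' C d⟩) d
      exact ⟨e, fun ρ => (he ρ).trans (ev_plusI₁ C d ρ).symm⟩
  | commInr l hv hd hS hR =>
    intro T d
    cases d with
    | plusI₂ C d =>
      obtain ⟨e, he⟩ := hS.exists_der_map (F := .inr) hR inrₗ
        (fun d => ⟨.plusI₂ C d, ev_plusI₂' C d⟩) d
      exact ⟨e, fun ρ => (he ρ).trans (ev_plusI₂ C d ρ).symm⟩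
  | cast hv hw =>
    intro T d
    cases d with
    | Btens d =>
      cases d with
      | tensI h d d' =>
        cases h
        cases d with
        | BI _ d =>
          cases d' with
          | BI _ d' =>
            refine ⟨.BI Ctx.empty_nil (.tensI .nil d d'), fun ρ => ?_⟩
            rw [ev_Btens', ev_tensI', ev_BI', ev_BI', ev_BI', ev_tensI', btens_tvec_bproj]
            rfl
  | commTau l hv hd hS hR =>
    intro T d
    cases d with
    | Btens d =>
      obtain ⟨e, he⟩ := hS.exists_der_map (F := .tau) hR btens
        (fun d => ⟨.Btens d, ev_Btens' d⟩) d
      exact ⟨e, fun ρ => (he ρ).trans (ev_Btens' d ρ).symm⟩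
  | commB a ha hv =>
    intro T d
    cases d with
    | BI h d =>
      cases d with
      | prod _ d =>
        exact ⟨.prod _ (.BI h d), fun ρ => by rw [ev_prod, ev_BI', ev_BI', ev_prod, bproj_smul]⟩
  | @commBapp l k S S' R hl hk hdl hdk hS hS' hR =>
    intro T d
    cases d with
    | lolliE h d k =>
      obtain ⟨x, hx⟩ := List.exists_mem_of_ne_nil l (by rintro rfl; exact hS)
      cases h
      obtain ⟨dx⟩ := hS.derivable_smul.1 ⟨d⟩ x hx
      cases dx
    | @BlolliE _ _ _ _ _ P Q h d e =>
      cases h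
      have h₁ : ∀ x ∈ l, Derivable [] x.2 (P.lolli Q) := fun x hx => by
        obtain ⟨dx⟩ := hS.derivable_smul.1 ⟨d⟩ x hx
        cases dx with
        | BI _ dx => exact ⟨dx⟩
      have h₂ : ∀ y ∈ k, Derivable [] y.2 P := fun y hy => by
        obtain ⟨dy⟩ := hS'.derivable_smul.1 ⟨e⟩ y hy
        cases dy with
        | BI _ dy => exact ⟨dy⟩
      have h₃ : ∀ x ∈ l, ∀ y ∈ k, Derivable [] (Tm.B (.app x.2 y.2)) (.B Q) := by
        intro x hx y hy
        obtain ⟨dx⟩ := h₁ x hx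
        obtain ⟨dy⟩ := h₂ y hy
        exact ⟨.BI Ctx.empty_nil (.lolliE .nil dx dy)⟩
      have hR' : Derivable [] R (.B Q) := hR.derivable_iff.2 fun M hM => by
        obtain ⟨x, hx, hM⟩ := List.mem_flatMap.1 hM
        obtain ⟨y, hy, rfl⟩ := List.mem_map.1 hM
        exact derivable_smul.2 (h₃ x hx y hy)
      -- Both sides expand bilinearly over the pairs of summands, and each pair is an instance of
      -- `bapp_bproj`.
      have key : ∀ ρ, (LinearMap.proj ρ : (Env [] → Basis (.B Q) → ℂ) →ₗ[ℂ] _)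
          (sem [] (.B Q) R) = (bapp.compl₁₂ (LinearMap.proj ρ) (LinearMap.proj ρ))
            (sem [] (.B (P.lolli Q)) S) (sem [] (.B P) S') := by
        intro ρ
        rw [hS.sem_smul ⟨d⟩, hS'.sem_smul ⟨e⟩, hR.sem_eq hR', map₂_list_sum, map_list_sum,
          List.map_flatMap, List.map_flatMap, List.flatMap_map]
        congr 1
        refine List.flatMap_congr fun x hx => ?_
        rw [List.map_map, List.map_map, List.map_map]
        refine List.map_congr_left fun y hy => ?_
        obtain ⟨dx⟩ := h₁ x hx
        obtain ⟨dy⟩ := h₂ y hy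
        simp only [Function.comp_apply, sem_smul _ (h₃ x hx y hy), Scal.toComplex_mul,
          sem_eq (.BI Ctx.empty_nil dx), sem_eq (.BI Ctx.empty_nil dy),
          sem_eq (.BI Ctx.empty_nil (.lolliE .nil dx dy)), map_smul, LinearMap.smul_apply,
          LinearMap.compl₁₂_apply, LinearMap.proj_apply, ev_BI', mul_smul]
        have hb : bapp (bproj (ev dx .nil)) (bproj (ev dy .nil)) =
            bproj (ev (.lolliE .nil dx dy) .nil) :=
          (bapp_bproj _ _).trans (congrArg bproj (ev_lolliE .nil dx dy .nil).symm)
        congr 1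
        refine Eq.trans ?_ (map_smul (bapp (bproj (ev dx .nil))) y.1.toComplex
          (ev (.BI Ctx.empty_nil dy) ρ)).symm
        rw [ev_BI', hb]
      obtain ⟨e'⟩ := hR'
      refine ⟨e', fun ρ => ?_⟩
      have := key ρ
      rw [sem_eq d, sem_eq e, sem_eq e'] at this
      exact this.trans (ev_BlolliE' .nil d e ρ).symm
  | addL N h ih =>
    intro T d
    cases d with
    | sum d k =>
      obtain ⟨e, he⟩ := ih d
      exact ⟨.sum e k, fun ρ => by rw [ev_sum, ev_sum, he]⟩
  | smul a h ih =>
    intro T d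
    cases d with
    | prod _ d =>
      obtain ⟨e, he⟩ := ih d
      exact ⟨.prod a e, fun ρ => by rw [ev_prod, ev_prod, he]⟩
  | elimZero h ih =>
    intro T d
    cases d with
    | zeroE A s d =>
      cases s
      obtain ⟨e, he⟩ := ih d
      exact ⟨.zeroE _ .nil e, fun ρ => by rw [ev_zeroE, ev_zeroE]⟩
  | elimOneL N h ih =>
    intro T d
    cases d with
    | oneE s d k =>
      cases s
      obtain ⟨e, he⟩ := ih d
      exact ⟨.oneE .nil e k, fun ρ => by rw [ev_oneE, ev_oneE, he]⟩
  | appL N h ih =>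
    intro T d
    cases d with
    | lolliE s d k =>
      cases s
      obtain ⟨e, he⟩ := ih d
      exact ⟨.lolliE .nil e k, fun ρ => by rw [ev_lolliE, ev_lolliE, he]⟩
    | BlolliE s d k =>
      cases s
      obtain ⟨e, he⟩ := ih d
      exact ⟨.BlolliE .nil e k, fun ρ => by rw [ev_BlolliE', ev_BlolliE', he]⟩
  | appR hV h ih =>
    intro T d
    cases d with
    | lolliE s k d =>
      cases s
      obtain ⟨e, he⟩ := ih d
      exact ⟨.lolliE .nil k e, fun ρ => by rw [ev_lolliE, ev_lolliE, he]⟩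
    | BlolliE s k d =>
      cases s
      obtain ⟨e, he⟩ := ih d
      exact ⟨.BlolliE .nil k e, fun ρ => by rw [ev_BlolliE', ev_BlolliE', he]⟩
  | pairL n h ih =>
    intro T d
    cases d with
    | ampI d k =>
      obtain ⟨e, he⟩ := ih d
      exact ⟨.ampI e k, fun ρ => by rw [ev_ampI, ev_ampI, he]⟩
  | pairR hv h ih =>
    intro T d
    cases d with
    | ampI k d =>
      obtain ⟨e, he⟩ := ih d
      exact ⟨.ampI k e, fun ρ => by rw [ev_ampI, ev_ampI, he]⟩
  | elimWith₁ n h ih =>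
    intro T d
    cases d with
    | ampE₁ s d k =>
      cases s
      obtain ⟨e, he⟩ := ih d
      exact ⟨.ampE₁ .nil e k, fun ρ => by rw [ev_ampE₁, ev_ampE₁, he]⟩
  | elimWith₂ n h ih =>
    intro T d
    cases d with
    | ampE₂ s d k =>
      cases s
      obtain ⟨e, he⟩ := ih d
      exact ⟨.ampE₂ .nil e k, fun ρ => by rw [ev_ampE₂, ev_ampE₂, he]⟩
  | inl h ih =>
    intro T d
    cases d with
    | plusI₁ C d =>
      obtain ⟨e, he⟩ := ih d
      exact ⟨.plusI₁ C e, fun ρ => by rw [ev_plusI₁, ev_plusI₁, he]⟩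
  | inr h ih =>
    intro T d
    cases d with
    | plusI₂ C d =>
      obtain ⟨e, he⟩ := ih d
      exact ⟨.plusI₂ C e, fun ρ => by rw [ev_plusI₂, ev_plusI₂, he]⟩
  | elimPlus n o h ih =>
    intro T d
    cases d with
    | plusE s d k k' =>
      cases s
      obtain ⟨e, he⟩ := ih d
      exact ⟨.plusE .nil e k k', fun ρ => by rw [ev_plusE, ev_plusE, he]⟩
  | tensL N h ih =>
    intro T d
    cases d with
    | tensI s d k =>
      cases s
      obtain ⟨e, he⟩ := ih d
      exact ⟨.tensI .nil e k, fun ρ => by rw [ev_tensI', ev_tensI', he]⟩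
  | tensR hV h ih =>
    intro T d
    cases d with
    | tensI s k d =>
      cases s
      obtain ⟨e, he⟩ := ih d
      exact ⟨.tensI .nil k e, fun ρ => by rw [ev_tensI', ev_tensI', he]⟩
  | elimTens N h ih =>
    intro T d
    cases d with
    | tensE s d k =>
      cases s
      obtain ⟨e, he⟩ := ih d
      exact ⟨.tensE .nil e k, fun ρ => by rw [ev_tensE', ev_tensE', he]⟩
  | B h ih =>
    intro T d
    cases d with
    | BI s d =>
      obtain ⟨e, he⟩ := ih d
      exact ⟨.BI s e, fun ρ => by rw [ev_BI', ev_BI', he]⟩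
  | tau h ih =>
    intro T d
    cases d with
    | Btens d =>
      obtain ⟨e, he⟩ := ih d
      exact ⟨.Btens e, fun ρ => by rw [ev_Btens', ev_Btens', he]⟩

/-! ## Measures of terms -/

/-- A measure that strictly decreases in cuts. -/
def Tm.wt : {f : Frag} → Tm f → ℕ
  | _, .var _ => 1
  | _, .add M N => M.wt + N.wt
  | _, .smul _ M => M.wt
  | _, .star => 1
  | _, .elimOne M N => 2 * M.wt * N.wt
  | _, .lam M => M.wt
  | _, .app M N => 2 * M.wt * N.wt
  | _, .tens M N => M.wt * N.wt
  | _, .elimTens M N => 2 * M.wt * N.wt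
  | _, .topI => 1
  | _, .pair m n => m.wt + n.wt
  | _, .elimWith₁ m n => m.wt * n.wt
  | _, .elimWith₂ m n => m.wt * n.wt
  | _, .elimZero m => m.wt
  | _, .inl m => m.wt
  | _, .inr m => m.wt
  | _, .elimPlus m n o => m.wt * (n.wt + o.wt)
  -- With a constant `c` here, application in `𝓑` turns `2 (c v²)(c w²)` into `c (2 v w)² = 4 c v²
  -- w²`, which is smaller only if `c > 2`. Fusion by `τ` turns `c² v² w²` into `c v² w²`.
  | _, .B m => 3 * m.wt ^ 2
  | _, .tau m => m.wt

theorem Tm.wt_pos {f : Frag} (M : Tm f) : 0 < M.wt := by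
  induction M <;> simp only [Tm.wt] <;> positivity

open Classical in
/-- The contribution of a coefficient to the second measure. -/
noncomputable def cf {f : Frag} (k : ℕ) (a : Scal f) : ℕ := if a = 1 then k else 2

/-- A measure that decreases in the commutation with sums. -/
noncomputable def Tm.cwt (k : ℕ) : {f : Frag} → Tm f → ℕ
  | _, .var _ => 1
  | _, .add M N => M.cwt k + N.cwt k
  | _, .smul a M => cf k a * M.cwt k
  | _, .star => 1
  | _, .elimOne M N => M.cwt k * N.cwt k
  -- The `+ 1` of abstractions and pairs is counted for every summand before a commutation with a
  -- sum, and only once after it.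
  | _, .lam M => M.cwt k + 1
  | _, .app M N => M.cwt k * N.cwt k
  | _, .tens M N => M.cwt k * N.cwt k
  | _, .elimTens M N => M.cwt k ^ 2 * N.cwt k
  | _, .topI => 1
  | _, .pair m n => m.cwt k + n.cwt k + 1
  | _, .elimWith₁ m n => m.cwt k * n.cwt k
  | _, .elimWith₂ m n => m.cwt k * n.cwt k
  | _, .elimZero m => m.cwt k
  | _, .inl m => m.cwt k ^ 2
  | _, .inr m => m.cwt k ^ 2
  | _, .elimPlus m n o => m.cwt k ^ 2 * (n.cwt k + o.cwt k)
  | _, .B m => m.cwt k ^ 2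
  | _, .tau m => m.cwt k ^ 2

/-- For `k = 1` a coefficient `1` is free, so it can be inserted at no cost. For `k = 2` every
coefficient counts `2`, so that commutations with a lone coefficient `1` are seen as well. -/
theorem cf_one {f : Frag} (k : ℕ) : cf k (1 : Scal f) = k := if_pos rfl

theorem cf_of_ne {f : Frag} (k : ℕ) {a : Scal f} (ha : a ≠ 1) : cf k a = 2 := if_neg ha

theorem cf_le_two {f : Frag} {k : ℕ} (hk : k ≤ 2) (a : Scal f) : cf k a ≤ 2 := by
  unfold cf; split <;> omega

theorem le_cf {f : Frag} {k : ℕ} (hk : k ≤ 2) (a : Scal f) : k ≤ cf k a := by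
  unfold cf; split <;> omega

theorem cf_pos {f : Frag} {k : ℕ} (hk : 0 < k) (a : Scal f) : 0 < cf k a := by
  unfold cf; split <;> omega

/-- A factor `1` changes nothing, and a factor other than `1` already contributes the maximal value
`2`. -/
theorem cf_mul_le {f : Frag} (a b : Scal f) : cf 1 (a * b) ≤ cf 1 a * cf 1 b := by
  by_cases ha : a = 1
  · rw [ha, one_mul, cf_one, one_mul]
  · rw [cf_of_ne 1 ha]
    have := cf_le_two (by omega) (a * b) (k := 1)
    have := cf_pos one_pos b
    omega

theorem cf_add_le {f : Frag} (a b : Scal f) : cf 1 (a + b) ≤ cf 1 a + cf 1 b := by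
  have := cf_le_two (by omega) (a + b) (k := 1)
  have := cf_pos one_pos a
  have := cf_pos one_pos b
  omega

theorem Tm.cwt_pos {f : Frag} {k : ℕ} (hk : 0 < k) (M : Tm f) : 0 < M.cwt k := by
  induction M <;> simp only [Tm.cwt] <;>
    first | positivity | exact Nat.mul_pos (cf_pos hk _) ‹_›

theorem Tm.wt_rename {f : Frag} (M : Tm f) : ∀ r : ℕ → ℕ, (M.rename r).wt = M.wt := by
  induction M <;> intro r <;> simp_all only [Tm.rename, Tm.wt]

/-- The product of the measures of the terms that a substitution gives to the declared variables. -/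
def Ctx.substWt {f : Frag} : Ctx f → (ℕ → Tm f) → ℕ
  | [], _ => 1
  | none :: Γ, s => Ctx.substWt Γ fun i => s (i + 1)
  | some _ :: Γ, s => (s 0).wt * Ctx.substWt Γ fun i => s (i + 1)

theorem Ctx.substWt_pos {f : Frag} : ∀ (Γ : Ctx f) (s : ℕ → Tm f), 0 < Γ.substWt s
  | [], _ => Nat.one_pos
  | none :: Γ, _ => Ctx.substWt_pos Γ _
  | some _ :: Γ, _ => Nat.mul_pos (Tm.wt_pos _) (Ctx.substWt_pos Γ _)

theorem Ctx.substWt_congr {f : Frag} : ∀ (Γ : Ctx f) {s s' : ℕ → Tm f}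
    (_ : ∀ i, (s i).wt = (s' i).wt), Γ.substWt s = Γ.substWt s'
  | [], _, _, _ => rfl
  | none :: Γ, _, _, h => Ctx.substWt_congr Γ fun i => h (i + 1)
  | some _ :: Γ, _, _, h =>
      congrArg₂ (· * ·) (h 0) (Ctx.substWt_congr Γ fun i => h (i + 1))

theorem Ctx.substWt_liftSub {f : Frag} (Γ : Ctx f) (S : Prp f) (s : ℕ → Tm f) :
    Ctx.substWt (some S :: Γ) (liftSub s) = Γ.substWt s :=
  (one_mul _).trans (Γ.substWt_congr fun i => (s i).wt_rename _)

theorem Split.substWt {f : Frag} {Γ Γ₁ Γ₂ : Ctx f} (h : Split Γ Γ₁ Γ₂) : ∀ s : ℕ → Tm f,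
    Γ.substWt s = Γ₁.substWt s * Γ₂.substWt s := by
  induction h with
  | nil => exact fun s => rfl
  | none h ih => exact fun s => ih _
  | left S h ih => exact fun s => by simp only [Ctx.substWt, ih, mul_assoc]
  | right S h ih => exact fun s => by simp only [Ctx.substWt, ih, mul_left_comm]

theorem Only.wt_le {f : Frag} {Γ : Ctx f} {i : ℕ} {S : Prp f} (h : Only Γ i S) :
    ∀ s : ℕ → Tm f, (s i).wt ≤ Γ.substWt s := by
  induction h with
  | here h => exact fun s => Nat.le_mul_of_pos_right _ (Ctx.substWt_pos _ _)
  | there h ih => exact fun s => ih fun i => s (i + 1)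

/-- Variables occur linearly in terms. -/
theorem Der.wt_subst_le {f : Frag} {Γ : Ctx f} {M : Tm f} {T : Prp f} (d : Der Γ M T) :
    ∀ s : ℕ → Tm f, (M.subst s).wt ≤ M.wt * Γ.substWt s := by
  induction d with
  | ax h => exact fun s => (h.wt_le s).trans (one_mul _).ge
  -- Premises that share a context are added in the measure, so the weight of the substitution
  -- distributes over them; where the context is divided, it factors by `Split.substWt`.
  -- Declarations that are discarded only help, since weights are positive.
  | sum d e ihd ihe =>
    intro s
    simp only [Tm.subst, Tm.wt, add_mul]
    exact add_le_add (ihd s) (ihe s)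
  | prod a d ih => exact ih
  | topI Γ => exact fun s => (Ctx.substWt_pos _ _).trans_eq (one_mul _).symm
  | zeroE A h d ih =>
    intro s
    refine (ih s).trans ?_
    rw [h.substWt]
    exact Nat.mul_le_mul_left _ (Nat.le_mul_of_pos_right _ (Ctx.substWt_pos _ _))
  | oneI h => exact fun s => (Ctx.substWt_pos _ _).trans_eq (one_mul _).symm
  | oneE h d e ihd ihe =>
    intro s
    simp only [Tm.subst, Tm.wt, h.substWt]
    calc _ ≤ _ := Nat.mul_le_mul (Nat.mul_le_mul_left 2 (ihd s)) (ihe s)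
      _ = _ := by ring
  | lolliI d ih => exact fun s => (ih _).trans_eq (by rw [Ctx.substWt_liftSub]; rfl)
  | lolliE h d e ihd ihe =>
    intro s
    simp only [Tm.subst, Tm.wt, h.substWt]
    calc _ ≤ _ := Nat.mul_le_mul (Nat.mul_le_mul_left 2 (ihd s)) (ihe s)
      _ = _ := by ring
  | ampI d e ihd ihe =>
    intro s
    simp only [Tm.subst, Tm.wt, add_mul]
    exact add_le_add (ihd s) (ihe s)
  | ampE₁ h d e ihd ihe =>
    intro s
    simp only [Tm.subst, Tm.wt, h.substWt]
    calc _ ≤ _ := Nat.mul_le_mul (ihd s) (ihe _)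
      _ = _ := by rw [Ctx.substWt_liftSub]; ring
  | ampE₂ h d e ihd ihe =>
    intro s
    simp only [Tm.subst, Tm.wt, h.substWt]
    calc _ ≤ _ := Nat.mul_le_mul (ihd s) (ihe _)
      _ = _ := by rw [Ctx.substWt_liftSub]; ring
  | plusI₁ C d ih => exact ih
  | plusI₂ C d ih => exact ih
  | plusE h d e o ihd ihe iho =>
    intro s
    simp only [Tm.subst, Tm.wt, h.substWt]
    calc _ ≤ _ := Nat.mul_le_mul (ihd s) (add_le_add (ihe _) (iho _))
      _ = _ := by rw [Ctx.substWt_liftSub, Ctx.substWt_liftSub]; ring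
  | tensI h d e ihd ihe =>
    intro s
    simp only [Tm.subst, Tm.wt, h.substWt]
    calc _ ≤ _ := Nat.mul_le_mul (ihd s) (ihe _)
      _ = _ := by ring
  | tensE h d e ihd ihe =>
    intro s
    simp only [Tm.subst, Tm.wt, h.substWt]
    calc _ ≤ _ := Nat.mul_le_mul (Nat.mul_le_mul_left 2 (ihd s)) (ihe _)
      _ = _ := by rw [Ctx.substWt_liftSub, Ctx.substWt_liftSub]; ring
  | BI h d ih => exact fun s => Nat.le_mul_of_pos_right _ (Ctx.substWt_pos _ _)
  | BlolliE h d e ihd ihe =>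
    intro s
    simp only [Tm.subst, Tm.wt, h.substWt]
    calc _ ≤ _ := Nat.mul_le_mul (Nat.mul_le_mul_left 2 (ihd s)) (ihe s)
      _ = _ := by ring
  | Btens d ih => exact ih

theorem Der.wt_inst_le {f : Frag} {V M : Tm f} {S T : Prp f} (d : Der [some S] M T) :
    (Tm.inst V M).wt ≤ M.wt * V.wt :=
  (d.wt_subst_le _).trans_eq (congrArg (M.wt * ·) (mul_one V.wt))

theorem Der.wt_inst₂_le {f : Frag} {V W M : Tm f} {S₁ S₂ T : Prp f}
    (d : Der [some S₂, some S₁] M T) : (Tm.inst₂ V W M).wt ≤ M.wt * (W.wt * V.wt) :=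
  (d.wt_subst_le _).trans_eq (congrArg (fun x => M.wt * (W.wt * x)) (mul_one V.wt))

theorem IsSum.map_eq_sum {f : Frag} {E : Type} [AddCommMonoid E] (w : Tm f → E)
    (hw : ∀ M N, w (.add M N) = w M + w N) {l : List (Tm f)} {S : Tm f} (h : IsSum l S) :
    w S = (l.map w).sum := by
  refine IsSum.rec_add (p := fun l S => w S = (l.map w).sum) (fun M => by simp)
    (fun l S N _ ih => ?_) h
  rw [hw, ih]; simp

theorem IsSum.wt_eq {f : Frag} {X : Type} {l : List X} {a : X → Scal f} {g : X → Tm f} {S : Tm f}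
    (h : IsSum (l.map fun x => .smul (a x) (g x)) S) : S.wt = (l.map fun x => (g x).wt).sum := by
  rw [h.map_eq_sum Tm.wt fun _ _ => rfl, List.map_map]; rfl

theorem IsSum.cwt_eq {f : Frag} (k : ℕ) {X : Type} {l : List X} {a : X → Scal f} {g : X → Tm f}
    {S : Tm f} (h : IsSum (l.map fun x => .smul (a x) (g x)) S) :
    S.cwt k = (l.map fun x => cf k (a x) * (g x).cwt k).sum := by
  rw [h.map_eq_sum (Tm.cwt k) fun _ _ => rfl, List.map_map]; rfl

/-- Since `k ≤ c x`, one has `k c v² ≤ (c v)²`, and a sum of squares is at most the square of the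
sum. For this reason `cwt` squares the argument of the constructors that distribute over sums. -/
theorem mul_sum_le_sum_sq (k : ℕ) {X : Type} (l : List X) (c v : X → ℕ) (hc : ∀ x, k ≤ c x) :
    k * (l.map fun x => c x * v x ^ 2).sum ≤ (l.map fun x => c x * v x).sum ^ 2 := by
  induction l with
  | nil => simp
  | cons x l ih =>
    simp only [List.map_cons, List.sum_cons, mul_add]
    have : k * (c x * v x ^ 2) ≤ (c x * v x) ^ 2 := by
      calc k * (c x * v x ^ 2) ≤ c x * (c x * v x ^ 2) := Nat.mul_le_mul_right _ (hc x)
        _ = _ := by ring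
    calc _ ≤ (c x * v x) ^ 2 + (l.map fun x => c x * v x).sum ^ 2 := add_le_add this ih
      _ ≤ _ := by nlinarith [Nat.zero_le (c x * v x * (l.map fun x => c x * v x).sum)]

theorem IsSum.mul_cwt_le {f : Frag} {X : Type} {l : List X} {a : X → Scal f} {g : X → Tm f}
    {F : Tm f → Tm f} {S R : Tm f} (hS : IsSum (l.map fun x => .smul (a x) (g x)) S)
    (hR : IsSum (l.map fun x => .smul (a x) (F (g x))) R) {k c : ℕ}
    (hF : ∀ M, (F M).cwt k = M.cwt k ^ 2 * c) (hk : k ≤ 2) :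
    k * R.cwt k ≤ S.cwt k ^ 2 * c := by
  rw [hR.cwt_eq k, hS.cwt_eq k]
  calc _ = k * (l.map fun x => cf k (a x) * (g x).cwt k ^ 2).sum * c := by
        rw [mul_assoc, ← List.sum_map_mul_right]
        simp only [hF, mul_assoc]
    _ ≤ _ := Nat.mul_le_mul_right _ (mul_sum_le_sum_sq k l (fun x => cf k (a x))
        (fun x => (g x).cwt k) fun x => le_cf hk (a x))

theorem sum_flatMap_mul {X Y : Type} (l : List X) (k : List Y) (v : X → ℕ) (w : Y → ℕ) :
    (l.flatMap fun x => k.map fun y => v x * w y).sum = (l.map v).sum * (k.map w).sum := by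
  induction l with
  | nil => simp
  | cons x l ih => simp [ih, add_mul, List.sum_map_mul_left]

theorem sum_pos_of_ne_nil {X : Type} {l : List X} (hl : l ≠ []) {v : X → ℕ} (hv : ∀ x, 0 < v x) :
    0 < (l.map v).sum := by
  cases l with
  | nil => exact absurd rfl hl
  | cons x l => simp [hv x]

/-- The decrease of the measures in a step of cut reduction. -/
def Dec {f : Frag} (N M : Tm f) : Prop :=
  N.wt < M.wt ∨ N.wt = M.wt ∧ N.cwt 1 ≤ M.cwt 1 ∧ N.cwt 2 < M.cwt 2

theorem strictMono_sq : StrictMono fun x : ℕ => x ^ 2 := fun _ _ h => Nat.pow_lt_pow_left h two_ne_zero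

/-- A term constructor in which the measures are strictly increasing. -/
structure MeasureCtx {f g : Frag} (F : Tm f → Tm g) : Prop where
  wt : ∃ φ : ℕ → ℕ, StrictMono φ ∧ ∀ M, (F M).wt = φ M.wt
  cwt : ∀ k : ℕ, 0 < k → ∃ ψ : ℕ → ℕ, StrictMono ψ ∧ ∀ M, (F M).cwt k = ψ (M.cwt k)

namespace MeasureCtx

theorem addL {f : Frag} (N : Tm f) : MeasureCtx (.add · N) where
  wt := ⟨fun x => x + N.wt, strictMono_id.add_const _, fun _ => rfl⟩
  cwt k _ := ⟨fun x => x + N.cwt k, strictMono_id.add_const _, fun _ => rfl⟩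

theorem smul {f : Frag} (a : Scal f) : MeasureCtx (Tm.smul a) where
  wt := ⟨fun x => x, strictMono_id, fun _ => rfl⟩
  cwt k hk := ⟨fun x => cf k a * x, strictMono_id.const_mul (cf_pos hk a), fun _ => rfl⟩

theorem lam {f : Frag} : MeasureCtx (@Tm.lam f) where
  wt := ⟨fun x => x, strictMono_id, fun _ => rfl⟩
  cwt _ _ := ⟨fun x => x + 1, strictMono_id.add_const 1, fun _ => rfl⟩

theorem elimZero : MeasureCtx Tm.elimZero where
  wt := ⟨fun x => x, strictMono_id, fun _ => rfl⟩
  cwt _ _ := ⟨fun x => x, strictMono_id, fun _ => rfl⟩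

theorem elimOneL {f : Frag} (N : Tm f) : MeasureCtx (.elimOne · N) where
  wt := ⟨fun x => 2 * x * N.wt, (strictMono_id.const_mul two_pos).mul_const N.wt_pos, fun _ => rfl⟩
  cwt k hk := ⟨fun x => x * N.cwt k, strictMono_id.mul_const (N.cwt_pos hk), fun _ => rfl⟩

theorem elimOneR {f : Frag} (M : Tm f) : MeasureCtx (.elimOne M ·) where
  wt := ⟨fun x => 2 * M.wt * x, strictMono_id.const_mul (Nat.mul_pos two_pos M.wt_pos), fun _ => rfl⟩
  cwt k hk := ⟨fun x => M.cwt k * x, strictMono_id.const_mul (M.cwt_pos hk), fun _ => rfl⟩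

theorem appL {f : Frag} (N : Tm f) : MeasureCtx (.app · N) where
  wt := ⟨fun x => 2 * x * N.wt, (strictMono_id.const_mul two_pos).mul_const N.wt_pos, fun _ => rfl⟩
  cwt k hk := ⟨fun x => x * N.cwt k, strictMono_id.mul_const (N.cwt_pos hk), fun _ => rfl⟩

theorem appR {f : Frag} (M : Tm f) : MeasureCtx (.app M ·) where
  wt := ⟨fun x => 2 * M.wt * x, strictMono_id.const_mul (Nat.mul_pos two_pos M.wt_pos), fun _ => rfl⟩
  cwt k hk := ⟨fun x => M.cwt k * x, strictMono_id.const_mul (M.cwt_pos hk), fun _ => rfl⟩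

theorem pairL (N : Tm .pure) : MeasureCtx (.pair · N) where
  wt := ⟨fun x => x + N.wt, strictMono_id.add_const _, fun _ => rfl⟩
  cwt k _ := ⟨fun x => x + N.cwt k + 1, (strictMono_id.add_const _).add_const 1, fun _ => rfl⟩

theorem pairR (M : Tm .pure) : MeasureCtx (.pair M ·) where
  wt := ⟨fun x => M.wt + x, strictMono_id.const_add _, fun _ => rfl⟩
  cwt k _ := ⟨fun x => M.cwt k + x + 1, (strictMono_id.const_add _).add_const 1, fun _ => rfl⟩

theorem elimWith₁L (N : Tm .pure) : MeasureCtx (.elimWith₁ · N) where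
  wt := ⟨fun x => x * N.wt, strictMono_id.mul_const N.wt_pos, fun _ => rfl⟩
  cwt k hk := ⟨fun x => x * N.cwt k, strictMono_id.mul_const (N.cwt_pos hk), fun _ => rfl⟩

theorem elimWith₁R (M : Tm .pure) : MeasureCtx (.elimWith₁ M ·) where
  wt := ⟨fun x => M.wt * x, strictMono_id.const_mul M.wt_pos, fun _ => rfl⟩
  cwt k hk := ⟨fun x => M.cwt k * x, strictMono_id.const_mul (M.cwt_pos hk), fun _ => rfl⟩

theorem elimWith₂L (N : Tm .pure) : MeasureCtx (.elimWith₂ · N) where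
  wt := ⟨fun x => x * N.wt, strictMono_id.mul_const N.wt_pos, fun _ => rfl⟩
  cwt k hk := ⟨fun x => x * N.cwt k, strictMono_id.mul_const (N.cwt_pos hk), fun _ => rfl⟩

theorem elimWith₂R (M : Tm .pure) : MeasureCtx (.elimWith₂ M ·) where
  wt := ⟨fun x => M.wt * x, strictMono_id.const_mul M.wt_pos, fun _ => rfl⟩
  cwt k hk := ⟨fun x => M.cwt k * x, strictMono_id.const_mul (M.cwt_pos hk), fun _ => rfl⟩

theorem inl : MeasureCtx Tm.inl where
  wt := ⟨fun x => x, strictMono_id, fun _ => rfl⟩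
  cwt _ _ := ⟨fun x => x ^ 2, strictMono_sq, fun _ => rfl⟩

theorem inr : MeasureCtx Tm.inr where
  wt := ⟨fun x => x, strictMono_id, fun _ => rfl⟩
  cwt _ _ := ⟨fun x => x ^ 2, strictMono_sq, fun _ => rfl⟩

theorem elimPlus₁ (N O : Tm .mixed) : MeasureCtx (.elimPlus · N O) where
  wt := ⟨fun x => x * (N.wt + O.wt), strictMono_id.mul_const (Nat.add_pos_left N.wt_pos _), fun _ => rfl⟩
  cwt k hk := ⟨fun x => x ^ 2 * (N.cwt k + O.cwt k), strictMono_sq.mul_const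
    (Nat.add_pos_left (N.cwt_pos hk) _), fun _ => rfl⟩

theorem elimPlus₂ (M O : Tm .mixed) : MeasureCtx (.elimPlus M · O) where
  wt := ⟨fun x => M.wt * (x + O.wt), (strictMono_id.add_const _).const_mul M.wt_pos, fun _ => rfl⟩
  cwt k hk := ⟨fun x => M.cwt k ^ 2 * (x + O.cwt k),
    (strictMono_id.add_const _).const_mul (pow_pos (M.cwt_pos hk) 2), fun _ => rfl⟩

theorem elimPlus₃ (M N : Tm .mixed) : MeasureCtx (.elimPlus M N ·) where
  wt := ⟨fun x => M.wt * (N.wt + x), (strictMono_id.const_add _).const_mul M.wt_pos, fun _ => rfl⟩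
  cwt k hk := ⟨fun x => M.cwt k ^ 2 * (N.cwt k + x),
    (strictMono_id.const_add _).const_mul (pow_pos (M.cwt_pos hk) 2), fun _ => rfl⟩

theorem tensL {f : Frag} (N : Tm f) : MeasureCtx (.tens · N) where
  wt := ⟨fun x => x * N.wt, strictMono_id.mul_const N.wt_pos, fun _ => rfl⟩
  cwt k hk := ⟨fun x => x * N.cwt k, strictMono_id.mul_const (N.cwt_pos hk), fun _ => rfl⟩

theorem tensR {f : Frag} (M : Tm f) : MeasureCtx (.tens M ·) where
  wt := ⟨fun x => M.wt * x, strictMono_id.const_mul M.wt_pos, fun _ => rfl⟩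
  cwt k hk := ⟨fun x => M.cwt k * x, strictMono_id.const_mul (M.cwt_pos hk), fun _ => rfl⟩

theorem elimTensL {f : Frag} (N : Tm f) : MeasureCtx (.elimTens · N) where
  wt := ⟨fun x => 2 * x * N.wt, (strictMono_id.const_mul two_pos).mul_const N.wt_pos, fun _ => rfl⟩
  cwt k hk := ⟨fun x => x ^ 2 * N.cwt k, strictMono_sq.mul_const (N.cwt_pos hk), fun _ => rfl⟩

theorem elimTensR {f : Frag} (M : Tm f) : MeasureCtx (.elimTens M ·) where
  wt := ⟨fun x => 2 * M.wt * x, strictMono_id.const_mul (Nat.mul_pos two_pos M.wt_pos), fun _ => rfl⟩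
  cwt k hk := ⟨fun x => M.cwt k ^ 2 * x, strictMono_id.const_mul (pow_pos (M.cwt_pos hk) 2), fun _ => rfl⟩

theorem B : MeasureCtx Tm.B where
  wt := ⟨fun x => 3 * x ^ 2, strictMono_sq.const_mul three_pos, fun _ => rfl⟩
  cwt _ _ := ⟨fun x => x ^ 2, strictMono_sq, fun _ => rfl⟩

theorem tau : MeasureCtx Tm.tau where
  wt := ⟨fun x => x, strictMono_id, fun _ => rfl⟩
  cwt _ _ := ⟨fun x => x ^ 2, strictMono_sq, fun _ => rfl⟩

end MeasureCtx

theorem Dec.map {f g : Frag} {N M : Tm f} (h : Dec N M) {F : Tm f → Tm g} (hF : MeasureCtx F) :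
    Dec (F N) (F M) := by
  obtain ⟨φ, mφ, hφ⟩ := hF.wt
  obtain ⟨ψ₁, mψ₁, hψ₁⟩ := hF.cwt 1 one_pos
  obtain ⟨ψ₂, mψ₂, hψ₂⟩ := hF.cwt 2 two_pos
  unfold Dec
  rw [hφ, hφ, hψ₁, hψ₁, hψ₂, hψ₂]
  rcases h with h | ⟨h₁, h₂, h₃⟩
  · exact .inl (mφ h)
  · exact .inr ⟨congrArg φ h₁, mψ₁.monotone h₂, mψ₂ h₃⟩

/-- The factor `2`, supplied by `mul_sum_le_sum_sq` at `k = 2`, yields a strict decrease because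
measures are positive. -/
theorem Dec.of_comm_le {f : Frag} {N M : Tm f} (h : N.wt = M.wt) (h₁ : N.cwt 1 ≤ M.cwt 1)
    (h₂ : 2 * N.cwt 2 ≤ M.cwt 2) : Dec N M :=
  .inr ⟨h, h₁, by have := N.cwt_pos two_pos; omega⟩

theorem Tm.wt_one_lt {f : Frag} (a : Scal f) (M : Tm f) :
    (Tm.smul a M).wt < (Tm.elimOne (.smul a .star) M).wt := by
  simp only [Tm.wt]
  have := M.wt_pos
  omega

theorem Tm.wt_cast_lt (v w : Tm .pure) :
    (Tm.B (.tens v w)).wt < (Tm.tau (.tens (.B v) (.B w))).wt := by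
  simp only [Tm.wt]
  nlinarith [Nat.mul_pos (pow_pos v.wt_pos 2) (pow_pos w.wt_pos 2)]

theorem Der.wt_beta_lt {f : Frag} {S T : Prp f} {V M : Tm f} (d : Der [some S] M T) :
    (Tm.inst V M).wt < (Tm.app (.lam M) V).wt := by
  refine d.wt_inst_le.trans_lt ?_
  simp only [Tm.wt]
  nlinarith [Nat.mul_pos M.wt_pos V.wt_pos]

theorem Der.wt_with₁_lt {S T : Prp .pure} {v w t : Tm .pure} (d : Der [some S] t T) :
    (Tm.inst v t).wt < (Tm.elimWith₁ (.pair v w) t).wt := by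
  refine d.wt_inst_le.trans_lt ?_
  simp only [Tm.wt]
  nlinarith [Nat.mul_pos t.wt_pos w.wt_pos]

theorem Der.wt_with₂_lt {S T : Prp .pure} {v w t : Tm .pure} (d : Der [some S] t T) :
    (Tm.inst w t).wt < (Tm.elimWith₂ (.pair v w) t).wt := by
  refine d.wt_inst_le.trans_lt ?_
  simp only [Tm.wt]
  nlinarith [Nat.mul_pos t.wt_pos v.wt_pos]

theorem Der.wt_plusL_lt {S T : Prp .mixed} {v m n : Tm .mixed} (d : Der [some S] m T) :
    (Tm.inst v m).wt < (Tm.elimPlus (.inl v) m n).wt := by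
  refine d.wt_inst_le.trans_lt ?_
  simp only [Tm.wt]
  nlinarith [Nat.mul_pos v.wt_pos n.wt_pos]

theorem Der.wt_plusR_lt {S T : Prp .mixed} {v m n : Tm .mixed} (d : Der [some S] n T) :
    (Tm.inst v n).wt < (Tm.elimPlus (.inr v) m n).wt := by
  refine d.wt_inst_le.trans_lt ?_
  simp only [Tm.wt]
  nlinarith [Nat.mul_pos v.wt_pos m.wt_pos]

theorem Der.wt_tensor_lt {f : Frag} {S S' T : Prp f} {V W M : Tm f}
    (d : Der [some S, some S'] M T) :
    (Tm.inst₂ V W M).wt < (Tm.elimTens (.tens V W) M).wt := by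
  refine d.wt_inst₂_le.trans_lt ?_
  simp only [Tm.wt]
  nlinarith [Nat.mul_pos M.wt_pos (Nat.mul_pos V.wt_pos W.wt_pos)]

/-- A pair of bodies of weights `v` and `w` contributes `18 v² w²` to the application and `12 v² w²`
to the result. -/
theorem IsSum.wt_app_B_lt {l k : List (Scal .mixed × Tm .pure)} {S S' R : Tm .mixed}
    (hS : IsSum (l.map fun x => .smul x.1 (.B x.2)) S)
    (hS' : IsSum (k.map fun y => .smul y.1 (.B y.2)) S')
    (hR : IsSum (l.flatMap fun x => k.map fun y =>
      .smul (x.1 * y.1) (.B (.app x.2 y.2))) R) : R.wt < (Tm.app S S').wt := by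
  have h₁ : R.wt = (l.map fun x => x.2.wt ^ 2).sum * (k.map fun y => 12 * y.2.wt ^ 2).sum := by
    rw [hR.map_eq_sum Tm.wt fun _ _ => rfl, List.map_flatMap, ← sum_flatMap_mul]
    simp only [List.map_map]
    refine congrArg List.sum (congrArg (List.flatMap · l) (funext fun x => ?_))
    refine List.map_congr_left fun y _ => ?_
    simp only [Function.comp_apply, Tm.wt]; ring
  have h₂ : S.wt = 3 * (l.map fun x => x.2.wt ^ 2).sum := by
    rw [hS.wt_eq, ← List.sum_map_mul_left]; rfl
  have h₃ : S'.wt = 3 * (k.map fun x => x.2.wt ^ 2).sum := by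
    rw [hS'.wt_eq, ← List.sum_map_mul_left]; rfl
  rw [Tm.wt, h₁, h₂, h₃, List.sum_map_mul_left]
  have h₄ := sum_pos_of_ne_nil (l := l) (by rintro rfl; exact hS)
    fun x : Scal .mixed × Tm .pure => pow_pos x.2.wt_pos 2
  have h₅ := sum_pos_of_ne_nil (l := k) (by rintro rfl; exact hS')
    fun x : Scal .mixed × Tm .pure => pow_pos x.2.wt_pos 2
  nlinarith [Nat.mul_pos h₄ h₅]

/-- This concerns every step, not only well-chosen ones, because clause (iii) of `↪` is not
available while a step `→` exists. Typing is used for the linearity of the substituted variables. -/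
theorem Red.dec {f : Frag} {M N : Tm f} (h : Red M N) :
    ∀ {T : Prp f} (_ : Der [] M T), Dec N M := by
  induction h with
  | one a M =>
    intro T d
    exact .inl (Tm.wt_one_lt a M)
  | @beta _ M V hV =>
    intro T d
    left
    cases d with
    | lolliE h d k =>
      cases h
      cases d with
      | lolliI d =>
        exact d.wt_beta_lt
    | BlolliE h d k => cases h; cases d
  | @with₁ v w t hv hw =>
    intro T d
    left
    cases d with
    | ampE₁ h d k =>
      cases h
      exact k.wt_with₁_lt
  | @with₂ v w t hv hw =>
    intro T d
    left
    cases d with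
    | ampE₂ h d k =>
      cases h
      exact k.wt_with₂_lt
  | @plusL v m n hv =>
    intro T d
    left
    cases d with
    | plusE h d k o =>
      cases h
      exact k.wt_plusL_lt
  | @plusR v m n hv =>
    intro T d
    left
    cases d with
    | plusE h d k o =>
      cases h
      exact o.wt_plusR_lt
  | @tensor _ V W M hV hW =>
    intro T d
    left
    cases d with
    | tensE h d k =>
      cases h
      exact k.wt_tensor_lt
  | commTop a =>
    intro T d
    have := cf_pos one_pos a
    have := le_cf (k := 2) le_rfl a
    exact .of_comm_le rfl (by simp only [Tm.cwt]; omega) (by simp only [Tm.cwt]; omega)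
  | @commLam f l S R hd hS hR =>
    intro T d
    have hl : l ≠ [] := by rintro rfl; exact hS
    have h₀ : ∀ k, S.cwt k = R.cwt k + (l.map fun x => cf k x.1).sum := fun k => by
      rw [hS.cwt_eq k, hR.cwt_eq k, ← List.sum_map_add]
      exact congrArg _ (List.map_congr_left fun x _ => mul_add_one _ _)
    have h₁ := sum_pos_of_ne_nil hl fun x : Scal f × Tm f => cf_pos one_pos x.1
    have h₂ : 2 ≤ (l.map fun x => cf 2 x.1).sum := by
      cases l with
      | nil => exact absurd rfl hl
      | cons x l => have := le_cf (k := 2) le_rfl x.1; simp; omega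
    refine .inr ⟨?_, ?_, ?_⟩
    · rw [hS.wt_eq, Tm.wt, hR.wt_eq]; rfl
    · rw [h₀, Tm.cwt]; omega
    · rw [h₀, Tm.cwt]; omega
  | @commPair l S R₁ R₂ hv hd hS hR₁ hR₂ =>
    intro T d
    have hl : l ≠ [] := by rintro rfl; exact hS
    have h₀ : ∀ k, S.cwt k = R₁.cwt k + R₂.cwt k + (l.map fun x => cf k x.1).sum := fun k => by
      rw [hS.cwt_eq k, hR₁.cwt_eq k, hR₂.cwt_eq k, ← List.sum_map_add, ← List.sum_map_add]
      exact congrArg _ (List.map_congr_left fun x _ => by simp only [Tm.cwt]; ring)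
    have h₁ := sum_pos_of_ne_nil hl fun x : Scal .pure × Tm .pure × Tm .pure => cf_pos one_pos x.1
    have h₂ : 2 ≤ (l.map fun x => cf 2 x.1).sum := by
      cases l with
      | nil => exact absurd rfl hl
      | cons x l => have := le_cf (k := 2) le_rfl x.1; simp; omega
    refine .inr ⟨?_, ?_, ?_⟩
    · rw [hS.wt_eq, Tm.wt, hR₁.wt_eq, hR₂.wt_eq, ← List.sum_map_add]; rfl
    · rw [h₀, Tm.cwt]; omega
    · rw [h₀, Tm.cwt]; omega
  | @commPlus l o s S R hv hd hS hR =>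
    intro T d
    have key := fun k => hS.mul_cwt_le (k := k) (F := fun M => .elimPlus M o s) hR fun M => rfl
    refine .of_comm_le ?_ ((one_mul _).ge.trans (key 1 (by omega))) (key 2 le_rfl)
    rw [hR.wt_eq, Tm.wt, hS.wt_eq, ← List.sum_map_mul_right]; rfl
  | @commTens f l M S R hv hd hS hR =>
    intro T d
    have key := fun k => hS.mul_cwt_le (k := k) (F := fun S => .elimTens S M) hR fun M => rfl
    refine .of_comm_le ?_ ((one_mul _).ge.trans (key 1 (by omega))) (key 2 le_rfl)
    rw [hR.wt_eq, Tm.wt, hS.wt_eq, mul_assoc, ← List.sum_map_mul_right, ← List.sum_map_mul_left]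
    simp only [Tm.wt, mul_assoc]
  | @commInl l S R hv hd hS hR =>
    intro T d
    have key := fun k => hS.mul_cwt_le (k := k) hR fun M => (mul_one (M.cwt k ^ 2)).symm
    simp only [mul_one] at key
    refine .of_comm_le ?_ ((one_mul _).ge.trans (key 1 (by omega))) (key 2 le_rfl)
    rw [hR.wt_eq, Tm.wt, hS.wt_eq]; rfl
  | @commInr l S R hv hd hS hR =>
    intro T d
    have key := fun k => hS.mul_cwt_le (k := k) hR fun M => (mul_one (M.cwt k ^ 2)).symm
    simp only [mul_one] at key
    refine .of_comm_le ?_ ((one_mul _).ge.trans (key 1 (by omega))) (key 2 le_rfl)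
    rw [hR.wt_eq, Tm.wt, hS.wt_eq]; rfl
  | @commTau l S R hv hd hS hR =>
    intro T d
    have key := fun k => hS.mul_cwt_le (k := k) hR fun M => (mul_one (M.cwt k ^ 2)).symm
    simp only [mul_one] at key
    refine .of_comm_le ?_ ((one_mul _).ge.trans (key 1 (by omega))) (key 2 le_rfl)
    rw [hR.wt_eq, Tm.wt, hS.wt_eq]; rfl
  | @cast v w hv hw =>
    intro T d
    exact .inl (Tm.wt_cast_lt v w)
  | @commB a v ha hv =>
    intro T d
    have key : ∀ k ≤ 2, 2 * (Tm.smul a.normSq (.B v)).cwt k ≤ (Tm.B (.smul a v)).cwt k :=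
      fun k hk => by
        have := cf_le_two hk a.normSq
        simp only [Tm.cwt, cf_of_ne k ha]
        nlinarith [Nat.mul_le_mul_right (v.cwt k ^ 2) this]
    have := key 1 (by omega)
    exact .of_comm_le rfl (by omega) (key 2 le_rfl)
  | @commBapp l k S S' R hl hk hdl hdk hS hS' hR =>
    intro T d
    exact .inl (IsSum.wt_app_B_lt hS hS' hR)
  | addL N h ih =>
    intro T d
    cases d with
    | sum d k => exact (ih d).map (.addL N)
  | smul a h ih =>
    intro T d
    cases d with
    | prod _ d => exact (ih d).map (.smul a)
  | elimZero h ih =>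
    intro T d
    cases d with
    | zeroE _ s d => cases s; exact (ih d).map (.elimZero)
  | elimOneL N h ih =>
    intro T d
    cases d with
    | oneE s d k => cases s; exact (ih d).map (.elimOneL N)
  | appL N h ih =>
    intro T d
    cases d with
    | lolliE s d k => cases s; exact (ih d).map (.appL _)
    | BlolliE s d k => cases s; exact (ih d).map (.appL _)
  | appR hV h ih =>
    intro T d
    cases d with
    | lolliE s k d => cases s; exact (ih d).map (.appR _)
    | BlolliE s k d => cases s; exact (ih d).map (.appR _)
  | pairL N h ih =>
    intro T d
    cases d with
    | ampI d k => exact (ih d).map (.pairL N)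
  | pairR hv h ih =>
    intro T d
    cases d with
    | ampI k d => exact (ih d).map (.pairR _)
  | elimWith₁ N h ih =>
    intro T d
    cases d with
    | ampE₁ s d k => cases s; exact (ih d).map (.elimWith₁L N)
  | elimWith₂ N h ih =>
    intro T d
    cases d with
    | ampE₂ s d k => cases s; exact (ih d).map (.elimWith₂L N)
  | inl h ih =>
    intro T d
    cases d with
    | plusI₁ _ d => exact (ih d).map (.inl)
  | inr h ih =>
    intro T d
    cases d with
    | plusI₂ _ d => exact (ih d).map (.inr)
  | elimPlus N O h ih =>
    intro T d
    cases d with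
    | plusE s d k k' => cases s; exact (ih d).map (.elimPlus₁ N O)
  | tensL N h ih =>
    intro T d
    cases d with
    | tensI s d k => cases s; exact (ih d).map (.tensL N)
  | tensR hV h ih =>
    intro T d
    cases d with
    | tensI s k d => cases s; exact (ih d).map (.tensR _)
  | elimTens N h ih =>
    intro T d
    cases d with
    | tensE s d k => cases s; exact (ih d).map (.elimTensL N)
  | B h ih =>
    intro T d
    cases d with
    | BI _ d => exact (ih d).map (.B)
  | tau h ih =>
    intro T d
    cases d with
    | Btens d => exact (ih d).map (.tau)

/-! ## Terms modulo algebraic equivalence form a module -/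

section Module

variable {f : Frag}

theorem derivable_add {Γ : Ctx f} {T : Prp f} {M N : Tm f} :
    Derivable Γ (.add M N) T ↔ Derivable Γ M T ∧ Derivable Γ N T := by
  constructor
  · rintro ⟨d⟩
    cases d with
    | sum d e => exact ⟨⟨d⟩, ⟨e⟩⟩
  · rintro ⟨⟨d⟩, ⟨e⟩⟩
    exact ⟨.sum d e⟩

variable {Γ : Ctx f} {T : Prp f} {M M' N N' : Tm f}

theorem AlgEq.add (h : AlgEq Γ T M M') (k : AlgEq Γ T N N') (hM : Derivable Γ M T)
    (hN : Derivable Γ N T) : AlgEq Γ T (.add M N) (.add M' N') := by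
  obtain ⟨dN⟩ := hN
  obtain ⟨dM'⟩ := h.derivable_iff.1 hM
  exact (h.map (.add · N) (.addL N) fun d => ⟨.sum d dN⟩).trans
    (k.map (.add M') (.addR M') fun d => ⟨.sum dM' d⟩)

theorem AlgEq.smul (a : Scal f) (h : AlgEq Γ T M M') : AlgEq Γ T (.smul a M) (.smul a M') :=
  h.map (.smul a) (.smul a) fun d => ⟨.prod a d⟩

/-- A term with coefficient `0` is neutral for sums. -/
theorem algEq_add_zero (hM : Derivable Γ M T) (hN : Derivable Γ N T) :
    AlgEq Γ T (.add M (.smul 0 N)) M := by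
  have h0 := derivable_smul (a := (0 : Scal f)).2 hN
  by_cases h : ∀ M', M ≠ .smul 0 M'
  · exact (AlgStep.add_zero M N h).algEq (derivable_add.2 ⟨hM, h0⟩)
  · push Not at h
    obtain ⟨M', rfl⟩ := h
    -- The generating rule excludes `0 • M'`. But `0 • M'` is equivalent to `0 • M' + 0 • M'`, which
    -- is a sum and so not of the excluded form; from it `0 • N` may be dropped.
    have e : AlgEq Γ T (.add (.smul 0 M') (.smul 0 M')) (.smul 0 M') := by
      have := (AlgStep.add_smul 0 0 M').algEq (derivable_add.2 ⟨hM, hM⟩)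
      rwa [_root_.add_zero] at this
    refine (e.symm.add (.refl (.smul 0 N)) hM h0).trans (AlgEq.trans ?_ e)
    exact (AlgStep.add_zero _ N fun _ => by simp).algEq
      (derivable_add.2 ⟨derivable_add.2 ⟨hM, hM⟩, h0⟩)

/-- Both terms are neutral for sums, so each is equivalent to `0 • M + 0 • N`. Hence the zero of the
module does not depend on a representative. -/
theorem algEq_zero_smul (hM : Derivable Γ M T) (hN : Derivable Γ N T) :
    AlgEq Γ T (.smul 0 M) (.smul 0 N) := by
  have hM0 := derivable_smul (a := (0 : Scal f)).2 hM
  have hN0 := derivable_smul (a := (0 : Scal f)).2 hN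
  exact ((algEq_add_zero hM0 hN).symm.trans
    ((AlgStep.add_comm _ _).algEq (derivable_add.2 ⟨hM0, hN0⟩))).trans (algEq_add_zero hN0 hM)

variable (Γ T) in
/-- The terms of a judgement. -/
def TmOf : Type := {M : Tm f // Derivable Γ M T}

instance TmOf.setoid : Setoid (TmOf Γ T) where
  r M N := AlgEq Γ T M.1 N.1
  iseqv := ⟨fun _ => .refl _, .symm, .trans⟩

variable (Γ T) in
/-- The terms of a judgement, modulo algebraic equivalence. -/
def TmMod : Type := Quotient (TmOf.setoid (Γ := Γ) (T := T))

def TmMod.mk (M : Tm f) (h : Derivable Γ M T) : TmMod Γ T := Quotient.mk _ ⟨M, h⟩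

theorem TmMod.mk_eq {h : Derivable Γ M T} {k : Derivable Γ N T} :
    TmMod.mk M h = TmMod.mk N k ↔ AlgEq Γ T M N := Quotient.eq

theorem TmMod.ind {p : TmMod Γ T → Prop} (h : ∀ M hM, p (.mk M hM)) (x : TmMod Γ T) : p x :=
  Quotient.ind (fun M => h M.1 M.2) x

instance : Add (TmMod Γ T) :=
  ⟨Quotient.map₂ (fun M N => ⟨.add M.1 N.1, derivable_add.2 ⟨M.2, N.2⟩⟩)
    fun M _ h N _ k => AlgEq.add h k M.2 N.2⟩

instance : SMul (Scal f) (TmMod Γ T) :=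
  ⟨fun a => Quotient.map (fun M => ⟨.smul a M.1, derivable_smul.2 M.2⟩) fun _ _ h => h.smul a⟩

/-- The syntax has no zero term; zero is the class of `0 • M` for an arbitrary term `M` of the
judgement, which must therefore have one. -/
noncomputable instance [Nonempty (TmOf Γ T)] : Zero (TmMod Γ T) :=
  ⟨.mk (.smul 0 (Classical.arbitrary (TmOf Γ T)).1)
    (derivable_smul.2 (Classical.arbitrary (TmOf Γ T)).2)⟩

theorem TmMod.mk_add (hM : Derivable Γ M T) (hN : Derivable Γ N T) :
    TmMod.mk (.add M N) (derivable_add.2 ⟨hM, hN⟩) = .mk M hM + .mk N hN := rfl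

theorem TmMod.mk_smul (a : Scal f) (hM : Derivable Γ M T) :
    TmMod.mk (.smul a M) (derivable_smul.2 hM) = a • .mk M hM := rfl

theorem TmMod.zero_smul [Nonempty (TmOf Γ T)] (x : TmMod Γ T) : (0 : Scal f) • x = 0 := by
  induction x using TmMod.ind with
  | h M hM => exact TmMod.mk_eq.2 (algEq_zero_smul hM (Classical.arbitrary (TmOf Γ T)).2)

noncomputable instance [Nonempty (TmOf Γ T)] : AddCommMonoid (TmMod Γ T) where
  add_assoc x y z := by
    induction x using TmMod.ind with | h M hM
    induction y using TmMod.ind with | h N hN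
    induction z using TmMod.ind with | h L hL
    exact TmMod.mk_eq.2 ((AlgStep.add_assoc M N L).algEq
      (derivable_add.2 ⟨hM, derivable_add.2 ⟨hN, hL⟩⟩)).symm
  add_comm x y := by
    induction x using TmMod.ind with | h M hM
    induction y using TmMod.ind with | h N hN
    exact TmMod.mk_eq.2 ((AlgStep.add_comm M N).algEq (derivable_add.2 ⟨hM, hN⟩))
  zero_add x := by
    induction x using TmMod.ind with | h M hM
    have hN := (Classical.arbitrary (TmOf Γ T)).2
    exact TmMod.mk_eq.2 (((AlgStep.add_comm _ M).algEq
      (derivable_add.2 ⟨derivable_smul.2 hN, hM⟩)).trans (algEq_add_zero hM hN))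
  add_zero x := by
    induction x using TmMod.ind with | h M hM
    exact TmMod.mk_eq.2 (algEq_add_zero hM (Classical.arbitrary (TmOf Γ T)).2)
  nsmul := nsmulRec

noncomputable instance [Nonempty (TmOf Γ T)] : Module (Scal f) (TmMod Γ T) where
  one_smul x := by
    induction x using TmMod.ind with | h M hM
    exact TmMod.mk_eq.2 ((AlgStep.one_smul M).algEq (derivable_smul.2 hM))
  mul_smul a b x := by
    induction x using TmMod.ind with | h M hM
    exact TmMod.mk_eq.2 ((AlgStep.smul_smul a b M).algEq
      (derivable_smul.2 (derivable_smul.2 hM))).symm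
  smul_zero a := by
    have hN := (Classical.arbitrary (TmOf Γ T)).2
    refine TmMod.mk_eq.2 (((AlgStep.smul_smul a 0 _).algEq
      (derivable_smul.2 (derivable_smul.2 hN))).trans ?_)
    rw [mul_zero]
    exact .refl _
  smul_add a x y := by
    induction x using TmMod.ind with | h M hM
    induction y using TmMod.ind with | h N hN
    exact TmMod.mk_eq.2 ((AlgStep.smul_add a M N).algEq
      (derivable_smul.2 (derivable_add.2 ⟨hM, hN⟩)))
  add_smul a b x := by
    induction x using TmMod.ind with | h M hM
    exact TmMod.mk_eq.2 ((AlgStep.add_smul a b M).algEq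
      (derivable_add.2 ⟨derivable_smul.2 hM, derivable_smul.2 hM⟩)).symm
  zero_smul := TmMod.zero_smul

open Classical in
variable (Γ T) in
/-- The class of a term. -/
noncomputable def cls [Nonempty (TmOf Γ T)] (M : Tm f) : TmMod Γ T :=
  if h : Derivable Γ M T then .mk M h else 0

theorem cls_eq_mk [Nonempty (TmOf Γ T)] (h : Derivable Γ M T) : cls Γ T M = .mk M h := dif_pos h

theorem cls_eq_iff [Nonempty (TmOf Γ T)] (hM : Derivable Γ M T) (hN : Derivable Γ N T) :
    cls Γ T M = cls Γ T N ↔ AlgEq Γ T M N := by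
  rw [cls_eq_mk hM, cls_eq_mk hN, TmMod.mk_eq]

theorem cls_add [Nonempty (TmOf Γ T)] (hM : Derivable Γ M T) (hN : Derivable Γ N T) :
    cls Γ T (.add M N) = cls Γ T M + cls Γ T N := by
  rw [cls_eq_mk hM, cls_eq_mk hN, cls_eq_mk (derivable_add.2 ⟨hM, hN⟩), TmMod.mk_add]

theorem cls_smul [Nonempty (TmOf Γ T)] (a : Scal f) (hM : Derivable Γ M T) :
    cls Γ T (.smul a M) = a • cls Γ T M := by
  rw [cls_eq_mk hM, cls_eq_mk (derivable_smul.2 hM), TmMod.mk_smul]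

theorem IsSum.cls_eq [Nonempty (TmOf Γ T)] {l : List (Tm f)} {S : Tm f} (h : IsSum l S) :
    Derivable Γ S T → cls Γ T S = (l.map (cls Γ T)).sum := by
  refine IsSum.rec_add (p := fun l S => Derivable Γ S T → cls Γ T S = (l.map (cls Γ T)).sum)
    (fun M _ => by simp) (fun l S N _ ih hd => ?_) h
  obtain ⟨hS, hN⟩ := derivable_add.1 hd
  rw [cls_add hS hN, ih hS]
  simp

theorem IsSum.cls_smul_eq [Nonempty (TmOf Γ T)] {X : Type} {l : List X} {a : X → Scal f}
    {g : X → Tm f} {S : Tm f} (h : IsSum (l.map fun x => .smul (a x) (g x)) S)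
    (hd : ∀ x ∈ l, Derivable Γ (g x) T) :
    cls Γ T S = (l.map fun x => a x • cls Γ T (g x)).sum := by
  rw [h.cls_eq (h.derivable_smul.2 hd), List.map_map]
  exact congrArg _ (List.map_congr_left fun x hx => cls_smul _ (hd x hx))

end Module

/-! ## Linear combinations of base forms -/

section LinComb

variable {f : Frag} {Γ : Ctx f} {T : Prp f}

/-- Lists that represent the same element of every module. -/
def SameSum (l l' : List (Scal f × Tm f)) : Prop :=
  ∀ (E : Type) [AddCommMonoid E] [Module (Scal f) E] (c : Tm f → E),
    (l.map fun x => x.1 • c x.2).sum = (l'.map fun x => x.1 • c x.2).sum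

/-- Terms modulo `⇆` form a module, so an identity of linear combinations valid in all modules holds
between the corresponding sums. Rearrangements of sums thus need no explicit chain of algebraic
steps. -/
theorem SameSum.algEq {l l' : List (Scal f × Tm f)} (h : SameSum l l')
    (hl : ∀ x ∈ l, Derivable Γ x.2 T) (hl' : ∀ x ∈ l', Derivable Γ x.2 T) {S S' : Tm f}
    (hS : IsSum (l.map fun x => .smul x.1 x.2) S)
    (hS' : IsSum (l'.map fun x => .smul x.1 x.2) S') : AlgEq Γ T S S' := by
  have dS : Derivable Γ S T := hS.derivable_smul.2 hl
  have : Nonempty (TmOf Γ T) := ⟨⟨S, dS⟩⟩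
  rw [← cls_eq_iff dS (hS'.derivable_smul.2 hl'), hS.cls_smul_eq hl, hS'.cls_smul_eq hl', h]

theorem SameSum.refl (l : List (Scal f × Tm f)) : SameSum l l := fun _ _ _ _ => rfl

theorem SameSum.trans {l l' l'' : List (Scal f × Tm f)} (h : SameSum l l') (k : SameSum l' l'') :
    SameSum l l'' := fun E _ _ c => (h E c).trans (k E c)

theorem SameSum.of_perm {l l' : List (Scal f × Tm f)} (h : l.Perm l') : SameSum l l' :=
  fun _ _ _ _ => (h.map _).sum_eq

/-- Lists of pairwise distinct terms with coefficients that are all nonzero, or with one term with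
coefficient zero. -/
structure GoodList (l : List (Scal f × Tm f)) : Prop where
  ne_nil : l ≠ []
  nodup : (l.map Prod.snd).Nodup
  coef : (∀ x ∈ l, x.1 ≠ 0) ∨ ∃ b, l = [(0, b)]

/-- `l'` is obtained from `l` by merging summands. -/
structure Merges (l l' : List (Scal f × Tm f)) : Prop where
  sum : SameSum l l'
  mem : ∀ x ∈ l', ∃ y ∈ l, y.2 = x.2
  wt : ∀ w : Tm f → ℕ, (l'.map fun x => w x.2).sum ≤ (l.map fun x => w x.2).sum
  cwt : ∀ w : Tm f → ℕ, (l'.map fun x => cf 1 x.1 * w x.2).sum ≤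
    (l.map fun x => cf 1 x.1 * w x.2).sum

theorem Merges.refl (l : List (Scal f × Tm f)) : Merges l l :=
  ⟨SameSum.refl l, fun x hx => ⟨x, hx, rfl⟩, fun _ => le_rfl, fun _ => le_rfl⟩

theorem Merges.trans {l l' l'' : List (Scal f × Tm f)} (h : Merges l l') (k : Merges l' l'') :
    Merges l l'' where
  sum := SameSum.trans h.sum k.sum
  mem x hx := by
    obtain ⟨y, hy, e⟩ := k.mem x hx
    obtain ⟨z, hz, e'⟩ := h.mem y hy
    exact ⟨z, hz, e'.trans e⟩
  wt w := (k.wt w).trans (h.wt w)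
  cwt w := (k.cwt w).trans (h.cwt w)

theorem Merges.cons (x : Scal f × Tm f) {l l' : List (Scal f × Tm f)} (h : Merges l l') :
    Merges (x :: l) (x :: l') where
  sum E _ _ c := by simp only [List.map_cons, List.sum_cons, h.sum E c]
  mem y hy := by
    rcases List.mem_cons.1 hy with rfl | hy
    · exact ⟨_, List.mem_cons_self, rfl⟩
    · obtain ⟨z, hz, e⟩ := h.mem y hy
      exact ⟨z, List.mem_cons_of_mem _ hz, e⟩
  wt w := by simpa using h.wt w
  cwt w := by simpa using h.cwt w

theorem Merges.of_perm {l l' : List (Scal f × Tm f)} (h : l.Perm l') : Merges l l' where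
  sum := SameSum.of_perm h
  mem x hx := ⟨x, h.mem_iff.2 hx, rfl⟩
  wt _ := (h.map _).sum_eq.ge
  cwt _ := (h.map _).sum_eq.ge

theorem Merges.add (a b : Scal f) (M : Tm f) (l : List (Scal f × Tm f)) :
    Merges ((a, M) :: (b, M) :: l) ((a + b, M) :: l) where
  sum E _ _ c := by simp only [List.map_cons, List.sum_cons, add_smul, add_assoc]
  mem y hy := by
    rcases List.mem_cons.1 hy with rfl | hy
    · exact ⟨_, List.mem_cons_self, rfl⟩
    · exact ⟨y, by simp [hy], rfl⟩
  wt w := by simp only [List.map_cons, List.sum_cons]; omega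
  cwt w := by
    have := Nat.mul_le_mul_right (w M) (cf_add_le a b)
    simp only [List.map_cons, List.sum_cons]
    rw [add_mul] at this
    omega

theorem Merges.zero_cons (M : Tm f) {l : List (Scal f × Tm f)} : Merges ((0, M) :: l) l where
  sum E _ _ c := by simp
  mem y hy := ⟨y, by simp [hy], rfl⟩
  wt _ := by simp
  cwt _ := by simp

/-- The merger of the summands with the same term. -/
theorem exists_goodList (l : List (Scal f × Tm f)) (hl : l ≠ []) :
    ∃ l', GoodList l' ∧ Merges l l' := by
  classical
  have single : ∀ x : Scal f × Tm f, GoodList [x] := fun x => ⟨by simp, by simp, by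
    by_cases ha : x.1 = 0
    · exact .inr ⟨x.2, by rw [← ha]⟩
    · exact .inl (by simpa using ha)⟩
  induction l with
  | nil => exact absurd rfl hl
  | cons x l ih =>
    obtain ⟨a, b⟩ := x
    by_cases hl' : l = []
    · subst hl'
      exact ⟨[(a, b)], single _, .refl _⟩
    · obtain ⟨l', g, m⟩ := ih hl'
      by_cases ha : a = 0
      · subst ha
        exact ⟨l', g, (m.cons _).trans (.zero_cons b)⟩
      rcases g.coef with hc | ⟨b', rfl⟩
      · by_cases hb : b ∈ l'.map Prod.snd
        · obtain ⟨⟨a', b'⟩, hx, rfl⟩ := List.mem_map.1 hb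
          obtain ⟨s, t, rfl⟩ := List.append_of_mem hx
          have hp : (s ++ (a', b') :: t).Perm ((a', b') :: (s ++ t)) := List.perm_middle
          have m' : Merges ((a, b') :: l) ((a + a', b') :: (s ++ t)) :=
            ((m.cons _).trans ((Merges.of_perm hp).cons _)).trans (.add a a' b' _)
          have hn : (b' :: (s ++ t).map Prod.snd).Nodup := (hp.map Prod.snd).nodup_iff.1 g.nodup
          have hc' : ∀ x ∈ s ++ t, x.1 ≠ 0 := fun x hx => hc x (hp.mem_iff.2 (by simp [hx]))
          -- Algebraic forms do not mix zero and nonzero coefficients: a cancelled summand is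
          -- dropped, unless nothing else remains.
          by_cases h0 : a + a' = 0
          · by_cases hst : s ++ t = []
            · rw [hst] at m'
              exact ⟨_, single _, m'⟩
            · rw [h0] at m'
              exact ⟨s ++ t, ⟨hst, (List.nodup_cons.1 hn).2, .inl hc'⟩, m'.trans (.zero_cons _)⟩
          · refine ⟨(a + a', b') :: (s ++ t), ⟨by simp, hn, .inl fun x hx => ?_⟩, m'⟩
            rcases List.mem_cons.1 hx with rfl | hx
            · exact h0
            · exact hc' x hx
        · refine ⟨(a, b) :: l', ⟨by simp, List.nodup_cons.2 ⟨hb, g.nodup⟩, .inl fun x hx => ?_⟩,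
            m.cons _⟩
          rcases List.mem_cons.1 hx with rfl | hx
          · exact ha
          · exact hc x hx
      · exact ⟨[(a, b)], single _, (m.cons _).trans
          ((Merges.of_perm (List.Perm.swap _ _ _)).trans (.zero_cons b'))⟩

end LinComb

/-! ## Progress -/

/-- Lexicographic decrease of the two measures. -/
def MLt {f : Frag} (N M : Tm f) : Prop :=
  N.wt < M.wt ∨ N.wt = M.wt ∧ N.cwt 1 < M.cwt 1

/-- `cwt 2` is left out of `MLt` because a passage to an algebraic form may raise it; strict
progress is therefore required in the first two measures. -/
theorem MLt.map {f g : Frag} {N M : Tm f} (h : MLt N M) {F : Tm f → Tm g} (hF : MeasureCtx F) :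
    MLt (F N) (F M) := by
  obtain ⟨φ, mφ, hφ⟩ := hF.wt
  obtain ⟨ψ, mψ, hψ⟩ := hF.cwt 1 one_pos
  unfold MLt
  rw [hφ, hφ, hψ, hψ]
  rcases h with h | ⟨h₁, h₂⟩
  · exact .inl (mφ h)
  · exact .inr ⟨congrArg φ h₁, mψ h₂⟩

/-- The term has a reduct with smaller measures. -/
def Prog {f : Frag} (M : Tm f) : Prop := ∃ N, Red M N ∧ MLt N M

theorem Prog.map {f g : Frag} {M : Tm f} (h : Prog M) {F : Tm f → Tm g} (hF : MeasureCtx F)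
    (hr : ∀ {M N : Tm f}, Red M N → Red (F M) (F N)) : Prog (F M) :=
  let ⟨N, r, m⟩ := h
  ⟨F N, hr r, m.map hF⟩

theorem Prog.of_isSum {f : Frag} {M : Tm f} (h : Prog M) (l : List (Tm f)) {S : Tm f}
    (hS : IsSum (M :: l) S) : Prog S := by
  have : ∀ (l : List (Tm f)) {M : Tm f}, Prog M → Prog (l.foldl Tm.add M) := by
    intro l
    induction l with
    | nil => exact id
    | cons N l ih => exact fun h => ih (h.map (.addL N) (.addL N))
  cases hS
  exact this l h

/-- The term is algebraically equivalent to a term with measures that are not larger. -/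
structure Approx {f : Frag} (Γ : Ctx f) (T : Prp f) (M A : Tm f) : Prop where
  algEq : AlgEq Γ T M A
  wt : A.wt ≤ M.wt
  cwt : A.cwt 1 ≤ M.cwt 1

section Approx

variable {f : Frag} {Γ : Ctx f} {T : Prp f} {M A C : Tm f}

theorem Approx.refl (M : Tm f) : Approx Γ T M M := ⟨.refl M, le_rfl, le_rfl⟩

theorem Approx.trans (h : Approx Γ T M A) (k : Approx Γ T A C) : Approx Γ T M C :=
  ⟨h.algEq.trans k.algEq, k.wt.trans h.wt, k.cwt.trans h.cwt⟩

theorem Approx.derivable (h : Approx Γ T M A) (d : Der Γ M T) : Derivable Γ A T :=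
  h.algEq.derivable_iff.1 ⟨d⟩

theorem Approx.map {g : Frag} {Δ : Ctx g} {S : Prp g} (h : Approx Γ T M A) {F : Tm f → Tm g}
    (hF : MeasureCtx F) (hs : ∀ {M N : Tm f}, AlgStep M N → AlgStep (F M) (F N))
    (hd : ∀ {M : Tm f}, Der Γ M T → Derivable Δ (F M) S) : Approx Δ S (F M) (F A) := by
  obtain ⟨φ, mφ, hφ⟩ := hF.wt
  obtain ⟨ψ, mψ, hψ⟩ := hF.cwt 1 one_pos
  refine ⟨h.algEq.map F hs hd, ?_, ?_⟩
  · rw [hφ, hφ]; exact mφ.monotone h.wt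
  · rw [hψ, hψ]; exact mψ.monotone h.cwt

theorem approx_one_smul (h : Derivable Γ M T) : Approx Γ T M (.smul 1 M) :=
  ⟨((AlgStep.one_smul M).algEq (derivable_smul.2 h)).symm, le_rfl, by
    simp only [Tm.cwt, cf_one, one_mul, le_refl]⟩

end Approx

/-- The body of a term of the form `𝓑(m)` is not a scalar multiple. -/
def Tm.BodyOK : {f : Frag} → Tm f → Prop
  -- The grammar admits `𝓑(a • v)` as a base value although it reduces when `v` is a base value and
  -- `a ≠ 1`. Excluding it leaves `𝓑(*)` as the only base value to be met at `𝓑(1)`.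
  | _, .B (.smul _ _) => False
  | _, _ => True

/-- A base form that reduces, or that is a value. -/
def Ready {f : Frag} (b : Tm f) : Prop := Prog b ∨ Val .noncomb b ∧ b.BodyOK

/-- A linear combination of base forms that is equivalent to a term. -/
structure LinRep {f : Frag} (Γ : Ctx f) (T : Prp f) (M : Tm f) (l : List (Scal f × Tm f)) :
    Prop where
  ne_nil : l ≠ []
  form : ∀ x ∈ l, AForm .base x.2
  der : ∀ x ∈ l, Derivable Γ x.2 T
  ready : Γ = [] → ∀ x ∈ l, Ready x.2
  approx : ∀ S, IsSum (l.map fun x => .smul x.1 x.2) S → Approx Γ T M S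

section LinRep

variable {f : Frag} {Γ : Ctx f} {T : Prp f} {M : Tm f} {l l' : List (Scal f × Tm f)}

theorem IsSum.exists_smul (hl : l ≠ []) :
    ∃ S : Tm f, IsSum (l.map fun x => .smul x.1 x.2) S :=
  exists_isSum (by simpa using hl)

theorem LinRep.merge (h : LinRep Γ T M l) (m : Merges l l') (hl' : l' ≠ []) :
    LinRep Γ T M l' := by
  have mem : ∀ {p : Tm f → Prop}, (∀ x ∈ l, p x.2) → ∀ x ∈ l', p x.2 := fun hp x hx => by
    obtain ⟨y, hy, e⟩ := m.mem x hx
    rw [← e]; exact hp y hy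
  refine ⟨hl', mem h.form, mem (p := fun b => Derivable Γ b T) h.der, fun e => mem (h.ready e), fun S hS => ?_⟩
  obtain ⟨S₀, hS₀⟩ := IsSum.exists_smul h.ne_nil
  refine (h.approx S₀ hS₀).trans ⟨m.sum.algEq h.der (mem (p := fun b => Derivable Γ b T) h.der) hS₀ hS, ?_, ?_⟩
  · rw [hS.wt_eq, hS₀.wt_eq]; exact m.wt Tm.wt
  · rw [hS.cwt_eq, hS₀.cwt_eq]; exact m.cwt (Tm.cwt 1)

theorem LinRep.exists_good (h : LinRep Γ T M l) : ∃ l', GoodList l' ∧ LinRep Γ T M l' :=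
  let ⟨l', g, m⟩ := exists_goodList l h.ne_nil
  ⟨l', g, h.merge m g.ne_nil⟩

theorem GoodList.aform (g : GoodList l) (h : ∀ x ∈ l, AForm .base x.2) {S : Tm f}
    (hS : IsSum (l.map fun x => .smul x.1 x.2) S) : AForm .alg S := by
  refine .comb l _ ?_ h g.nodup ?_ hS
  · rcases g.coef with h | ⟨b, rfl⟩
    · exact .inl h
    · exact .inr (by simp)
  · rw [List.forall₂_map_right_iff]
    exact List.forall₂_same.2 fun x _ => .inl rfl

theorem Scal.one_ne_zero : (1 : Scal f) ≠ 0 := fun h => by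
  have := congrArg Scal.toComplex h
  rw [Scal.toComplex_one, Scal.toComplex_zero] at this
  exact _root_.one_ne_zero this

theorem AForm.ofBase {b : Tm f} (h : AForm .base b) : AForm .alg b :=
  .comb [(1, b)] [b] (.inl (by simpa using Scal.one_ne_zero)) (by simpa using h) (by simp) (by simp) rfl

/-- Every term is equivalent to an algebraic form. -/
theorem LinRep.exists_aform (h : LinRep Γ T M l) : ∃ A, AForm .alg A ∧ Approx Γ T M A := by
  obtain ⟨l', g, h'⟩ := h.exists_good
  obtain ⟨S, hS⟩ := IsSum.exists_smul h'.ne_nil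
  exact ⟨S, g.aform h'.form hS, h'.approx S hS⟩

theorem LinRep.of_base {b : Tm f} (d : Der Γ M T) (hb : AForm .base b) (a : Approx Γ T M b)
    (r : Γ = [] → Ready b) : ∃ l, LinRep Γ T M l := by
  refine ⟨[(1, b)], by simp, by simpa using hb, by simpa using a.derivable d, by simpa using r, ?_⟩
  rintro _ rfl
  exact a.trans (approx_one_smul (a.derivable d))

end LinRep

/-! ### Closed values -/

section Canonical

variable {f : Frag}

theorem Val.canonical_one {b : Tm f} (h : Val .noncomb b) (d : Der [] b .one) : b = .star := by
  cases h with
  | topI => cases d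
  | lam M => cases d
  | pair hv hw => cases d
  | ofBase h =>
    cases h with
    | star => rfl
    | var i => cases d with | ax h => cases h
    | tens | inl | inr | B => cases d

theorem Val.canonical_lolli {b : Tm f} {S T : Prp f} (h : Val .noncomb b)
    (d : Der [] b (.lolli S T)) : ∃ M, b = .lam M := by
  cases h with
  | topI => cases d
  | lam M => exact ⟨M, rfl⟩
  | pair hv hw => cases d
  | ofBase h =>
    cases h with
    | var i => cases d with | ax h => cases h
    | star | tens | inl | inr | B => cases d

theorem Val.canonical_tensor {b : Tm f} {S T : Prp f} (h : Val .noncomb b)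
    (d : Der [] b (.tensor S T)) : ∃ V W, b = .tens V W ∧ Val .noncomb V ∧ Val .noncomb W := by
  cases h with
  | topI => cases d
  | lam M => cases d
  | pair hv hw => cases d
  | ofBase h =>
    cases h with
    | var i => cases d with | ax h => cases h
    | tens hV hW => exact ⟨_, _, rfl, hV, hW⟩
    | star | inl | inr | B => cases d

theorem Val.canonical_top {b : Tm .pure} (h : Val .noncomb b) (d : Der [] b .top) :
    b = .topI := by
  cases h with
  | topI => rfl
  | lam M => cases d
  | pair hv hw => cases d
  | ofBase h =>
    cases h with
    | var i => cases d with | ax h => cases h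
    | star | tens => cases d

theorem Val.canonical_amp {b : Tm .pure} {P Q : Prp .pure} (h : Val .noncomb b)
    (d : Der [] b (.amp P Q)) : ∃ v w, b = .pair v w ∧ Val .full v ∧ Val .full w := by
  cases h with
  | topI => cases d
  | lam M => cases d
  | pair hv hw => exact ⟨_, _, rfl, hv, hw⟩
  | ofBase h =>
    cases h with
    | var i => cases d with | ax h => cases h
    | star | tens => cases d

theorem Val.not_zero {b : Tm .mixed} (h : Val .noncomb b) (d : Der [] b .zero) : False := by
  cases h with
  | lam M => cases d
  | ofBase h =>
    cases h with
    | var i => cases d with | ax h => cases h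
    | star | tens | inl | inr | B => cases d

theorem Val.canonical_plus {b : Tm .mixed} {A C : Prp .mixed} (h : Val .noncomb b)
    (d : Der [] b (.plus A C)) : ∃ v, (b = .inl v ∨ b = .inr v) ∧ Val .noncomb v := by
  cases h with
  | lam M => cases d
  | ofBase h =>
    cases h with
    | var i => cases d with | ax h => cases h
    | inl h => exact ⟨_, .inl rfl, h⟩
    | inr h => exact ⟨_, .inr rfl, h⟩
    | star | tens | B => cases d

theorem Val.canonical_B {b : Tm .mixed} {P : Prp .pure} (h : Val .noncomb b)
    (d : Der [] b (.B P)) : ∃ v, b = .B v ∧ Val .full v := by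
  cases h with
  | lam M => cases d
  | ofBase h =>
    cases h with
    | var i => cases d with | ax h => cases h
    | B h => exact ⟨_, rfl, h⟩
    | star | tens | inl | inr => cases d

end Canonical

/-! ### Linear combinations of closed values -/

/-- A linear combination of closed base values that is not a base value. -/
structure ValList {f : Frag} (T : Prp f) (M : Tm f) (l : List (Scal f × Tm f)) : Prop where
  good : GoodList l
  form : ∀ x ∈ l, AForm .base x.2
  der : ∀ x ∈ l, Derivable [] x.2 T
  val : ∀ x ∈ l, Val .base x.2 ∧ x.2.BodyOK
  ne_single : ∀ b, l ≠ [(1, b)]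
  approx : ∀ S, IsSum (l.map fun x => .smul x.1 x.2) S → Approx [] T M S

/-- The cases of the linear combination of base forms that is equivalent to a closed term. -/
inductive Outcome {f : Frag} (T : Prp f) (M : Tm f) : Prop
  | prog (A : Tm f) (hA : AForm .alg A) (h : Approx [] T M A) (hp : Prog A)
  | single (b : Tm f) (hb : AForm .base b) (h : Approx [] T M b) (hv : Val .noncomb b)
      (hB : b.BodyOK)
  | list (l : List (Scal f × Tm f)) (h : ValList T M l)

section Outcome

variable {f : Frag} {T : Prp f} {M : Tm f} {l : List (Scal f × Tm f)}

/-- Two summands count at least `1` each, and a lone coefficient other than `1` counts `2`. This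
outweighs the single `+ 1` that remains after a commutation with abstractions or pairs. -/
theorem two_le_sum_cf (hl : l ≠ []) (h1 : ∀ b, l ≠ [(1, b)]) :
    2 ≤ (l.map fun x => cf 1 x.1).sum := by
  rcases l with _ | ⟨x, _ | ⟨y, l⟩⟩
  · exact absurd rfl hl
  · have : x.1 ≠ 1 := fun h => h1 x.2 (by rw [← h])
    simp [cf_of_ne 1 this]
  · have := cf_pos one_pos x.1
    have := cf_pos one_pos y.1
    simp only [List.map_cons, List.sum_cons]
    omega

/-- Each `v b` is smaller than the total, unless the combination is one term with coefficient `1`.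
Multiplying by `c v` and summing gives strictness already at `k = 1`, where `mul_sum_le_sum_sq`
gives only a weak inequality. -/
theorem sum_lt_sum_sq (hl : l ≠ []) (h1 : ∀ b, l ≠ [(1, b)]) (v : Tm f → ℕ)
    (hv : ∀ b, 0 < v b) : (l.map fun x => cf 1 x.1 * v x.2 ^ 2).sum <
      (l.map fun x => cf 1 x.1 * v x.2).sum ^ 2 := by
  have H : ∀ x ∈ l, v x.2 < (l.map fun x => cf 1 x.1 * v x.2).sum := by
    intro x hx
    obtain ⟨s, t, rfl⟩ := List.append_of_mem hx
    rw [(List.perm_middle.map _).sum_eq, List.map_cons, List.sum_cons]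
    have h2 := hv x.2
    by_cases hx1 : x.1 = 1
    · have : s ++ t ≠ [] := fun h => by
        obtain ⟨rfl, rfl⟩ := List.append_eq_nil_iff.1 h
        exact h1 x.2 (by rw [← hx1]; rfl)
      have := sum_pos_of_ne_nil this (v := fun x => cf 1 x.1 * v x.2)
        fun x => Nat.mul_pos (cf_pos one_pos _) (hv _)
      rw [hx1, cf_one]
      omega
    · rw [cf_of_ne 1 hx1]
      omega
  rw [sq, ← List.sum_map_mul_right]
  refine List.sum_lt_sum_of_ne_nil hl _ _ fun x hx => ?_
  rw [sq, ← mul_assoc]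
  exact Nat.mul_lt_mul_of_pos_left (H x hx) (Nat.mul_pos (cf_pos one_pos _) (hv _))

theorem exists_map_eq {X Y Z : Type} (g : Y → Z) (l : List (X × Z)) (h : ∀ x ∈ l, ∃ y, x.2 = g y) :
    ∃ k : List (X × Y), l = k.map fun z => (z.1, g z.2) := by
  induction l with
  | nil => exact ⟨[], rfl⟩
  | cons x l ih =>
    obtain ⟨y, hy⟩ := h x List.mem_cons_self
    obtain ⟨k, rfl⟩ := ih fun x hx => h x (List.mem_cons_of_mem _ hx)
    exact ⟨(x.1, y) :: k, by rw [List.map_cons, ← hy]⟩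

/-- Moving the sum under one `λ` replaces the count of all coefficients, at least `2` by
`two_le_sum_cf`, by a single `+ 1`, so `cwt 1` drops strictly. -/
theorem prog_lam_list (hne : l ≠ []) (hn : (l.map Prod.snd).Nodup) (h1 : ∀ b, l ≠ [(1, b)])
    (h : ∀ x ∈ l, ∃ M, x.2 = .lam M) {S : Tm f}
    (hS : IsSum (l.map fun x => .smul x.1 x.2) S) : Prog S := by
  have h2 := two_le_sum_cf hne h1
  obtain ⟨k, rfl⟩ := exists_map_eq Tm.lam l h
  rw [List.map_map] at hS h2 hn
  obtain ⟨R, hR⟩ := IsSum.exists_smul (l := k) (by simpa using hne)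
  refine ⟨.lam R, .commLam k (List.Nodup.of_map Tm.lam (by rwa [List.map_map])) hS hR, .inr ⟨?_, ?_⟩⟩
  · rw [Tm.wt, hR.wt_eq, IsSum.wt_eq hS]; rfl
  · have : S.cwt 1 = R.cwt 1 + (k.map fun x => cf 1 x.1).sum := by
      rw [IsSum.cwt_eq 1 hS, hR.cwt_eq 1, ← List.sum_map_add]
      exact congrArg _ (List.map_congr_left fun x _ => mul_add_one _ _)
    rw [this, Tm.cwt]
    exact Nat.add_lt_add_left h2 _

theorem prog_pair_list {l : List (Scal .pure × Tm .pure)} (hne : l ≠ [])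
    (hn : (l.map Prod.snd).Nodup) (h1 : ∀ b, l ≠ [(1, b)])
    (h : ∀ x ∈ l, ∃ v w, x.2 = .pair v w ∧ Val .full v ∧ Val .full w) {S : Tm .pure}
    (hS : IsSum (l.map fun x => .smul x.1 x.2) S) : Prog S := by
  have h2 := two_le_sum_cf hne h1
  obtain ⟨k, rfl⟩ := exists_map_eq (fun z : Tm .pure × Tm .pure => Tm.pair z.1 z.2) l fun x hx =>
    let ⟨v, w, e, _⟩ := h x hx
    ⟨(v, w), e⟩
  have hk : k ≠ [] := by simpa using hne
  have hv : ∀ x ∈ k, Val .full x.2.1 ∧ Val .full x.2.2 := fun x hx => by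
    obtain ⟨v, w, e, hv, hw⟩ := h _ (List.mem_map_of_mem hx)
    cases e
    exact ⟨hv, hw⟩
  rw [List.map_map] at hS h2 hn
  obtain ⟨R₁, hR₁⟩ := exists_isSum (l := k.map fun x => Tm.smul x.1 x.2.1) (by simpa using hk)
  obtain ⟨R₂, hR₂⟩ := exists_isSum (l := k.map fun x => Tm.smul x.1 x.2.2) (by simpa using hk)
  refine ⟨.pair R₁ R₂, .commPair k hv
    (List.Nodup.of_map (fun z : Tm .pure × Tm .pure => Tm.pair z.1 z.2) (by rwa [List.map_map]))
    hS hR₁ hR₂, .inr ⟨?_, ?_⟩⟩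
  · rw [Tm.wt, hR₁.wt_eq, hR₂.wt_eq, IsSum.wt_eq hS, ← List.sum_map_add]; rfl
  · have : S.cwt 1 = R₁.cwt 1 + R₂.cwt 1 + (k.map fun x => cf 1 x.1).sum := by
      rw [IsSum.cwt_eq 1 hS, hR₁.cwt_eq 1, hR₂.cwt_eq 1, ← List.sum_map_add, ← List.sum_map_add]
      exact congrArg _ (List.map_congr_left fun x _ => by
        simp only [Tm.cwt]; ring)
    rw [this, Tm.cwt]
    exact Nat.add_lt_add_left h2 _

/-- All summands equal `⟨⟩` and they are pairwise distinct, so there is only one, and its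
coefficient is not `1`. -/
theorem prog_top_list {l : List (Scal .pure × Tm .pure)} (hne : l ≠ [])
    (hn : (l.map Prod.snd).Nodup) (h1 : ∀ b, l ≠ [(1, b)])
    (h : ∀ x ∈ l, x.2 = .topI) {S : Tm .pure}
    (hS : IsSum (l.map fun x => .smul x.1 x.2) S) : Prog S := by
  rcases l with _ | ⟨⟨a, b⟩, _ | ⟨y, l⟩⟩
  · exact absurd rfl hne
  · cases h _ List.mem_cons_self
    cases hS
    have ha : a ≠ 1 := fun h => h1 .topI (by rw [h])
    exact ⟨.topI, .commTop a, .inr ⟨rfl, by simp [Tm.cwt, cf_of_ne 1 ha]⟩⟩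
  · have h3 := h y (by simp)
    cases h _ List.mem_cons_self
    simp [h3] at hn

/-- If no base form progresses, all are values. Either the combination is a single value with
coefficient `1`, or all its terms are base values, or one of them is `⟨⟩`, an abstraction or a pair.
In the last case the proposition forces all the others to have the same shape, and a commutation
with sums applies. -/
theorem LinRep.outcome (h : LinRep [] T M l) : Outcome T M := by
  obtain ⟨l, g, h⟩ := h.exists_good
  by_cases hp : ∃ x ∈ l, Prog x.2
  · obtain ⟨x, hx, hp⟩ := hp
    obtain ⟨s, t, rfl⟩ := List.append_of_mem hx
    -- Evaluation contexts reach only the left summand of a sum, so the term that reduces is moved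
    -- to the front.
    have hq : (s ++ x :: t).Perm (x :: (s ++ t)) := List.perm_middle
    have h' := h.merge (.of_perm hq) (by simp)
    obtain ⟨S, hS⟩ := IsSum.exists_smul h'.ne_nil
    refine .prog S (GoodList.aform ⟨h'.ne_nil, (hq.map _).nodup_iff.1 g.nodup, ?_⟩ h'.form hS)
      (h'.approx S hS) ((hp.map (.smul x.1) (.smul x.1)).of_isSum _ hS)
    rcases g.coef with hc | ⟨b, hb⟩
    · exact .inl fun y hy => hc y (hq.mem_iff.2 hy)
    · rw [hb] at hq
      exact .inr ⟨b, (List.singleton_perm.1 hq).symm⟩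
  push Not at hp
  have hr : ∀ x ∈ l, Val .noncomb x.2 ∧ x.2.BodyOK := fun x hx =>
    (h.ready rfl x hx).resolve_left (hp x hx)
  by_cases h1 : ∃ b, l = [(1, b)]
  · obtain ⟨b, rfl⟩ := h1
    have hm : (1, b) ∈ [((1 : Scal f), b)] := List.mem_cons_self
    refine .single b (h.form _ hm) ((h.approx _ rfl).trans
      ⟨(approx_one_smul (h.der _ hm)).algEq.symm, ?_, ?_⟩) (hr _ hm).1 (hr _ hm).2
    · exact le_rfl
    · show b.cwt 1 ≤ cf 1 (1 : Scal f) * b.cwt 1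
      rw [cf_one, one_mul]
  push Not at h1
  by_cases hb : ∀ x ∈ l, Val .base x.2
  · exact .list l ⟨g, h.form, h.der, fun x hx => ⟨hb x hx, (hr x hx).2⟩, h1, h.approx⟩
  push Not at hb
  obtain ⟨x, hx, hb⟩ := hb
  obtain ⟨S, hS⟩ := IsSum.exists_smul h.ne_nil
  refine .prog S (g.aform h.form hS) (h.approx S hS) ?_
  obtain ⟨d⟩ := h.der x hx
  have hvx := (hr x hx).1
  -- The non-base value `b` reveals the outermost connective of `T`, and canonical forms then
  -- describe the other summands.
  generalize x.2 = b at *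
  cases hvx with
  | topI =>
    cases d
    refine prog_top_list h.ne_nil g.nodup h1 (fun y hy => ?_) hS
    obtain ⟨d⟩ := h.der y hy
    exact (hr y hy).1.canonical_top d
  | lam N =>
    cases d
    refine prog_lam_list h.ne_nil g.nodup h1 (fun y hy => ?_) hS
    obtain ⟨d⟩ := h.der y hy
    exact (hr y hy).1.canonical_lolli d
  | pair hv hw =>
    cases d
    refine prog_pair_list h.ne_nil g.nodup h1 (fun y hy => ?_) hS
    obtain ⟨d⟩ := h.der y hy
    exact (hr y hy).1.canonical_amp d
  | ofBase hv => exact absurd hv hb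

/-- The grammar of values puts the terms with coefficients other than `1` first and writes the
others bare, so the list is partitioned accordingly. The last clause says that a combination of at
least two terms becomes a genuine sum, as is needed for `BodyOK` under `𝓑`. -/
theorem ValList.isValue (h : ValList T M l) : ∃ V, Val .full V ∧ AForm .alg V ∧ Approx [] T M V ∧
    (2 ≤ l.length → ∀ a N, V ≠ .smul a N) := by
  classical
  rcases h.good.coef with hc | ⟨b, rfl⟩
  · set l₁ := l.filter fun x => decide (x.1 ≠ 1)
    set l₂ := l.filter fun x => !decide (x.1 ≠ 1)
    have hp : (l₁ ++ l₂).Perm l := List.filter_append_perm _ l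
    have hm₁ : ∀ x ∈ l₁, x ∈ l ∧ x.1 ≠ 1 := fun x hx => by simpa [l₁] using hx
    have hm₂ : ∀ x ∈ l₂, x ∈ l ∧ x.1 = 1 := fun x hx => by simpa [l₂] using hx
    have hlen : (l₁.map (fun x => Tm.smul x.1 x.2) ++ l₂.map Prod.snd).length = l.length := by
      simpa using hp.length_eq
    obtain ⟨V, hV⟩ := exists_isSum (l := l₁.map (fun x => Tm.smul x.1 x.2) ++ l₂.map Prod.snd)
      fun h0 => by
        rw [h0] at hlen
        exact h.good.ne_nil (List.length_eq_zero_iff.1 hlen.symm)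
    have hn : ((l₁ ++ l₂).map Prod.snd).Nodup := (hp.map _).nodup_iff.2 h.good.nodup
    have hsum : ∀ {E : Type} [AddCommMonoid E] (w : Tm f → E) (v : Scal f × Tm f → E),
        (∀ x ∈ l, w (.smul x.1 x.2) = v x) → (∀ x ∈ l, x.1 = 1 → w x.2 = v x) →
        ((l₁.map (fun x => Tm.smul x.1 x.2) ++ l₂.map Prod.snd).map w).sum = (l.map v).sum := by
      intro E _ w v h₁ h₂
      rw [← (hp.map v).sum_eq, List.map_append, List.map_append, List.map_map, List.map_map]
      congr 2
      · exact List.map_congr_left fun x hx => h₁ x (hm₁ x hx).1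
      · exact List.map_congr_left fun x hx => h₂ x (hm₂ x hx).1 (hm₂ x hx).2
    obtain ⟨S, hS⟩ := IsSum.exists_smul h.good.ne_nil
    have dS : Derivable [] S T := hS.derivable_smul.2 h.der
    have dV : Derivable [] V T := hV.derivable_iff.2 fun M hM => by
      rcases List.mem_append.1 hM with hM | hM
      · obtain ⟨x, hx, rfl⟩ := List.mem_map.1 hM
        exact derivable_smul.2 (h.der x (hm₁ x hx).1)
      · obtain ⟨x, hx, rfl⟩ := List.mem_map.1 hM
        exact h.der x (hm₂ x hx).1
    refine ⟨V, .comb l₁ (l₂.map Prod.snd) (fun x hx => ⟨hc x (hm₁ x hx).1, (hm₁ x hx).2⟩)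
      (fun x hx => (h.val x (hm₁ x hx).1).1) ?_ (by rwa [← List.map_append]) hV,
      .comb (l₁ ++ l₂) _ (.inl fun x hx => hc x (hp.mem_iff.1 hx))
        (fun x hx => h.form x (hp.mem_iff.1 hx)) hn ?_ hV, ?_, ?_⟩
    · intro v hv
      obtain ⟨x, hx, rfl⟩ := List.mem_map.1 hv
      exact (h.val x (hm₂ x hx).1).1
    · refine List.rel_append ?_ ?_
      · rw [List.forall₂_map_right_iff]
        exact List.forall₂_same.2 fun x _ => .inl rfl
      · rw [List.forall₂_map_right_iff]
        exact List.forall₂_same.2 fun x hx => .inr ⟨(hm₂ x hx).2, rfl⟩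
    · refine (h.approx S hS).trans ⟨?_, ?_, ?_⟩
      · have : Nonempty (TmOf ([] : Ctx f) T) := ⟨⟨S, dS⟩⟩
        rw [← cls_eq_iff dS dV, hS.cls_smul_eq h.der, hV.cls_eq dV,
          hsum (cls [] T) (fun x => x.1 • cls [] T x.2)]
        · exact fun x hx => cls_smul _ (h.der x hx)
        · exact fun x hx h1 => by rw [h1, one_smul]
      · rw [hS.wt_eq, hV.map_eq_sum Tm.wt fun _ _ => rfl, hsum Tm.wt fun x => x.2.wt]
        · exact fun x hx => rfl
        · exact fun x hx h1 => rfl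
      · rw [hS.cwt_eq 1, hV.map_eq_sum (Tm.cwt 1) fun _ _ => rfl,
          hsum (Tm.cwt 1) fun x => cf 1 x.1 * x.2.cwt 1]
        · exact fun x hx => rfl
        · exact fun x hx h1 => by rw [h1, cf_one, one_mul]
    · intro h2 a N
      rw [← hlen] at h2
      revert hV h2
      generalize l₁.map (fun x => Tm.smul x.1 x.2) ++ l₂.map Prod.snd = ts
      intro hV h2
      rcases List.eq_nil_or_concat ts with rfl | ⟨L, N', rfl⟩
      · exact hV.elim
      · rw [List.concat_eq_append] at hV h2
        have hL : L ≠ [] := by rintro rfl; simp at h2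
        obtain ⟨S', -, rfl⟩ := (isSum_append_singleton hL).1 hV
        simp
  · refine ⟨.smul 0 b, .zeros [b] (fun v hv => ?_) (by simp) rfl,
      h.good.aform h.form rfl, h.approx _ rfl, fun h2 => absurd h2 (by simp)⟩
    rw [List.mem_singleton.1 hv]
    exact (h.val _ List.mem_cons_self).1

theorem Outcome.prog_or_value (h : Outcome T M) :
    (∃ A, AForm .alg A ∧ Approx [] T M A ∧ Prog A) ∨
      ∃ V, Val .full V ∧ AForm .alg V ∧ Approx [] T M V := by
  cases h with
  | prog A hA h hp => exact .inl ⟨A, hA, h, hp⟩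
  | single b hb h hv _ => exact .inr ⟨b, .ofNoncomb hv, .ofBase hb, h⟩
  | list l h =>
    obtain ⟨V, h₁, h₂, h₃, _⟩ := h.isValue
    exact .inr ⟨V, h₁, h₂, h₃⟩

end Outcome

/-! ## Existence of linear representations -/

section Combine

variable {f : Frag} {Γ : Ctx f} {T : Prp f} {M N : Tm f} {l k : List (Scal f × Tm f)}

theorem LinRep.of_approx (h : LinRep Γ T N l) (a : Approx Γ T M N) : LinRep Γ T M l :=
  ⟨h.ne_nil, h.form, h.der, h.ready, fun S hS => a.trans (h.approx S hS)⟩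

theorem LinRep.exists_sum (h : LinRep Γ T M l) :
    ∃ S, IsSum (l.map fun x => .smul x.1 x.2) S ∧ Approx Γ T M S :=
  let ⟨S, hS⟩ := IsSum.exists_smul h.ne_nil
  ⟨S, hS, h.approx S hS⟩

/-- Comparison of a term with a linear combination of terms. -/
theorem approx_of_sum {S : Tm f} (hM : Derivable Γ M T) (hl : ∀ x ∈ l, Derivable Γ x.2 T)
    (hS : IsSum (l.map fun x => .smul x.1 x.2) S)
    (hc : ∀ [Nonempty (TmOf Γ T)], cls Γ T M = (l.map fun x => x.1 • cls Γ T x.2).sum)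
    (hw : (l.map fun x => x.2.wt).sum ≤ M.wt)
    (hv : (l.map fun x => cf 1 x.1 * x.2.cwt 1).sum ≤ M.cwt 1) : Approx Γ T M S := by
  have : Nonempty (TmOf Γ T) := ⟨⟨M, hM⟩⟩
  refine ⟨?_, ?_, ?_⟩
  · rw [← cls_eq_iff hM (hS.derivable_smul.2 hl), hc, hS.cls_smul_eq hl]
  · rw [hS.wt_eq]; exact hw
  · rw [hS.cwt_eq 1]; exact hv

theorem LinRep.add (h : LinRep Γ T M l) (h' : LinRep Γ T N k) (d : Der Γ M T) (e : Der Γ N T) :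
    LinRep Γ T (.add M N) (l ++ k) := by
  obtain ⟨S₁, hS₁, a₁⟩ := h.exists_sum
  obtain ⟨S₂, hS₂, a₂⟩ := h'.exists_sum
  have dl : ∀ x ∈ l ++ k, Derivable Γ x.2 T := fun x hx =>
    (List.mem_append.1 hx).elim (h.der x) (h'.der x)
  have d₁ := a₁.derivable d
  have d₂ := a₂.derivable e
  refine ⟨by simp [h.ne_nil], fun x hx => (List.mem_append.1 hx).elim (h.form x) (h'.form x), dl,
    fun hΓ x hx => (List.mem_append.1 hx).elim (h.ready hΓ x) (h'.ready hΓ x), fun S hS => ?_⟩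
  have a : Approx Γ T (.add M N) (.add S₁ S₂) :=
    ⟨a₁.algEq.add a₂.algEq ⟨d⟩ ⟨e⟩, add_le_add a₁.wt a₂.wt, add_le_add a₁.cwt a₂.cwt⟩
  refine a.trans (approx_of_sum (derivable_add.2 ⟨d₁, d₂⟩) dl hS ?_ ?_ ?_)
  · intro _
    rw [cls_add d₁ d₂, hS₁.cls_smul_eq h.der, hS₂.cls_smul_eq h'.der]
    simp
  · rw [Tm.wt, hS₁.wt_eq, hS₂.wt_eq]; simp
  · rw [Tm.cwt, hS₁.cwt_eq 1, hS₂.cwt_eq 1]; simp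

theorem LinRep.smul (h : LinRep Γ T M l) (a : Scal f) (d : Der Γ M T) :
    LinRep Γ T (.smul a M) (l.map fun x => (a * x.1, x.2)) := by
  obtain ⟨S₁, hS₁, a₁⟩ := h.exists_sum
  have mem : ∀ {p : Tm f → Prop}, (∀ x ∈ l, p x.2) →
      ∀ x ∈ l.map (fun x => (a * x.1, x.2)), p x.2 := fun hp x hx => by
    obtain ⟨y, hy, rfl⟩ := List.mem_map.1 hx
    exact hp y hy
  have dl := mem (p := fun b => Derivable Γ b T) h.der
  refine ⟨by simp [h.ne_nil], mem h.form, dl, fun hΓ => mem (h.ready hΓ), fun S hS => ?_⟩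
  have d₁ := a₁.derivable d
  have a' : Approx Γ T (.smul a M) (.smul a S₁) :=
    a₁.map (.smul a) (.smul a) fun d => ⟨.prod a d⟩
  refine a'.trans (approx_of_sum (derivable_smul.2 d₁) dl hS ?_ ?_ ?_)
  · intro _
    rw [cls_smul a d₁, hS₁.cls_smul_eq h.der, List.smul_sum, List.map_map, List.map_map]
    simp only [Function.comp_def, mul_smul]
  · rw [Tm.wt, hS₁.wt_eq]; simp [Function.comp_def]
  · rw [Tm.cwt, hS₁.cwt_eq 1, List.map_map, ← List.sum_map_mul_left]
    refine List.sum_le_sum fun x _ => ?_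
    rw [← mul_assoc]
    exact Nat.mul_le_mul_right _ (cf_mul_le _ _)

section Tens

variable {Γ₁ Γ₂ : Ctx f} {S : Prp f}

theorem derivable_tens (s : Split Γ Γ₁ Γ₂) (h : Derivable Γ₁ M S) (k : Derivable Γ₂ N T) :
    Derivable Γ (.tens M N) (.tensor S T) :=
  let ⟨d⟩ := h
  let ⟨e⟩ := k
  ⟨.tensI s d e⟩

variable [Nonempty (TmOf Γ (.tensor S T))]

theorem cls_tens_left (s : Split Γ Γ₁ Γ₂) (hN : Derivable Γ₂ N T) {R : Tm f}
    (hR : IsSum (l.map fun x => .smul x.1 x.2) R) (hl : ∀ x ∈ l, Derivable Γ₁ x.2 S) :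
    cls Γ (.tensor S T) (.tens R N) =
      (l.map fun x => x.1 • cls Γ (.tensor S T) (.tens x.2 N)).sum := by
  have key : ∀ {l : List (Tm f)} {R : Tm f}, IsSum l R → Derivable Γ₁ R S →
      cls Γ (.tensor S T) (.tens R N) =
        (l.map fun M => cls Γ (.tensor S T) (.tens M N)).sum := by
    intro l R h
    refine IsSum.rec_add (p := fun l R => Derivable Γ₁ R S → cls Γ (.tensor S T) (.tens R N) =
      (l.map fun M => cls Γ (.tensor S T) (.tens M N)).sum) (fun M _ => by simp)
      (fun l R M _ ih hd => ?_) h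
    obtain ⟨h₁, h₂⟩ := derivable_add.1 hd
    have t₁ := derivable_tens s h₁ hN
    have t₂ := derivable_tens s h₂ hN
    rw [(cls_eq_iff (derivable_tens s hd hN) (derivable_add.2 ⟨t₁, t₂⟩)).2
      ((AlgStep.add_tens R M N).algEq (derivable_tens s hd hN)), cls_add t₁ t₂, ih h₁]
    simp
  rw [key hR (hR.derivable_smul.2 hl), List.map_map]
  refine congrArg _ (List.map_congr_left fun x hx => ?_)
  have t := derivable_tens s (hl x hx) hN
  have t' := derivable_tens s ((derivable_smul (a := x.1)).2 (hl x hx)) hN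
  exact ((cls_eq_iff t' (derivable_smul.2 t)).2 ((AlgStep.smul_tens x.1 x.2 N).algEq t')).trans
    (cls_smul _ t)

theorem cls_tens_right (s : Split Γ Γ₁ Γ₂) (hM : Derivable Γ₁ M S) {R : Tm f}
    (hR : IsSum (l.map fun x => .smul x.1 x.2) R) (hl : ∀ x ∈ l, Derivable Γ₂ x.2 T) :
    cls Γ (.tensor S T) (.tens M R) =
      (l.map fun x => x.1 • cls Γ (.tensor S T) (.tens M x.2)).sum := by
  have key : ∀ {l : List (Tm f)} {R : Tm f}, IsSum l R → Derivable Γ₂ R T →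
      cls Γ (.tensor S T) (.tens M R) =
        (l.map fun N => cls Γ (.tensor S T) (.tens M N)).sum := by
    intro l R h
    refine IsSum.rec_add (p := fun l R => Derivable Γ₂ R T → cls Γ (.tensor S T) (.tens M R) =
      (l.map fun N => cls Γ (.tensor S T) (.tens M N)).sum) (fun M _ => by simp)
      (fun l R N _ ih hd => ?_) h
    obtain ⟨h₁, h₂⟩ := derivable_add.1 hd
    have t₁ := derivable_tens s hM h₁
    have t₂ := derivable_tens s hM h₂
    rw [(cls_eq_iff (derivable_tens s hM hd) (derivable_add.2 ⟨t₁, t₂⟩)).2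
      ((AlgStep.tens_add M R N).algEq (derivable_tens s hM hd)), cls_add t₁ t₂, ih h₁]
    simp
  rw [key hR (hR.derivable_smul.2 hl), List.map_map]
  refine congrArg _ (List.map_congr_left fun x hx => ?_)
  have t := derivable_tens s hM (hl x hx)
  have t' := derivable_tens s hM ((derivable_smul (a := x.1)).2 (hl x hx))
  exact ((cls_eq_iff t' (derivable_smul.2 t)).2 ((AlgStep.tens_smul x.1 M x.2).algEq t')).trans
    (cls_smul _ t)

end Tens

theorem Ready.tens {b c : Tm f} (h : Ready b) (k : Ready c) : Ready (.tens b c) := by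
  rcases h with h | ⟨h, -⟩
  · exact .inl (h.map (.tensL c) (.tensL c))
  · rcases k with k | ⟨k, -⟩
    · exact .inl (k.map (.tensR b) (.tensR (.ofNoncomb h)))
    · exact .inr ⟨.ofBase (.tens h k), trivial⟩

/-- A tensor is a base form only if both factors are, so the product of two combinations is
expanded. The measures are multiplicative on `⊗` in order that this expansion costs nothing. -/
theorem LinRep.tens {Γ₁ Γ₂ : Ctx f} {S : Prp f} (s : Split Γ Γ₁ Γ₂) (h : LinRep Γ₁ S M l)
    (h' : LinRep Γ₂ T N k) (d : Der Γ₁ M S) (e : Der Γ₂ N T) :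
    LinRep Γ (.tensor S T) (.tens M N)
      (l.flatMap fun x => k.map fun y => (x.1 * y.1, .tens x.2 y.2)) := by
  obtain ⟨S₁, hS₁, a₁⟩ := h.exists_sum
  obtain ⟨S₂, hS₂, a₂⟩ := h'.exists_sum
  have d₁ := a₁.derivable d
  have d₂ := a₂.derivable e
  have mem : ∀ {p : Tm f → Prop}, (∀ x ∈ l, ∀ y ∈ k, p (.tens x.2 y.2)) →
      ∀ z ∈ l.flatMap (fun x => k.map fun y => (x.1 * y.1, Tm.tens x.2 y.2)), p z.2 :=
    fun hp z hz => by
      obtain ⟨x, hx, hz⟩ := List.mem_flatMap.1 hz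
      obtain ⟨y, hy, rfl⟩ := List.mem_map.1 hz
      exact hp x hx y hy
  have dl := mem (p := fun b => Derivable Γ b (.tensor S T))
    fun x hx y hy => derivable_tens s (h.der x hx) (h'.der y hy)
  refine ⟨?_, mem fun x hx y hy => .tens (h.form x hx) (h'.form y hy), dl, ?_, fun R hR => ?_⟩
  · obtain ⟨x, hx⟩ := List.exists_mem_of_ne_nil l h.ne_nil
    obtain ⟨y, hy⟩ := List.exists_mem_of_ne_nil k h'.ne_nil
    exact List.ne_nil_of_mem (List.mem_flatMap.2 ⟨x, hx, List.mem_map_of_mem hy⟩)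
  · rintro rfl
    cases s
    exact mem fun x hx y hy => (h.ready rfl x hx).tens (h'.ready rfl y hy)
  have a : Approx Γ (.tensor S T) (.tens M N) (.tens S₁ S₂) :=
    (a₁.map (.tensL N) (.tensL N) fun d => ⟨.tensI s d e⟩).trans
      (a₂.map (.tensR S₁) (.tensR S₁) fun d => derivable_tens s d₁ ⟨d⟩)
  refine a.trans (approx_of_sum (derivable_tens s d₁ d₂) dl hR ?_ ?_ ?_)
  · intro _
    rw [cls_tens_left s d₂ hS₁ h.der, List.map_flatMap, List.flatMap_def, List.sum_flatten,
      List.map_map]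
    refine congrArg _ (List.map_congr_left fun x hx => ?_)
    rw [cls_tens_right s (h.der x hx) hS₂ h'.der, List.smul_sum, List.map_map,
      Function.comp_apply, List.map_map]
    simp only [Function.comp_def, mul_smul]
  · rw [Tm.wt, hS₁.wt_eq, hS₂.wt_eq, ← sum_flatMap_mul, List.map_flatMap]
    simp only [List.map_map, Function.comp_def, Tm.wt, le_refl]
  · rw [Tm.cwt, hS₁.cwt_eq 1, hS₂.cwt_eq 1, ← sum_flatMap_mul, List.map_flatMap,
      List.flatMap_def, List.flatMap_def, List.sum_flatten, List.sum_flatten, List.map_map,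
      List.map_map]
    refine List.sum_le_sum fun x _ => ?_
    simp only [List.map_map, Function.comp_def, Tm.cwt]
    refine List.sum_le_sum fun y _ => ?_
    calc _ ≤ _ := Nat.mul_le_mul_right _ (cf_mul_le _ _)
      _ = _ := by ring

end Combine

/-! ### Constructors applied to an evaluated argument. -/

section Cut

variable {f g : Frag}

theorem Prog.of_wt {M N : Tm f} (r : Red M N) (h : N.wt < M.wt) : Prog M := ⟨N, r, .inl h⟩

/-- Distributing `F` over the combination keeps `wt`, on which `F` acts linearly, and lowers `cwt 1`
by `sum_lt_sum_sq`, since `F` squares it. -/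
theorem ValList.prog_comm {T : Prp f} {M S : Tm f} {l : List (Scal f × Tm f)} (h : ValList T M l)
    (hS : IsSum (l.map fun x => .smul x.1 x.2) S) {F : Tm f → Tm f} {c e : ℕ} (hc : 0 < c)
    (hF : ∀ N, (F N).cwt 1 = N.cwt 1 ^ 2 * c) (hw : ∀ N, (F N).wt = N.wt * e)
    (r : ∀ R, IsSum (l.map fun x => .smul x.1 (F x.2)) R → Red (F S) R) : Prog (F S) := by
  obtain ⟨R, hR⟩ := exists_isSum (l := l.map fun x => Tm.smul x.1 (F x.2))
    (by simpa using h.good.ne_nil)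
  refine ⟨R, r R hR, .inr ⟨?_, ?_⟩⟩
  · rw [hR.wt_eq, hw, hS.wt_eq, ← List.sum_map_mul_right]
    simp only [hw]
  · rw [hR.cwt_eq 1, hF, hS.cwt_eq 1]
    simp only [hF, ← mul_assoc]
    rw [List.sum_map_mul_right]
    exact Nat.mul_lt_mul_of_pos_right
      (sum_lt_sum_sq h.good.ne_nil h.ne_single (Tm.cwt 1) fun b => b.cwt_pos one_pos) hc

theorem ValList.not_of_type {T : Prp f} {M : Tm f} {l : List (Scal f × Tm f)} (h : ValList T M l)
    (hT : ∀ b, Val .base b → Der [] b T → False) : False := by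
  obtain ⟨x, hx⟩ := List.exists_mem_of_ne_nil l h.good.ne_nil
  obtain ⟨d⟩ := h.der x hx
  exact hT x.2 (h.val x hx).1 d

theorem GoodList.eq_singleton {l : List (Scal f × Tm f)} (h : GoodList l) {u : Tm f}
    (hu : ∀ x ∈ l, x.2 = u) : ∃ a, l = [(a, u)] := by
  have hn := h.nodup
  have hne := h.ne_nil
  rcases l with _ | ⟨⟨a, b⟩, _ | ⟨⟨a', b'⟩, l⟩⟩
  · exact absurd rfl hne
  · cases hu _ List.mem_cons_self
    exact ⟨a, rfl⟩
  · have := hu (a, b) (by simp)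
    have := hu (a', b') (by simp)
    simp_all

variable {Γ₁ : Ctx g} {Γ : Ctx f} {S : Prp g} {T : Prp f} {M : Tm g} {F : Tm g → Tm f}

theorem exists_linRep_of_ready (hF : MeasureCtx F)
    (hs : ∀ {M N : Tm g}, AlgStep M N → AlgStep (F M) (F N))
    (hd : ∀ {M : Tm g}, Der Γ₁ M S → Derivable Γ (F M) T)
    (hf : ∀ {A : Tm g}, AForm .alg A → AForm .base (F A)) (d : Der Γ₁ M S)
    (h : ∃ A, AForm .alg A ∧ Approx Γ₁ S M A ∧ (Γ = [] → Ready (F A))) :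
    ∃ l, LinRep Γ T (F M) l := by
  obtain ⟨A, hA, a, r⟩ := h
  obtain ⟨d'⟩ := hd d
  exact LinRep.of_base d' (hf hA) (a.map hF hs hd) r

/-- Terms with an evaluated subterm. -/
theorem exists_linRep_of_outcome (hF : MeasureCtx F)
    (hs : ∀ {M N : Tm g}, AlgStep M N → AlgStep (F M) (F N))
    (hd : ∀ {M : Tm g}, Der Γ₁ M S → Derivable Γ (F M) T)
    (hf : ∀ {A : Tm g}, AForm .alg A → AForm .base (F A))
    (hr : ∀ {M N : Tm g}, Red M N → Red (F M) (F N)) (hΓ : Γ = [] → Γ₁ = [])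
    -- The second alternative is for `δ₁`, whose rule expects an explicit coefficient on `*`.
    (single : Γ = [] → ∀ b, Val .noncomb b → b.BodyOK → Der [] b S → Ready (F b) ∨ Ready (F (.smul 1 b)))
    (list : Γ = [] → ∀ N l V, ValList S N l → IsSum (l.map fun x => .smul x.1 x.2) V → Ready (F V))
    (d : Der Γ₁ M S) (h : ∃ l, LinRep Γ₁ S M l) : ∃ l, LinRep Γ T (F M) l := by
  refine exists_linRep_of_ready hF hs hd hf d ?_
  obtain ⟨l, h⟩ := h
  by_cases hΓ' : Γ = []
  · obtain rfl := hΓ hΓ'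
    cases h.outcome with
    | prog A hA a hp => exact ⟨A, hA, a, fun _ => .inl (hp.map hF hr)⟩
    | single b hb a hv hB =>
      obtain ⟨d'⟩ := a.derivable d
      rcases single hΓ' b hv hB d' with r | r
      · exact ⟨b, .ofBase hb, a, fun _ => r⟩
      · exact ⟨.smul 1 b, .comb [(1, b)] [.smul 1 b] (.inl (by simpa using Scal.one_ne_zero))
          (by simpa using hb) (by simp) (by simp) rfl, a.trans (approx_one_smul ⟨d'⟩), fun _ => r⟩
    | list l hl =>
      obtain ⟨V, hV⟩ := IsSum.exists_smul hl.good.ne_nil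
      exact ⟨V, hl.good.aform hl.form hV, hl.approx V hV, fun _ => list hΓ' M l V hl hV⟩
  · obtain ⟨A, hA, a⟩ := h.exists_aform
    exact ⟨A, hA, a, fun h => absurd h hΓ'⟩

end Cut

/-! ### Linear representations for each term constructor. -/

section Cases

variable {f : Frag}

theorem exists_linRep_elimOne {Γ Γ₁ Γ₂ : Ctx f} {M N : Tm f} {T : Prp f} (s : Split Γ Γ₁ Γ₂)
    (d : Der Γ₁ M .one) (e : Der Γ₂ N T) (h : ∃ l, LinRep Γ₁ .one M l)
    (k : ∃ l, LinRep Γ₂ T N l) : ∃ l, LinRep Γ T (.elimOne M N) l := by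
  obtain ⟨_, k⟩ := k
  -- The premise that is not evaluated is also put in algebraic form, because base forms require it
  -- of all their immediate subterms.
  obtain ⟨A, hA, a⟩ := k.exists_aform
  obtain ⟨e'⟩ := a.derivable e
  obtain ⟨l, hl⟩ := exists_linRep_of_outcome (F := (.elimOne · A)) (T := T) (Γ := Γ) (.elimOneL A)
    (.elimOneL A) (fun d => ⟨.oneE s d e'⟩) (.elimOne · hA) (.elimOneL A)
    (by rintro rfl; cases s; rfl)
    (fun _ b hb _ d => by
      rw [hb.canonical_one d]
      -- A bare `*` is rewritten as `1 • *`, at no cost in `wt` and `cwt 1`, to match the rule for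
      -- `δ₁`.
      exact .inr (.inl (.of_wt (.one 1 A) (Tm.wt_one_lt 1 A))))
    (fun _ N l V hl hV => by
      obtain ⟨a, rfl⟩ := hl.good.eq_singleton fun x hx =>
        let ⟨d⟩ := hl.der x hx
        (Val.ofBase (hl.val x hx).1).canonical_one d
      cases hV
      exact .inl (.of_wt (.one a A) (Tm.wt_one_lt a A))) d h
  exact ⟨l, hl.of_approx (a.map (.elimOneR M) (.elimOneR M) fun e => ⟨.oneE s d e⟩)⟩

theorem exists_linRep_elimTens {Γ Γ₁ Γ₂ : Ctx f} {M N : Tm f} {S₁ S₂ T : Prp f}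
    (s : Split Γ Γ₁ Γ₂) (d : Der Γ₁ M (.tensor S₁ S₂)) (e : Der (some S₂ :: some S₁ :: Γ₂) N T)
    (h : ∃ l, LinRep Γ₁ (.tensor S₁ S₂) M l)
    (k : ∃ l, LinRep (some S₂ :: some S₁ :: Γ₂) T N l) : ∃ l, LinRep Γ T (.elimTens M N) l := by
  obtain ⟨_, k⟩ := k
  obtain ⟨A, hA, a⟩ := k.exists_aform
  obtain ⟨e'⟩ := a.derivable e
  obtain ⟨l, hl⟩ := exists_linRep_of_outcome (F := (.elimTens · A)) (T := T) (Γ := Γ)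
    (.elimTensL A) (.elimTensL A) (fun d => ⟨.tensE s d e'⟩) (.elimTens · hA) (.elimTens A)
    (by rintro rfl; cases s; rfl)
    (fun hΓ b hb _ d₀ => by
      subst hΓ; cases s
      obtain ⟨V, W, rfl, hV, hW⟩ := hb.canonical_tensor d₀
      exact .inl (.inl (.of_wt (.tensor A hV hW) e'.wt_tensor_lt)))
    (fun _ N l V hl hV => .inl (hl.prog_comm hV (F := (.elimTens · A)) (c := A.cwt 1)
      (e := 2 * A.wt) (A.cwt_pos one_pos) (fun N => rfl) (fun N => by simp only [Tm.wt]; ring)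
      fun R hR => .commTens l A (fun x hx => (hl.val x hx).1) hl.good.nodup hV hR)) d h
  exact ⟨l, hl.of_approx (a.map (.elimTensR M) (.elimTensR M) fun e => ⟨.tensE s d e⟩)⟩

theorem exists_linRep_elimWith₁ {Γ Γ₁ Γ₂ : Ctx .pure} {M N : Tm .pure} {P Q T : Prp .pure}
    (s : Split Γ Γ₁ Γ₂) (d : Der Γ₁ M (.amp P Q)) (e : Der (some P :: Γ₂) N T)
    (h : ∃ l, LinRep Γ₁ (.amp P Q) M l)
    (k : ∃ l, LinRep (some P :: Γ₂) T N l) : ∃ l, LinRep Γ T (.elimWith₁ M N) l := by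
  obtain ⟨_, k⟩ := k
  obtain ⟨A, hA, a⟩ := k.exists_aform
  obtain ⟨e'⟩ := a.derivable e
  obtain ⟨l, hl⟩ := exists_linRep_of_outcome (F := (.elimWith₁ · A)) (T := T) (Γ := Γ)
    (.elimWith₁L A) (.elimWith₁L A) (fun d => ⟨.ampE₁ s d e'⟩) (.elimWith₁ · hA) (.elimWith₁ A)
    (by rintro rfl; cases s; rfl)
    (fun hΓ b hb _ d₀ => by
      subst hΓ; cases s
      obtain ⟨v, w, rfl, hv, hw⟩ := hb.canonical_amp d₀
      exact .inl (.inl (.of_wt (.with₁ A hv hw) e'.wt_with₁_lt)))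
    -- A closed value of `P & Q` is a pair, and pairs are not base values; nontrivial combinations
    -- of pairs have already been found to reduce.
    (fun _ N l V hl hV => (hl.not_of_type fun b hb d => by
      obtain ⟨v, w, rfl, -⟩ := (Val.ofBase hb).canonical_amp d
      cases hb).elim) d h
  exact ⟨l, hl.of_approx (a.map (.elimWith₁R M) (.elimWith₁R M) fun e => ⟨.ampE₁ s d e⟩)⟩

theorem exists_linRep_elimWith₂ {Γ Γ₁ Γ₂ : Ctx .pure} {M N : Tm .pure} {P Q T : Prp .pure}
    (s : Split Γ Γ₁ Γ₂) (d : Der Γ₁ M (.amp P Q)) (e : Der (some Q :: Γ₂) N T)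
    (h : ∃ l, LinRep Γ₁ (.amp P Q) M l)
    (k : ∃ l, LinRep (some Q :: Γ₂) T N l) : ∃ l, LinRep Γ T (.elimWith₂ M N) l := by
  obtain ⟨_, k⟩ := k
  obtain ⟨A, hA, a⟩ := k.exists_aform
  obtain ⟨e'⟩ := a.derivable e
  obtain ⟨l, hl⟩ := exists_linRep_of_outcome (F := (.elimWith₂ · A)) (T := T) (Γ := Γ)
    (.elimWith₂L A) (.elimWith₂L A) (fun d => ⟨.ampE₂ s d e'⟩) (.elimWith₂ · hA) (.elimWith₂ A)
    (by rintro rfl; cases s; rfl)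
    (fun hΓ b hb _ d₀ => by
      subst hΓ; cases s
      obtain ⟨v, w, rfl, hv, hw⟩ := hb.canonical_amp d₀
      exact .inl (.inl (.of_wt (.with₂ A hv hw) e'.wt_with₂_lt)))
    (fun _ N l V hl hV => (hl.not_of_type fun b hb d => by
      obtain ⟨v, w, rfl, -⟩ := (Val.ofBase hb).canonical_amp d
      cases hb).elim) d h
  exact ⟨l, hl.of_approx (a.map (.elimWith₂R M) (.elimWith₂R M) fun e => ⟨.ampE₂ s d e⟩)⟩

theorem exists_linRep_elimPlus {Γ Γ₁ Γ₂ : Ctx .mixed} {M N O : Tm .mixed} {A C T : Prp .mixed}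
    (s : Split Γ Γ₁ Γ₂) (d : Der Γ₁ M (.plus A C)) (e : Der (some A :: Γ₂) N T)
    (e' : Der (some C :: Γ₂) O T) (h : ∃ l, LinRep Γ₁ (.plus A C) M l)
    (k : ∃ l, LinRep (some A :: Γ₂) T N l) (k' : ∃ l, LinRep (some C :: Γ₂) T O l) :
    ∃ l, LinRep Γ T (.elimPlus M N O) l := by
  obtain ⟨_, k⟩ := k
  obtain ⟨_, k'⟩ := k'
  obtain ⟨N', hN', a⟩ := k.exists_aform
  obtain ⟨O', hO', a'⟩ := k'.exists_aform
  obtain ⟨e₁⟩ := a.derivable e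
  obtain ⟨e₂⟩ := a'.derivable e'
  obtain ⟨l, hl⟩ := exists_linRep_of_outcome (F := (.elimPlus · N' O')) (T := T) (Γ := Γ)
    (.elimPlus₁ N' O') (.elimPlus₁ N' O') (fun d => ⟨.plusE s d e₁ e₂⟩)
    (.elimPlus · hN' hO') (.elimPlus N' O')
    (by rintro rfl; cases s; rfl)
    (fun hΓ b hb _ d₀ => by
      subst hΓ; cases s
      obtain ⟨v, rfl | rfl, hv⟩ := hb.canonical_plus d₀
      · exact .inl (.inl (.of_wt (.plusL N' O' (.ofNoncomb hv)) e₁.wt_plusL_lt))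
      · exact .inl (.inl (.of_wt (.plusR N' O' (.ofNoncomb hv)) e₂.wt_plusR_lt)))
    (fun _ N l V hl hV => .inl (hl.prog_comm hV (F := (.elimPlus · N' O'))
      (c := N'.cwt 1 + O'.cwt 1) (e := N'.wt + O'.wt)
      (Nat.add_pos_left (N'.cwt_pos one_pos) _) (fun N => rfl) (fun N => rfl)
      fun R hR => .commPlus l N' O' (fun x hx => (hl.val x hx).1) hl.good.nodup hV hR)) d h
  exact ⟨l, hl.of_approx
    ((a.map (.elimPlus₂ M O) (.elimPlus₂ M O) fun e => ⟨.plusE s d e e'⟩).trans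
      (a'.map (.elimPlus₃ M N') (.elimPlus₃ M N') fun e' => ⟨.plusE s d e₁ e'⟩))⟩

theorem exists_linRep_elimZero {Γ Γ₁ Γ₂ : Ctx .mixed} {M : Tm .mixed} (T : Prp .mixed)
    (s : Split Γ Γ₁ Γ₂) (d : Der Γ₁ M .zero) (h : ∃ l, LinRep Γ₁ .zero M l) :
    ∃ l, LinRep Γ T (.elimZero M) l :=
  exists_linRep_of_outcome (F := .elimZero) .elimZero .elimZero (fun d => ⟨.zeroE T s d⟩)
    .elimZero .elimZero (by rintro rfl; cases s; rfl)
    (fun _ _ hb _ d => (hb.not_zero d).elim)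
    (fun _ _ _ _ hl _ => (hl.not_of_type fun _ hb d => (Val.ofBase hb).not_zero d).elim) d h

theorem exists_linRep_inl {Γ : Ctx .mixed} {M : Tm .mixed} {A : Prp .mixed} (C : Prp .mixed)
    (d : Der Γ M A) (h : ∃ l, LinRep Γ A M l) : ∃ l, LinRep Γ (.plus A C) (.inl M) l :=
  exists_linRep_of_outcome (F := .inl) .inl .inl (fun d => ⟨.plusI₁ C d⟩) .inl .inl id
    (fun _ _ hb _ _ => .inl (.inr ⟨.ofBase (.inl hb), trivial⟩))
    (fun _ _ l _ hl hV => .inl (hl.prog_comm hV (F := .inl) (c := 1) (e := 1) one_pos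
      (fun _ => (mul_one _).symm) (fun _ => (mul_one _).symm)
      fun _ hR => .commInl l (fun x hx => (hl.val x hx).1) hl.good.nodup hV hR)) d h

theorem exists_linRep_inr {Γ : Ctx .mixed} {M : Tm .mixed} (A : Prp .mixed) {C : Prp .mixed}
    (d : Der Γ M C) (h : ∃ l, LinRep Γ C M l) : ∃ l, LinRep Γ (.plus A C) (.inr M) l :=
  exists_linRep_of_outcome (F := .inr) .inr .inr (fun d => ⟨.plusI₂ A d⟩) .inr .inr id
    (fun _ _ hb _ _ => .inl (.inr ⟨.ofBase (.inr hb), trivial⟩))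
    (fun _ _ l _ hl hV => .inl (hl.prog_comm hV (F := .inr) (c := 1) (e := 1) one_pos
      (fun _ => (mul_one _).symm) (fun _ => (mul_one _).symm)
      fun _ hR => .commInr l (fun x hx => (hl.val x hx).1) hl.good.nodup hV hR)) d h

theorem exists_linRep_tau {Γ : Ctx .mixed} {M : Tm .mixed} {P Q : Prp .pure}
    (d : Der Γ M (.tensor (.B P) (.B Q))) (h : ∃ l, LinRep Γ (.tensor (.B P) (.B Q)) M l) :
    ∃ l, LinRep Γ (.B (.tensor P Q)) (.tau M) l :=
  exists_linRep_of_outcome (F := .tau) .tau .tau (fun d => ⟨.Btens d⟩) .tau .tau id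
    (fun _ b hb _ d => by
      obtain ⟨V, W, rfl, hV, hW⟩ := hb.canonical_tensor d
      cases d with
      | tensI s d e =>
        cases s
        obtain ⟨v, rfl, hv⟩ := hV.canonical_B d
        obtain ⟨w, rfl, hw⟩ := hW.canonical_B e
        exact .inl (.inl (.of_wt (.cast hv hw) (Tm.wt_cast_lt v w))))
    (fun _ _ l _ hl hV => .inl (hl.prog_comm hV (F := .tau) (c := 1) (e := 1) one_pos
      (fun _ => (mul_one _).symm) (fun _ => (mul_one _).symm)
      fun _ hR => .commTau l (fun x hx => (hl.val x hx).1) hl.good.nodup hV hR)) d h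

theorem exists_linRep_lam {Γ : Ctx f} {M : Tm f} {S T : Prp f} (d : Der (some S :: Γ) M T)
    (h : ∃ l, LinRep (some S :: Γ) T M l) : ∃ l, LinRep Γ (.lolli S T) (.lam M) l := by
  obtain ⟨_, h⟩ := h
  obtain ⟨A, hA, a⟩ := h.exists_aform
  exact exists_linRep_of_ready (F := .lam) .lam .lam (fun d => ⟨.lolliI d⟩) .lam d
    ⟨A, hA, a, fun _ => .inr ⟨.lam A, trivial⟩⟩

theorem Tm.bodyOK_B {v : Tm .pure} (h : ∀ a N, v ≠ .smul a N) : (Tm.B v).BodyOK := by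
  cases v with
  | smul a N => exact (h a N rfl).elim
  | _ => trivial

/-- The form chosen for the body ensures `BodyOK`: a lone `c • b` has `c ≠ 1` and reduces by
`commB`, a longer combination is a sum, and a non-combination value is no multiple. -/
theorem exists_linRep_B {Γ : Ctx .mixed} {m : Tm .pure} {P : Prp .pure} (s : Γ.Empty)
    (d : Der [] m P) (h : ∃ l, LinRep [] P m l) : ∃ l, LinRep Γ (.B P) (.B m) l := by
  refine exists_linRep_of_ready (F := .B) .B .B (fun d => ⟨.BI s d⟩) .B d ?_
  obtain ⟨_, h⟩ := h
  cases h.outcome with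
  | prog A hA a hp => exact ⟨A, hA, a, fun _ => .inl (hp.map .B .B)⟩
  | single b hb a hv _ =>
    refine ⟨b, .ofBase hb, a, fun _ => .inr ⟨.ofBase (.B (.ofNoncomb hv)), Tm.bodyOK_B ?_⟩⟩
    rintro a N rfl
    cases hv with | ofBase h => cases h
  | list l hl =>
    obtain ⟨V, hV, hA, a, hV'⟩ := hl.isValue
    rcases l with _ | ⟨⟨c, b⟩, _ | ⟨y, l⟩⟩
    · exact absurd rfl hl.good.ne_nil
    · refine ⟨.smul c b, hl.good.aform hl.form rfl, hl.approx _ rfl, fun _ => .inl ?_⟩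
      have hc : c ≠ 1 := fun h => hl.ne_single b (by rw [h])
      refine ⟨_, .commB c hc (hl.val _ List.mem_cons_self).1, .inr ⟨rfl, ?_⟩⟩
      have := cf_le_two (k := 1) (by omega) c.normSq
      simp only [Tm.cwt, cf_of_ne 1 hc]
      nlinarith [pow_pos (b.cwt_pos one_pos) 2]
    · exact ⟨V, hA, a, fun _ => .inr ⟨.ofBase (.B hV), Tm.bodyOK_B (hV' (by simp))⟩⟩

theorem exists_linRep_pair {Γ : Ctx .pure} {m n : Tm .pure} {P Q : Prp .pure} (d : Der Γ m P)
    (e : Der Γ n Q) (h : ∃ l, LinRep Γ P m l) (k : ∃ l, LinRep Γ Q n l) :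
    ∃ l, LinRep Γ (.amp P Q) (.pair m n) l := by
  obtain ⟨_, h⟩ := h
  obtain ⟨_, k⟩ := k
  have key : ∃ A B, AForm .alg A ∧ AForm .alg B ∧ Approx Γ P m A ∧ Approx Γ Q n B ∧
      (Γ = [] → Ready (.pair A B)) := by
    obtain ⟨B, hB, b⟩ := k.exists_aform
    by_cases hΓ : Γ = []
    · subst hΓ
      rcases h.outcome.prog_or_value with ⟨A, hA, a, hp⟩ | ⟨A, hv, hA, a⟩
      · exact ⟨A, B, hA, hB, a, b, fun _ => .inl (hp.map (.pairL B) (.pairL B))⟩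
      rcases k.outcome.prog_or_value with ⟨B, hB, b, hp⟩ | ⟨B, hw, hB, b⟩
      · exact ⟨A, B, hA, hB, a, b, fun _ => .inl (hp.map (.pairR A) (.pairR hv))⟩
      · exact ⟨A, B, hA, hB, a, b, fun _ => .inr ⟨.pair hv hw, trivial⟩⟩
    · obtain ⟨A, hA, a⟩ := h.exists_aform
      exact ⟨A, B, hA, hB, a, b, fun h => absurd h hΓ⟩
  obtain ⟨A, B, hA, hB, a, b, r⟩ := key
  obtain ⟨d'⟩ := a.derivable d
  exact LinRep.of_base (.ampI d e) (.pair hA hB)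
    ((a.map (.pairL n) (.pairL n) fun d => ⟨.ampI d e⟩).trans
      (b.map (.pairR A) (.pairR A) fun e => ⟨.ampI d' e⟩)) r

theorem exists_linRep_app {Γ Γ₁ Γ₂ : Ctx f} {M N : Tm f} {S T : Prp f} (s : Split Γ Γ₁ Γ₂)
    (d : Der Γ₁ M (.lolli S T)) (e : Der Γ₂ N S) (h : ∃ l, LinRep Γ₁ (.lolli S T) M l)
    (k : ∃ l, LinRep Γ₂ S N l) : ∃ l, LinRep Γ T (.app M N) l := by
  obtain ⟨_, k⟩ := k
  have key : ∃ A, AForm .alg A ∧ Approx Γ₂ S N A ∧ (Γ = [] → Prog A ∨ Val .full A) := by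
    by_cases hΓ : Γ = []
    · subst hΓ; cases s
      rcases k.outcome.prog_or_value with ⟨A, hA, a, hp⟩ | ⟨A, hv, hA, a⟩
      · exact ⟨A, hA, a, fun _ => .inl hp⟩
      · exact ⟨A, hA, a, fun _ => .inr hv⟩
    · obtain ⟨A, hA, a⟩ := k.exists_aform
      exact ⟨A, hA, a, fun h => absurd h hΓ⟩
  obtain ⟨A, hA, a, r⟩ := key
  obtain ⟨e'⟩ := a.derivable e
  obtain ⟨l, hl⟩ := exists_linRep_of_outcome (F := (.app · A)) (T := T) (Γ := Γ)
    (.appL A) (.appL A) (fun d => ⟨.lolliE s d e'⟩) (.app · hA) (.appL A)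
    (by rintro rfl; cases s; rfl)
    (fun hΓ b hb _ d₀ => by
      subst hΓ; cases s
      obtain ⟨M, rfl⟩ := hb.canonical_lolli d₀
      cases d₀ with
      | lolliI d =>
        rcases r rfl with hp | hv
        · exact .inl (.inl (hp.map (.appR _) (.appR (.ofNoncomb (.lam M)))))
        · exact .inl (.inl (.of_wt (.beta M hv) d.wt_beta_lt)))
    (fun _ N l V hl hV => (hl.not_of_type fun b hb d => by
      obtain ⟨M, rfl⟩ := (Val.ofBase hb).canonical_lolli d
      cases hb).elim) d h
  exact ⟨l, hl.of_approx (a.map (.appR M) (.appR M) fun e => ⟨.lolliE s d e⟩)⟩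

/-- Closed terms of the proposition `𝓑(P)` are equivalent to combinations of terms `𝓑(v)`. -/
theorem Outcome.B_cases {M : Tm .mixed} {P : Prp .pure} (h : Outcome (.B P) M)
    (d : Der [] M (.B P)) :
    (∃ A, AForm .alg A ∧ Approx [] (.B P) M A ∧ Prog A) ∨
      ∃ (l : List (Scal .mixed × Tm .pure)) (A : Tm .mixed), (∀ x ∈ l, Val .full x.2) ∧
        (l.map Prod.snd).Nodup ∧ IsSum (l.map fun x => .smul x.1 (.B x.2)) A ∧ AForm .alg A ∧
        Approx [] (.B P) M A := by
  cases h with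
  | prog A hA a hp => exact .inl ⟨A, hA, a, hp⟩
  | single b hb a hv _ =>
    obtain ⟨d'⟩ := a.derivable d
    obtain ⟨v, rfl, hv'⟩ := hv.canonical_B d'
    exact .inr ⟨[(1, v)], .smul 1 (.B v), by simpa using hv', by simp, rfl,
      .comb [(1, .B v)] [.smul 1 (.B v)] (.inl (by simpa using Scal.one_ne_zero))
        (by simpa using hb) (by simp) (by simp) rfl, a.trans (approx_one_smul ⟨d'⟩)⟩
  | list l hl =>
    obtain ⟨A, hA⟩ := IsSum.exists_smul hl.good.ne_nil
    have hB : ∀ x ∈ l, ∃ v, x.2 = .B v ∧ Val .full v := fun x hx => by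
      obtain ⟨d⟩ := hl.der x hx
      exact (Val.ofBase (hl.val x hx).1).canonical_B d
    have a := hl.approx A hA
    have f := hl.good.aform hl.form hA
    have hn := hl.good.nodup
    obtain ⟨k, rfl⟩ := exists_map_eq Tm.B l fun x hx => (hB x hx).imp fun _ h => h.1
    rw [List.map_map] at hA hn
    refine .inr ⟨k, A, fun x hx => ?_, List.Nodup.of_map Tm.B (by rwa [List.map_map]), hA, f, a⟩
    obtain ⟨v, e, hv⟩ := hB _ (List.mem_map_of_mem hx)
    cases e
    exact hv

theorem exists_linRep_appB {Γ Γ₁ Γ₂ : Ctx .mixed} {M N : Tm .mixed} {P Q : Prp .pure}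
    (s : Split Γ Γ₁ Γ₂) (d : Der Γ₁ M (.B (.lolli P Q))) (e : Der Γ₂ N (.B P))
    (h : ∃ l, LinRep Γ₁ (.B (.lolli P Q)) M l) (k : ∃ l, LinRep Γ₂ (.B P) N l) :
    ∃ l, LinRep Γ (.B Q) (.app M N) l := by
  obtain ⟨_, h⟩ := h
  obtain ⟨_, k⟩ := k
  have key : ∃ A B, AForm .alg A ∧ AForm .alg B ∧ Approx Γ₁ (.B (.lolli P Q)) M A ∧
      Approx Γ₂ (.B P) N B ∧ (Γ = [] → Ready (.app A B)) := by
    obtain ⟨B, hB, b⟩ := k.exists_aform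
    by_cases hΓ : Γ = []
    · subst hΓ; cases s
      rcases h.outcome.B_cases d with ⟨A, hA, a, hp⟩ | ⟨l, A, hl, nl, hA, fA, a⟩
      · exact ⟨A, B, hA, hB, a, b, fun _ => .inl (hp.map (.appL B) (.appL B))⟩
      rcases k.outcome.B_cases e with ⟨B, hB, b, hp⟩ | ⟨l', B, hl', nl', hB, fB, b⟩
      -- Reducing the argument requires the function to be a value, whereas the combination `A`
      -- above may carry explicit coefficients `1`, which values do not allow. The function is
      -- therefore represented anew.
      · rcases h.outcome.prog_or_value with ⟨A, hA, a, hq⟩ | ⟨A, hv, hA, a⟩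
        · exact ⟨A, B, hA, hB, a, b, fun _ => .inl (hq.map (.appL B) (.appL B))⟩
        · exact ⟨A, B, hA, hB, a, b, fun _ => .inl (hp.map (.appR A) (.appR hv))⟩
      · refine ⟨A, B, fA, fB, a, b, fun _ => .inl ?_⟩
        have hne : (l.flatMap fun x => l'.map fun y =>
            Tm.smul (x.1 * y.1) (.B (.app x.2 y.2))) ≠ [] := by
          obtain ⟨x, hx⟩ := List.exists_mem_of_ne_nil l (by rintro rfl; exact hA)
          obtain ⟨y, hy⟩ := List.exists_mem_of_ne_nil l' (by rintro rfl; exact hB)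
          exact List.ne_nil_of_mem (List.mem_flatMap.2 ⟨x, hx, List.mem_map_of_mem hy⟩)
        obtain ⟨R, hR⟩ := exists_isSum hne
        exact .of_wt (.commBapp l l' hl hl' nl nl' hA hB hR) (IsSum.wt_app_B_lt hA hB hR)
    · obtain ⟨A, hA, a⟩ := h.exists_aform
      exact ⟨A, B, hA, hB, a, b, fun h => absurd h hΓ⟩
  obtain ⟨A, B, hA, hB, a, b, r⟩ := key
  obtain ⟨d'⟩ := a.derivable d
  exact LinRep.of_base (.BlolliE s d e) (.app hA hB)
    ((a.map (.appL N) (.appL N) fun d => ⟨.BlolliE s d e⟩).trans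
      (b.map (.appR A) (.appR A) fun e => ⟨.BlolliE s d' e⟩)) r

/-- Every derivable term is equivalent to a linear combination of base forms that are ready. -/
theorem Der.exists_linRep {Γ : Ctx f} {M : Tm f} {T : Prp f} (d : Der Γ M T) :
    ∃ l, LinRep Γ T M l := by
  induction d with
  | ax h => exact LinRep.of_base (.ax h) (.var _) (.refl _) fun _ => .inr ⟨.ofBase (.var _), trivial⟩
  | sum d e h k =>
    obtain ⟨_, h⟩ := h
    obtain ⟨_, k⟩ := k
    exact ⟨_, h.add k d e⟩
  | prod a d h =>
    obtain ⟨_, h⟩ := h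
    exact ⟨_, h.smul a d⟩
  | topI Γ => exact LinRep.of_base (.topI Γ) .topI (.refl _) fun _ => .inr ⟨.topI, trivial⟩
  | zeroE A s d h => exact exists_linRep_elimZero A s d h
  | oneI h => exact LinRep.of_base (.oneI h) .star (.refl _) fun _ => .inr ⟨.ofBase .star, trivial⟩
  | oneE s d e h k => exact exists_linRep_elimOne s d e h k
  | lolliI d h => exact exists_linRep_lam d h
  | lolliE s d e h k => exact exists_linRep_app s d e h k
  | ampI d e h k => exact exists_linRep_pair d e h k
  | ampE₁ s d e h k => exact exists_linRep_elimWith₁ s d e h k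
  | ampE₂ s d e h k => exact exists_linRep_elimWith₂ s d e h k
  | plusI₁ C d h => exact exists_linRep_inl C d h
  | plusI₂ A d h => exact exists_linRep_inr A d h
  | plusE s d e e' h k k' => exact exists_linRep_elimPlus s d e e' h k k'
  | tensI s d e h k =>
    obtain ⟨_, h⟩ := h
    obtain ⟨_, k⟩ := k
    exact ⟨_, h.tens s k d e⟩
  | tensE s d e h k => exact exists_linRep_elimTens s d e h k
  | BI s d h => exact exists_linRep_B s d h
  | BlolliE s d e h k => exact exists_linRep_appB s d e h k
  | Btens d h => exact exists_linRep_tau d h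

end Cases

/-! ## Termination -/

section Termination

variable {f : Frag} {T : Prp f}

/-- The lexicographic order given by the three measures. -/
def MeasureLt (N M : Tm f) : Prop :=
  N.wt < M.wt ∨ N.wt = M.wt ∧ (N.cwt 1 < M.cwt 1 ∨ N.cwt 1 = M.cwt 1 ∧ N.cwt 2 < M.cwt 2)

theorem measureLt_wf : WellFounded (MeasureLt (f := f)) := by
  refine Subrelation.wf (r := InvImage (Prod.Lex (· < ·) (Prod.Lex (· < ·) (· < ·)))
    fun M : Tm f => (M.wt, M.cwt 1, M.cwt 2)) (fun {N M} h => ?_)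
    (InvImage.wf _ (WellFounded.prod_lex Nat.lt_wfRel.wf
      (WellFounded.prod_lex Nat.lt_wfRel.wf Nat.lt_wfRel.wf)))
  simpa only [InvImage, Prod.lex_def, MeasureLt] using h

theorem Dec.measureLt {N M : Tm f} (h : Dec N M) : MeasureLt N M := by
  rcases h with h | ⟨h₁, h₂, h₃⟩
  · exact .inl h
  · exact .inr ⟨h₁, h₂.lt_or_eq.imp id fun h => ⟨h, h₃⟩⟩

/-- The rearrangement does not increase the first two measures and the step lowers them strictly, so
the third measure is irrelevant. -/
theorem MLt.measureLt {N A M : Tm f} {Γ : Ctx f} (h : MLt N A) (a : Approx Γ T M A) :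
    MeasureLt N M := by
  have h₁ := a.wt
  have h₂ := a.cwt
  unfold MLt at h
  unfold MeasureLt
  omega

/-- Closed terms reduce to values, up to algebraic equivalence. -/
theorem Der.exists_hookStar {M : Tm f} (d : Der [] M T) : ∃ N, HookStar [] T M N ∧
    Derivable [] N T ∧ sem [] T N = sem [] T M ∧
    ((∃ b, AlgEq [] T N b ∧ Val .noncomb b ∧ b.BodyOK) ∨ ∃ l, ValList T N l) := by
  induction M using measureLt_wf.induction with
  | _ M ih =>
    have step : ∀ {N : Tm f}, Hook [] T M N → MeasureLt N M → Derivable [] N T →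
        sem [] T N = sem [] T M → ∃ N, HookStar [] T M N ∧ Derivable [] N T ∧
          sem [] T N = sem [] T M ∧
          ((∃ b, AlgEq [] T N b ∧ Val .noncomb b ∧ b.BodyOK) ∨ ∃ l, ValList T N l) := by
      rintro N h m ⟨e⟩ hs
      obtain ⟨L, hL, dL, sL, c⟩ := ih N m e
      exact ⟨L, .head h hL, dL, sL.trans hs, c⟩
    have red : ∀ {A N : Tm f}, Red A N → Derivable [] A T →
        Derivable [] N T ∧ sem [] T N = sem [] T A := by
      rintro A N r ⟨d⟩
      obtain ⟨e, he⟩ := r.exists_der d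
      exact ⟨⟨e⟩, by rw [sem_eq d, sem_eq e]; exact funext he⟩
    by_cases hr : ∃ N, Red M N
    · obtain ⟨N, r⟩ := hr
      obtain ⟨e, he⟩ := red r ⟨d⟩
      exact step (.red r) (r.dec d).measureLt e he
    -- From here `M` has no reduct, as clause (iii) of `↪` demands.
    obtain ⟨l, hl⟩ := d.exists_linRep
    cases hl.outcome with
    | prog A hA a hp =>
      obtain ⟨N, r, m⟩ := hp
      obtain ⟨e, he⟩ := red r (a.derivable d)
      exact step (.alg hr a.algEq hA r) (m.measureLt a) e (he.trans a.algEq.sem_eq.symm)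
    -- No further step is made: the passage to the value is left to clause (ii) of `↪`, where its
    -- final shape is chosen.
    | single b hb a hv hB => exact ⟨M, .refl, ⟨d⟩, rfl, .inl ⟨b, a.algEq, hv, hB⟩⟩
    | list l hl => exact ⟨M, .refl, ⟨d⟩, rfl, .inr ⟨l, hl⟩⟩

end Termination

/-! ## Adequacy -/

section Adequacy

variable {f : Frag} {T : Prp f}

/-- A proposition all of whose closed values are multiples of one base value. -/
structure IsUnit (T : Prp f) (u : Tm f) : Prop where
  val : Val .base u
  der : Derivable [] u T
  sem_ne : sem [] T u ≠ 0
  eq : ∀ b, Val .noncomb b → b.BodyOK → Derivable [] b T → b = u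

open Classical in
/-- The value that is equivalent to a multiple of a base value. -/
noncomputable def smulValue (a : Scal f) (u : Tm f) : Tm f := if a = 1 then u else .smul a u

theorem smulValue_val (a : Scal f) {u : Tm f} (h : Val .base u) : Val .full (smulValue a u) := by
  unfold smulValue
  split_ifs with h1
  · exact .ofNoncomb (.ofBase h)
  by_cases h0 : a = 0
  · subst h0
    exact .zeros [u] (by simpa using h) (by simp) rfl
  · exact .comb [(a, u)] [] (by simpa using ⟨h0, h1⟩) (by simpa using h) (by simp) (by simp) rfl

theorem smulValue_algEq {Γ : Ctx f} (a : Scal f) {u : Tm f} (h : Derivable Γ u T) :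
    AlgEq Γ T (.smul a u) (smulValue a u) := by
  unfold smulValue
  split_ifs with h1
  · rw [h1]
    exact (AlgStep.one_smul u).algEq (derivable_smul.2 h)
  · exact .refl _

/-- The terms in a `GoodList` are pairwise distinct, so if all of them equal `u`, the combination is
one multiple of `u`. Soundness then expresses its scalar through the denotation of `M`. -/
theorem IsUnit.exists_hookStar {u : Tm f} (h : IsUnit T u) {M : Tm f} (d : Der [] M T) :
    ∃ a, HookStar [] T M (smulValue a u) ∧ sem [] T M = Scal.toComplex a • sem [] T u := by
  obtain ⟨N, hN, dN, sN, c⟩ := d.exists_hookStar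
  have key : ∃ a, AlgEq [] T N (.smul a u) := by
    rcases c with ⟨b, hb, hv, hB⟩ | ⟨l, hl⟩
    · obtain rfl := h.eq b hv hB (hb.derivable_iff.1 dN)
      exact ⟨1, hb.trans ((AlgStep.one_smul b).algEq (derivable_smul.2 h.der)).symm⟩
    · obtain ⟨a, rfl⟩ := hl.good.eq_singleton fun x hx =>
        h.eq x.2 (.ofBase (hl.val x hx).1) (hl.val x hx).2 (hl.der x hx)
      exact ⟨a, (hl.approx _ rfl).algEq⟩
  obtain ⟨a, ha⟩ := key
  -- Since `1 • u` is not a value, the last step goes to `smulValue a u`.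
  exact ⟨a, hN.tail (.val (ha.trans (smulValue_algEq a h.der)) (smulValue_val a h.val)),
    by rw [← sN, ha.sem_eq, sem_smul a h.der]⟩

theorem isUnit_one : IsUnit (Prp.one : Prp f) .star where
  val := .star
  der := ⟨.oneI (by simp [Ctx.Empty])⟩
  sem_ne h := by
    have hE : Ctx.Empty ([] : Ctx f) := by simp [Ctx.Empty]
    have := congrFun ((sem_eq (.oneI hE)).symm.trans h) .nil
    exact one_ne_zero (congrFun ((ev_oneI hE _).symm.trans this) ())
  eq b hv _ := fun ⟨d⟩ => hv.canonical_one d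

/-- Base values in a value are pairwise distinct and at `1` all equal `*`, so there is only one;
without a scalar in front, it is `*` itself. This identifies the body of a value of `𝓑(1)`. -/
theorem Val.eq_star {v : Tm f} (h : Val .full v) (hd : Derivable [] v .one)
    (hs : ∀ a N, v ≠ .smul a N) : v = .star := by
  have star : ∀ {b : Tm f}, Val .base b → Derivable [] b .one → b = .star :=
    fun hb ⟨d⟩ => (Val.ofBase hb).canonical_one d
  cases h with
  | ofNoncomb h =>
    obtain ⟨d⟩ := hd
    exact h.canonical_one d
  | comb l r ha hl hr hn hV =>
    have dl := hV.derivable_iff.1 hd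
    rcases l with _ | ⟨⟨a, b⟩, l⟩
    · rcases r with _ | ⟨b, _ | ⟨c, r⟩⟩
      · exact hV.elim
      · cases hV
        exact star (hr _ (by simp)) hd
      · have h₁ := star (hr b (by simp)) (dl b (by simp))
        have h₂ := star (hr c (by simp)) (dl c (by simp))
        simp [h₁, h₂] at hn
    · have h₁ := star (hl _ List.mem_cons_self) (derivable_smul.1 (dl (.smul a b) (by simp)))
      rcases l with _ | ⟨⟨a', c⟩, l⟩
      · rcases r with _ | ⟨c, r⟩
        · cases hV
          exact absurd rfl (hs _ _)
        · have h₂ := star (hr c (by simp)) (dl c (by simp))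
          simp_all
      · have h₂ := star (hl (a', c) (by simp)) (derivable_smul.1 (dl (.smul a' c) (by simp)))
        simp_all
  | zeros l hl hn hV =>
    have dl := hV.derivable_iff.1 hd
    rcases l with _ | ⟨b, _ | ⟨c, l⟩⟩
    · exact hV.elim
    · cases hV
      exact absurd rfl (hs _ _)
    · have h₁ := star (hl b (by simp)) (derivable_smul.1 (dl (.smul 0 b) (by simp)))
      have h₂ := star (hl c (by simp)) (derivable_smul.1 (dl (.smul 0 c) (by simp)))
      simp [h₁, h₂] at hn

theorem isUnit_B_one : IsUnit (.B .one) (.B .star) where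
  val := .B (.ofNoncomb (.ofBase .star))
  der := ⟨.BI (by simp [Ctx.Empty]) (.oneI (by simp [Ctx.Empty]))⟩
  sem_ne h := by
    have hE : ∀ {f : Frag}, Ctx.Empty ([] : Ctx f) := by simp [Ctx.Empty]
    have := congrFun ((sem_eq (.BI hE (.oneI hE))).symm.trans h) .nil
    have := congrFun ((ev_BI hE (.oneI hE) _).symm.trans this) ((), ())
    rw [ev_oneI] at this
    exact one_ne_zero ((by simp : (1 : ℂ) = 1 * star 1).trans this)
  eq b hv hB := fun ⟨d⟩ => by
    obtain ⟨v, rfl, hv'⟩ := hv.canonical_B d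
    cases d with
    | BI _ d =>
      rw [hv'.eq_star ⟨d⟩]
      rintro a N rfl
      exact hB

theorem Observable.exists_isUnit (h : Observable T) : ∃ u, IsUnit T u := by
  cases h with
  | one => exact ⟨_, isUnit_one⟩
  | Bone => exact ⟨_, isUnit_B_one⟩

/-- Closed terms of an observable proposition with the same denotation reduce to the same value. -/
theorem Observable.exists_value (h : Observable T) {M N : Tm f} (d : Der [] M T) (e : Der [] N T)
    (hs : ev d .nil = ev e .nil) :
    ∃ V, Val .full V ∧ HookStar [] T M V ∧ HookStar [] T N V := by
  obtain ⟨u, hu⟩ := h.exists_isUnit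
  obtain ⟨a, ha, sa⟩ := hu.exists_hookStar d
  obtain ⟨b, hb, sb⟩ := hu.exists_hookStar e
  have h' : sem [] T M = sem [] T N := by
    rw [sem_eq d, sem_eq e]
    exact funext fun _ => hs
  rw [sa, sb] at h'
  -- The same vector is a multiple of the nonzero `⟦u⟧` by both scalars, so these agree.
  obtain rfl := Scal.toComplex_injective (smul_left_injective ℂ hu.sem_ne h')
  exact ⟨_, smulValue_val a hu.val, ha, hb⟩

/-- Compositionality moves the equality of denotations from `M` and `N` to `E[M]` and `E[N]`, where
the observable proposition turns it into a common value. -/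
theorem ctxEquiv_of_den_eq {M N : Tm f} (d : Der [] M T) (e : Der [] N T) (h : den d = den e) :
    CtxEquiv T M N := by
  rintro E T' hT ⟨dE⟩
  have hde : ev d .nil = ev e .nil := funext fun t => by rw [ev_nil, ev_nil, h]
  obtain ⟨d', hd⟩ := dE.exists_plug E d
  obtain ⟨e', he⟩ := dE.exists_plug E e
  exact hT.exists_value d' e' (by rw [hd, he, hde])

end Adequacy

end BImall

theorem mainTheorem3 {f : BImall.Frag} {M N : BImall.Tm f} {T : BImall.Prp f}
    (d : BImall.Der [] M T) (e : BImall.Der [] N T) (h : BImall.den d = BImall.den e) :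
    BImall.CtxEquiv T M N := by
  exact BImall.ctxEquiv_of_den_eq d e h
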